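/- **Notation.** Let $1\le p\le\infty$, $k\in\mathbb N$ ($k\ge 1$), $r\in\mathbb N_0$, $\|\cdot\|_p:=\|\cdot\|_{L_p[-1,1]}$ (essential supremum if $p=\infty$) and $\varphi(x):=\sqrt{1-x^2}$. *Spaces.* $\mathbb B_p^0:=L_p[-1,1]$, and for $r\ge1$, $\mathbb B_p^r$ is the set of functions $f$ on $(-1,1)$ such that $f^{(r-1)}$ exists and is locally absolutely continuous in $(-1,1)$ and $\|f^{(r)}\varphi^r\|_p<\infty$. *Differences.* $\Delta_h^k(F,x):=\sum_{i=0}^k\binom ki(-1)^{k-i}F\bigl(x+(i-\tfrac k2)h\bigr)$ if both $x\pm kh/2\in[-1,1]$, and $\Delta_h^k(F,x):=0$ otherwise; $\overrightarrow\Delta_h^k(F,x):=\Delta_h^k(F,x+kh/2)$ and $\overleftarrow\Delta_h^k(F,x):=\Delta_h^k(F,x-kh/2)$. *Moduli.* Let $\mathcal W_\delta(x):=\bigl((1-x-\delta\varphi(x)/2)(1+x-\delta\varphi(x)/2)\bigr)^{1/2}$ and $\mathfrak D_\delta:=\{x: 1-\delta\varphi(x)/2\ge|x|\}\setminus\{\pm1\}$.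 For $f\in\mathbb B_p^r$ and $t>0$ put $$\omega_{k,r}^\varphi(f^{(r)},t)_p:=\sup_{0\le h\le t}\bigl\|\mathcal W_{kh}^r(\cdot)\,\Delta^k_{h\varphi(\cdot)}(f^{(r)},\cdot)\bigr\|_p,$$ $$\omega_{k,r}^{*\varphi}(f^{(r)},t)_p:=\Bigl(\frac1t\int_0^t\int_{\mathfrak D_{k\tau}}\bigl|\mathcal W_{k\tau}^r(x)\Delta^k_{\tau\varphi(x)}(f^{(r)},x)\bigr|^p\,dx\,d\tau\Bigr)^{1/p}\quad(p<\infty),$$ and $\omega_{k,r}^{*\varphi}(f^{(r)},t)_\infty:=\omega_{k,r}^\varphi(f^{(r)},t)_\infty$. *$K$-functional.* $$K_{k,r}^\varphi(f^{(r)},t^k)_p:=\inf_{g\in\mathbb B_p^{k+r}}\bigl(\|(f^{(r)}-g^{(r)})\varphi^r\|_p+t^k\|g^{(k+r)}\varphi^{k+r}\|_p\bigr).$$ *Weighted Ditzian–Totik modulus.* With $t^*:=2k^2t^2$, $$\begin{aligned}\omega_\varphi^k(F,t)_{\varphi^r,p}:=&\sup_{0<h\le t}\|\varphi^r\Delta^k_{h\varphi}F\|_{L_p[-1+t^*,1-t^*]}+\sup_{0<h\le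 t^*}\|\varphi^r\overrightarrow\Delta^k_hF\|_{L_p[-1,-1+12t^*]}\\&+\sup_{0<h\le t^*}\|\varphi^r\overleftarrow\Delta^k_hF\|_{L_p[1-12t^*,1]}.\end{aligned}$$ **Theorem.** Let $k\in\mathbb N$, $r\in\mathbb N_0$ and $1\le p\le\infty$. (a) There are constants $c,C>0$ depending only on $k$, $r$ and $p$ such that for all $f\in\mathbb B_p^r$ and all $0<t\le 2/k$, $$c\,K^\varphi_{k,r}(f^{(r)},t^k)_p\le\omega^{*\varphi}_{k,r}(f^{(r)},t)_p\le\omega^\varphi_{k,r}(f^{(r)},t)_p\le C\,K^\varphi_{k,r}(f^{(r)},t^k)_p.$$ (b) Consequently, there are constants $c,C,t_0>0$ depending only on $k$, $r$ and $p$ such that for all $f\in\mathbb B_p^r$ and all $0<t\le t_0$, $$c\,\omega_\varphi^k(f^{(r)},t)_{\varphi^r,p}\le\omega^{*\varphi}_{k,r}(f^{(r)},t)_p\le\omega^\varphi_{k,r}(f^{(r)},t)_p\le C\,\omega_\varphi^k(f^{(r)},t)_{\varphi^r,p}.$$ -/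

import Mathlib

open MeasureTheory Set
open scoped ENNReal NNReal

noncomputable section

namespace DTModuli

/-- The weight `φ(x) = √(1 - x²)`. -/
def phi (x : ℝ) : ℝ := Real.sqrt (1 - x ^ 2)

/-- The norm of `L_p[-1,1]`, with values in `[0,∞]`. -/
def normP (p : ℝ≥0∞) (F : ℝ → ℝ) : ℝ≥0∞ := eLpNorm F p (volume.restrict (Icc (-1) 1))

open Classical in
/-- The `k`-th symmetric difference with step `h` on the set `J`; it is `0` unless both
end points `x ± kh/2` lie in `J`. -/
def symmDiffOn (J : Set ℝ) (k : ℕ) (h : ℝ) (F : ℝ → ℝ) (x : ℝ) : ℝ :=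
  if x + k * h / 2 ∈ J ∧ x - k * h / 2 ∈ J then
    ∑ i ∈ Finset.range (k + 1),
      (k.choose i : ℝ) * (-1) ^ (k - i) * F (x + ((i : ℝ) - (k : ℝ) / 2) * h)
  else 0

/-- The `k`-th symmetric difference on `[-1,1]`. -/
def symmDelta (k : ℕ) (h : ℝ) (F : ℝ → ℝ) (x : ℝ) : ℝ :=
  symmDiffOn (Icc (-1) 1) k h F x

/-- The `k`-th forward difference on `[-1,1]`; it is `0` unless `x` and `x + kh` lie in `[-1,1]`. -/
def forwardDelta (k : ℕ) (h : ℝ) (F : ℝ → ℝ) (x : ℝ) : ℝ :=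
  symmDelta k h F (x + k * h / 2)

/-- The `k`-th backward difference on `[-1,1]`; it is `0` unless `x` and `x - kh` lie in `[-1,1]`. -/
def backwardDelta (k : ℕ) (h : ℝ) (F : ℝ → ℝ) (x : ℝ) : ℝ :=
  symmDelta k h F (x - k * h / 2)

/-- `F ∈ AC_loc(-1,1)`: `F` is absolutely continuous on every compact subinterval of `(-1,1)`. -/
def ACLoc (F : ℝ → ℝ) : Prop :=
  ∀ a b : ℝ, -1 < a → a ≤ b → b < 1 → AbsolutelyContinuousOnInterval F a b

/-- The space `B_p^r`: `B_p^0 = L_p[-1,1]`, and for `r ≥ 1` the functions on `(-1,1)` whose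
derivative of order `r - 1` exists and is locally absolutely continuous in `(-1,1)`, and for which
`φ^r f^{(r)}` is in `L_p[-1,1]`. Only the values of `f` in `(-1,1)` (up to null sets if `r = 0`)
matter. -/
def BSpace (p : ℝ≥0∞) : ℕ → Set (ℝ → ℝ)
  | 0 => {f | MemLp f p (volume.restrict (Icc (-1) 1))}
  | r + 1 => {f | ContDiffOn ℝ r f (Ioo (-1) 1) ∧ ACLoc (iteratedDeriv r f) ∧
      MemLp (fun x => iteratedDeriv (r + 1) f x * phi x ^ (r + 1)) p
        (volume.restrict (Icc (-1) 1))}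

/-- `W_δ(x) = ((1 - x - δφ(x)/2)(1 + x - δφ(x)/2))^{1/2}`. -/
def wt (δ x : ℝ) : ℝ :=
  Real.sqrt ((1 - x - δ * phi x / 2) * (1 + x - δ * phi x / 2))

/-- `D_δ = {x : 1 - δφ(x)/2 ≥ |x|} \ {±1}`. -/
def Dom (δ : ℝ) : Set ℝ := {x | |x| ≤ 1 - δ * phi x / 2} \ {-1, 1}

/-- The modulus `ω_{k,r}^φ(F,t)_p`, to be used with `F = f^{(r)}`. -/
def modulus (k r : ℕ) (p : ℝ≥0∞) (F : ℝ → ℝ) (t : ℝ) : ℝ≥0∞ :=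
  ⨆ h ∈ Icc (0 : ℝ) t, normP p (fun x => wt (k * h) x ^ r * symmDelta k (h * phi x) F x)

open Classical in
/-- The averaged modulus `ω_{k,r}^{*φ}(F,t)_p`, to be used with `F = f^{(r)}`; for `p = ∞` it is by
convention the modulus `ω_{k,r}^φ(F,t)_∞`. -/
def avgModulus (k r : ℕ) (p : ℝ≥0∞) (F : ℝ → ℝ) (t : ℝ) : ℝ≥0∞ :=
  if p = ∞ then modulus k r ∞ F t
  else (ENNReal.ofReal (1 / t) * ∫⁻ τ in Ioc (0 : ℝ) t, ∫⁻ x in Dom (k * τ),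
    ‖wt (k * τ) x ^ r * symmDelta k (τ * phi x) F x‖ₑ ^ p.toReal) ^ (1 / p.toReal)

/-- The weighted `K`-functional `K_{k,r}^φ(F,s)_p`, to be used with `F = f^{(r)}`, `s = t^k`. -/
def KFunctional (k r : ℕ) (p : ℝ≥0∞) (F : ℝ → ℝ) (s : ℝ) : ℝ≥0∞ :=
  ⨅ g ∈ BSpace p (k + r),
    (normP p (fun x => (F x - iteratedDeriv r g x) * phi x ^ r) +
      ENNReal.ofReal s * normP p (fun x => iteratedDeriv (k + r) g x * phi x ^ (k + r)))

/-- The weighted Ditzian–Totik modulus `ω_φ^k(F,t)_{w,p}` on `[-1,1]`, with `t* = 2k²t²` and the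
end point intervals of length `12 t*`. -/
def weightedDTModulus (k : ℕ) (w : ℝ → ℝ) (p : ℝ≥0∞) (F : ℝ → ℝ) (t : ℝ) : ℝ≥0∞ :=
  let ts : ℝ := 2 * (k : ℝ) ^ 2 * t ^ 2
  (⨆ h ∈ Ioc (0 : ℝ) t, eLpNorm (fun x => w x * symmDelta k (h * phi x) F x) p
      (volume.restrict (Icc (-1 + ts) (1 - ts)))) +
  (⨆ h ∈ Ioc (0 : ℝ) ts, eLpNorm (fun x => w x * forwardDelta k h F x) p
      (volume.restrict (Icc (-1) (-1 + 12 * ts)))) +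
  (⨆ h ∈ Ioc (0 : ℝ) ts, eLpNorm (fun x => w x * backwardDelta k h F x) p
      (volume.restrict (Icc (1 - 12 * ts) 1)))

end DTModuli

end

/-!
Both moduli and the `K`-functional are compared with one local quantity: the weighted forward
differences `φ(y)^r fd k u F y`, averaged over base points `y` and steps `u` which are both taken at
the scale `φ(y)/n` with `n ~ 1/t`. All estimates between `L_p` norms are instances of Schur's test
`eLpNorm_le_of_enorm_le_lintegral` or of a change of variables with bounded density, which
work for all `1 ≤ p ≤ ∞` alike.

*Upper bounds by the `K`-functional* (`exists_modulus_le_KFunctional`,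
`exists_weightedDTModulus_le_KFunctional`). For a competitor `g` with `G = g^{(r)}` the differences of
`F - G` are bounded by its weighted norm, since the nodes `x + bφ(x)` are distributed with bounded
density (`map_add_mul_phi_le`) and `W_{kh}(x) ≤ φ` at all nodes (`wt_le_phi`). The differences of `G`
annihilate its Taylor polynomial, and the remainder is an integral operator with kernel comparable to
`h^{k-1}/φ(z)` on the pairs with `|x - z| ≤ khφ(x)/2`; `lintegral_inv_phi_right_le` and
`volume_fibre_le` are the two hypotheses of Schur's test for it (`eLpNorm_wdiff_smooth_le`). The
one-sided differences near `±1` are treated in the same way, with `√h` in place of `h`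
(`eLpNorm_phi_mul_fd_smooth_le`).

*Upper bound of the `K`-functional* (`exists_KFunctional_le_eLpNorm_weightedFd`). The interval
`[-1, 0]` is covered by cells with left end points `-1 + (i/n)²` and lengths comparable to `(i + 1)/n²`,
and `[0, 1]` by their reflections. On each cell a Whitney type estimate (`exists_whitney_polynomial`,
`exists_polynomial_eLpNorm_cell_le`) gives a polynomial of degree `< k` whose distance to `F` is
controlled by the averaged differences. Its proof is explicit: Steklov means of order `k` of `F` are
polynomials of degree `< k` up to `k`-fold primitives of `k`-th differences. The base points lie to
the right of the points where `F` is approximated, hence away from the end point, so that the weight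
can be moved inside. The polynomials are glued by smooth transitions (`glue`); the `k`-th derivative
of the result lives on the jumps between neighbouring polynomials, and it is a competitor.

*The averaged differences are bounded by the moduli.* Passing from base point and step to centre `x`
and relative step `τ = u/φ(x)` maps the measure of the averages into a multiple of the uniform measure
in `τ ∈ (0, t]` and Lebesgue measure in `x` (`map_toCenter_le`). This gives the averaged modulus
(`exists_eLpNorm_weightedFd_le_avgModulus`) and, for the cells away from the end points, the interior
term of the weighted Ditzian–Totik modulus; the boundedly many remaining cells involve only one-sided
differences with steps at most `t*` close to the end points
(`exists_eLpNorm_weightedFd_le_weightedDTModulus`).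
-/

namespace DTModuli

/-! ### Tools for `L_p` seminorms, uniform in `p` -/

section LpTools

variable {α β : Type*} [MeasurableSpace α] [MeasurableSpace β]

theorem eLpNorm_le_const_mul {μ : Measure α} {f : α → ℝ} {g : α → ℝ} {c : ℝ≥0∞} (hc : c ≠ ∞)
    {p : ℝ≥0∞} (h : ∀ᵐ x ∂μ, ‖f x‖ₑ ≤ c * ‖g x‖ₑ) : eLpNorm f p μ ≤ c * eLpNorm g p μ := by
  lift c to ℝ≥0 using hc
  exact eLpNorm_le_mul_eLpNorm_of_ae_le_mul' h p

theorem ennreal_rpow_inv_le_self {c : ℝ≥0∞} (hc : 1 ≤ c) {p : ℝ≥0∞} (hp : 1 ≤ p) :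
    c ^ (1 / p).toReal ≤ c := by
  have h1 : (1 / p).toReal ≤ 1 := by
    have : (1 / p) ≤ 1 := by simpa using hp
    simpa using ENNReal.toReal_mono ENNReal.one_ne_top this
  calc c ^ (1 / p).toReal ≤ c ^ (1 : ℝ) := ENNReal.rpow_le_rpow_of_exponent_le hc h1
    _ = c := ENNReal.rpow_one c

/-- Composition with a map whose push-forward is dominated by `c • ν` costs a factor which is
independent of `p`. -/
theorem eLpNorm_comp_le_of_map_le {μ : Measure α} {ν : Measure β} {T : α → β} {c : ℝ≥0∞}
    (hc : 1 ≤ c) {p : ℝ≥0∞} (hp : 1 ≤ p) (hT : AEMeasurable T μ) (h : μ.map T ≤ c • ν)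
    {g : β → ℝ} (hg : AEStronglyMeasurable g ν) :
    eLpNorm (fun x => g (T x)) p μ ≤ c * eLpNorm g p ν := by
  have hac : μ.map T ≪ ν :=
    (Measure.absolutelyContinuous_of_le h).trans (Measure.smul_absolutelyContinuous)
  have := eLpNorm_map_measure (p := p) (hg.mono_ac hac) hT
  calc eLpNorm (fun x => g (T x)) p μ = eLpNorm g p (μ.map T) := this.symm
    _ ≤ eLpNorm g p (c • ν) := eLpNorm_mono_measure _ h
    _ ≤ c ^ (1 / p).toReal * eLpNorm g p ν := by
        simpa using eLpNorm_smul_measure_le c g p ν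
    _ ≤ c * eLpNorm g p ν := by gcongr; exact ennreal_rpow_inv_le_self hc hp

/-- Schur's test in the form used throughout: an operator given by a family of measures `κ x`
of mass at most `c₁` whose average over `lam` is at most `c₂ μ` is bounded on all `L_p`. -/
theorem eLpNorm_le_of_enorm_le_lintegral {lam : Measure α} {μ : Measure β} (κ : α → Measure β)
    {c₁ c₂ : ℝ≥0∞} (hκ1 : ∀ᵐ x ∂lam, κ x univ ≤ c₁)
    (hκ2 : ∀ s, MeasurableSet s → ∫⁻ x, κ x s ∂lam ≤ c₂ * μ s)
    (hκm : ∀ s, MeasurableSet s → Measurable fun x => κ x s)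
    (hc₁ : c₁ ≠ ∞) (hc₂ : c₂ ≠ ∞)
    {E : α → ℝ} {g : β → ℝ} (hg : Measurable g)
    (hE : ∀ᵐ x ∂lam, ‖E x‖ₑ ≤ ∫⁻ z, ‖g z‖ₑ ∂κ x) {p : ℝ≥0∞} (hp : 1 ≤ p) :
    eLpNorm E p lam ≤ max c₁ c₂ * eLpNorm g p μ := by
  have hκ : Measurable κ := Measure.measurable_of_measurable_coe _ hκm
  have hbind : lam.bind κ ≤ c₂ • μ := by
    refine Measure.le_iff.2 fun s hs => ?_
    rw [Measure.bind_apply hs hκ.aemeasurable]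
    simpa using hκ2 s hs
  -- For `p = ∞` the null sets of `μ` are null for almost every `κ x`; for `p < ∞` Jensen's
  -- inequality for `κ x` is integrated over `lam`.
  rcases eq_or_ne p ∞ with rfl | hpt
  · rw [eLpNorm_exponent_top, eLpNorm_exponent_top]
    refine (essSup_le_of_ae_le (max c₁ c₂ * eLpNormEssSup g μ) ?_)
    have hnull : ∀ᵐ x ∂lam, ∀ᵐ z ∂κ x, ‖g z‖ₑ ≤ eLpNormEssSup g μ := by
      have h0 : ∀ᵐ z ∂(lam.bind κ), ‖g z‖ₑ ≤ eLpNormEssSup g μ :=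
        ((Measure.absolutelyContinuous_of_le hbind).trans
          Measure.smul_absolutelyContinuous).ae_le (enorm_ae_le_eLpNormEssSup g μ)
      exact Measure.ae_ae_of_ae_bind hκ.aemeasurable h0
    filter_upwards [hE, hκ1, hnull] with x hx h1 h2
    calc ‖E x‖ₑ ≤ ∫⁻ z, ‖g z‖ₑ ∂κ x := hx
      _ ≤ ∫⁻ z, eLpNormEssSup g μ ∂κ x := lintegral_mono_ae h2
      _ = eLpNormEssSup g μ * κ x univ := by simp
      _ ≤ max c₁ c₂ * eLpNormEssSup g μ := by
          rw [mul_comm]; gcongr; exact h1.trans (le_max_left _ _)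
  · have hp0 : p ≠ 0 := (zero_lt_one.trans_le hp).ne'
    have hq : 1 ≤ p.toReal := by
      simpa using ENNReal.toReal_mono hpt hp
    have hq0 : 0 < p.toReal := zero_lt_one.trans_le hq
    rw [eLpNorm_eq_lintegral_rpow_enorm_toReal hp0 hpt,
      eLpNorm_eq_lintegral_rpow_enorm_toReal hp0 hpt]
    set q := p.toReal with hqdef
    have hmeas : Measurable fun z => ‖g z‖ₑ ^ q := by fun_prop
    have hx : ∀ᵐ x ∂lam, ‖E x‖ₑ ^ q ≤ c₁ ^ (q - 1) * ∫⁻ z, ‖g z‖ₑ ^ q ∂κ x := by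
      filter_upwards [hE, hκ1] with x hx h1
      have h3 := eLpNorm_le_eLpNorm_mul_rpow_measure_univ hp
        (hg.aestronglyMeasurable (μ := κ x)) (f := g)
      rw [eLpNorm_one_eq_lintegral_enorm, eLpNorm_eq_lintegral_rpow_enorm_toReal hp0 hpt] at h3
      calc ‖E x‖ₑ ^ q ≤ (∫⁻ z, ‖g z‖ₑ ∂κ x) ^ q := by gcongr
        _ ≤ ((∫⁻ z, ‖g z‖ₑ ^ q ∂κ x) ^ (1 / q) * κ x univ ^ (1 - 1 / q)) ^ q := by
            gcongr; simpa using h3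
        _ = (∫⁻ z, ‖g z‖ₑ ^ q ∂κ x) * κ x univ ^ (q - 1) := by
            rw [ENNReal.mul_rpow_of_nonneg _ _ hq0.le, ← ENNReal.rpow_mul, ← ENNReal.rpow_mul]
            congr 1
            · rw [one_div, inv_mul_cancel₀ hq0.ne', ENNReal.rpow_one]
            · congr 1; field_simp
        _ ≤ c₁ ^ (q - 1) * ∫⁻ z, ‖g z‖ₑ ^ q ∂κ x := by
            rw [mul_comm]; gcongr
    have hfin : c₁ ^ (q - 1) ≠ ∞ := ENNReal.rpow_ne_top_of_nonneg (by linarith) hc₁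
    have hint : ∫⁻ x, ‖E x‖ₑ ^ q ∂lam ≤ c₁ ^ (q - 1) * (c₂ * ∫⁻ z, ‖g z‖ₑ ^ q ∂μ) := by
      calc ∫⁻ x, ‖E x‖ₑ ^ q ∂lam ≤ ∫⁻ x, c₁ ^ (q - 1) * ∫⁻ z, ‖g z‖ₑ ^ q ∂κ x ∂lam :=
            lintegral_mono_ae hx
        _ = c₁ ^ (q - 1) * ∫⁻ x, ∫⁻ z, ‖g z‖ₑ ^ q ∂κ x ∂lam := lintegral_const_mul' _ _ hfin
        _ = c₁ ^ (q - 1) * ∫⁻ z, ‖g z‖ₑ ^ q ∂(lam.bind κ) := by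
            rw [Measure.lintegral_bind hκ.aemeasurable hmeas.aemeasurable]
        _ ≤ c₁ ^ (q - 1) * (∫⁻ z, ‖g z‖ₑ ^ q ∂(c₂ • μ)) := by
            gcongr
        _ = _ := by rw [lintegral_smul_measure]; rfl
    calc (∫⁻ x, ‖E x‖ₑ ^ q ∂lam) ^ (1 / q)
        ≤ ((max c₁ c₂) ^ (q - 1) * ((max c₁ c₂) * ∫⁻ z, ‖g z‖ₑ ^ q ∂μ)) ^ (1 / q) := by
          refine ENNReal.rpow_le_rpow (hint.trans ?_) (by positivity)
          have h1 : c₁ ^ (q - 1) ≤ (max c₁ c₂) ^ (q - 1) :=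
            ENNReal.rpow_le_rpow (le_max_left _ _) (by linarith)
          exact mul_le_mul' h1 (mul_le_mul' (le_max_right _ _) le_rfl)
      _ = max c₁ c₂ * (∫⁻ z, ‖g z‖ₑ ^ q ∂μ) ^ (1 / q) := by
          have hm : max c₁ c₂ ≠ ∞ := by simp [hc₁, hc₂]
          have : (max c₁ c₂) ^ (q - 1) * max c₁ c₂ = (max c₁ c₂) ^ q := by
            nth_rewrite 2 [← ENNReal.rpow_one (max c₁ c₂)]
            rw [← ENNReal.rpow_add_of_nonneg _ _ (by linarith) zero_le_one]
            congr 1; ring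
          rw [← mul_assoc, this, ENNReal.mul_rpow_of_nonneg _ _ (by positivity),
            ← ENNReal.rpow_mul, mul_one_div_cancel hq0.ne', ENNReal.rpow_one]

/-- Local `L_p` estimates on the pieces `lam i` add up, provided the measures `γ i` on the right
have bounded overlap. -/
theorem eLpNorm_sum_measure_le {ι : Type*} (s : Finset ι) {lam : ι → Measure α}
    {γ : ι → Measure β} {γ' : Measure β} {C c : ℝ≥0∞} (hc : 1 ≤ c)
    (hγ : ∑ i ∈ s, γ i ≤ c • γ') {E : α → ℝ} {g : β → ℝ} {p : ℝ≥0∞} (hp : 1 ≤ p)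
    (h : ∀ i ∈ s, eLpNorm E p (lam i) ≤ C * eLpNorm g p (γ i)) :
    eLpNorm E p (∑ i ∈ s, lam i) ≤ C * c * eLpNorm g p γ' := by
  rcases eq_or_ne p ∞ with rfl | hpt
  · simp only [eLpNorm_exponent_top] at h ⊢
    have hle : ∀ i ∈ s, γ i ≤ c • γ' := fun i hi =>
      Measure.le_intro fun t ht _ => by
        have h2 : ∑ j ∈ s, γ j t ≤ (c • γ') t := by simpa using hγ t
        exact (Finset.single_le_sum (f := fun j => γ j t) (fun _ _ => zero_le) hi).trans h2
    refine essSup_le_of_ae_le _ ?_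
    rw [Filter.EventuallyLE, ae_finsetSum_measure_iff]
    intro i hi
    have h1 : eLpNormEssSup g (γ i) ≤ eLpNormEssSup g γ' :=
      essSup_mono_measure ((Measure.absolutelyContinuous_of_le (hle i hi)).trans
          Measure.smul_absolutelyContinuous)
    filter_upwards [enorm_ae_le_eLpNormEssSup E (lam i)] with x hx
    calc ‖E x‖ₑ ≤ C * eLpNormEssSup g (γ i) := hx.trans (h i hi)
      _ ≤ C * c * eLpNormEssSup g γ' := by
        rw [mul_assoc]; gcongr; exact h1.trans (le_mul_of_one_le_left zero_le hc)
  · have hp0 : p ≠ 0 := (zero_lt_one.trans_le hp).ne'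
    have hq : 1 ≤ p.toReal := by
      simpa using ENNReal.toReal_mono hpt hp
    have hq0 : 0 < p.toReal := zero_lt_one.trans_le hq
    simp only [eLpNorm_eq_lintegral_rpow_enorm_toReal hp0 hpt] at h ⊢
    set q := p.toReal with hqdef
    have h' : ∀ i ∈ s, ∫⁻ x, ‖E x‖ₑ ^ q ∂lam i ≤ C ^ q * ∫⁻ x, ‖g x‖ₑ ^ q ∂γ i := by
      intro i hi
      have := ENNReal.rpow_le_rpow (h i hi) hq0.le
      rwa [ENNReal.mul_rpow_of_nonneg _ _ hq0.le, ← ENNReal.rpow_mul, ← ENNReal.rpow_mul,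
        one_div_mul_cancel hq0.ne', ENNReal.rpow_one, ENNReal.rpow_one] at this
    have hsum : ∫⁻ x, ‖E x‖ₑ ^ q ∂(∑ i ∈ s, lam i) ≤ C ^ q * (c * ∫⁻ x, ‖g x‖ₑ ^ q ∂γ') := by
      rw [lintegral_finsetSum_measure]
      calc ∑ i ∈ s, ∫⁻ x, ‖E x‖ₑ ^ q ∂lam i ≤ ∑ i ∈ s, C ^ q * ∫⁻ x, ‖g x‖ₑ ^ q ∂γ i :=
            Finset.sum_le_sum h'
        _ = C ^ q * ∫⁻ x, ‖g x‖ₑ ^ q ∂(∑ i ∈ s, γ i) := by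
            rw [← Finset.mul_sum, lintegral_finsetSum_measure]
        _ ≤ C ^ q * ∫⁻ x, ‖g x‖ₑ ^ q ∂(c • γ') := by gcongr
        _ = _ := by rw [lintegral_smul_measure]; rfl
    calc (∫⁻ x, ‖E x‖ₑ ^ q ∂(∑ i ∈ s, lam i)) ^ (1 / q)
        ≤ (C ^ q * (c * ∫⁻ x, ‖g x‖ₑ ^ q ∂γ')) ^ (1 / q) :=
          ENNReal.rpow_le_rpow hsum (by positivity)
      _ = C * (c ^ (1 / q) * (∫⁻ x, ‖g x‖ₑ ^ q ∂γ') ^ (1 / q)) := by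
          rw [ENNReal.mul_rpow_of_nonneg _ _ (by positivity),
            ENNReal.mul_rpow_of_nonneg _ _ (by positivity), ← ENNReal.rpow_mul,
            mul_one_div_cancel hq0.ne', ENNReal.rpow_one]
      _ ≤ C * (c * (∫⁻ x, ‖g x‖ₑ ^ q ∂γ') ^ (1 / q)) := by
          gcongr
          calc c ^ (1 / q) ≤ c ^ (1 : ℝ) :=
                ENNReal.rpow_le_rpow_of_exponent_le hc (by
                  rw [div_le_one hq0]; exact hq)
            _ = c := ENNReal.rpow_one c
      _ = _ := by rw [mul_assoc]

/-- A bound for all slices `g (x, ·)` bounds the norm on the product. -/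
theorem eLpNorm_prod_le_of_slices {lam : Measure α} {ν : Measure β} [SFinite lam] [SFinite ν]
    {g : α × β → ℝ} (hg : Measurable g) {p : ℝ≥0∞} (hp : 1 ≤ p) {M c : ℝ≥0∞} (hc : 1 ≤ c)
    (hlam : lam univ ≤ c) (h : ∀ᵐ x ∂lam, eLpNorm (fun y => g (x, y)) p ν ≤ M) :
    eLpNorm g p (lam.prod ν) ≤ c * M := by
  rcases eq_or_ne p ∞ with rfl | hpt
  · simp only [eLpNorm_exponent_top] at h ⊢
    refine (essSup_le_of_ae_le M ?_).trans (le_mul_of_one_le_left zero_le hc)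
    have hms : MeasurableSet {z : α × β | ‖g z‖ₑ ≤ M} := measurableSet_le (by fun_prop)
      (by fun_prop)
    refine (Measure.ae_prod_iff_ae_ae hms).2 ?_
    filter_upwards [h] with x hx
    filter_upwards [enorm_ae_le_eLpNormEssSup (fun y => g (x, y)) ν] with y hy
    exact hy.trans hx
  · have hp0 : p ≠ 0 := (zero_lt_one.trans_le hp).ne'
    have hq : 1 ≤ p.toReal := by
      simpa using ENNReal.toReal_mono hpt hp
    have hq0 : 0 < p.toReal := zero_lt_one.trans_le hq
    simp only [eLpNorm_eq_lintegral_rpow_enorm_toReal hp0 hpt] at h ⊢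
    set q := p.toReal with hqdef
    rw [lintegral_prod _ (by fun_prop)]
    have h' : ∀ᵐ x ∂lam, ∫⁻ y, ‖g (x, y)‖ₑ ^ q ∂ν ≤ M ^ q := by
      filter_upwards [h] with x hx
      have := ENNReal.rpow_le_rpow hx hq0.le
      rwa [← ENNReal.rpow_mul, one_div_mul_cancel hq0.ne', ENNReal.rpow_one] at this
    calc (∫⁻ x, ∫⁻ y, ‖g (x, y)‖ₑ ^ q ∂ν ∂lam) ^ (1 / q)
        ≤ (∫⁻ _x, M ^ q ∂lam) ^ (1 / q) := by gcongr ?_ ^ _; exact lintegral_mono_ae h'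
      _ = M * lam univ ^ (1 / q) := by
          rw [lintegral_const, ENNReal.mul_rpow_of_nonneg _ _ (by positivity), ← ENNReal.rpow_mul,
            mul_one_div_cancel hq0.ne', ENNReal.rpow_one]
      _ ≤ M * c ^ (1 / q) := by gcongr
      _ ≤ M * c := by
          gcongr
          calc c ^ (1 / q) ≤ c ^ (1 : ℝ) :=
                ENNReal.rpow_le_rpow_of_exponent_le hc (by
                  rw [div_le_one hq0]; exact hq)
            _ = c := ENNReal.rpow_one c
      _ = _ := mul_comm _ _

theorem eLpNorm_add_measure_le (g : α → ℝ) {p : ℝ≥0∞} (hp : 1 ≤ p) (μ ν : Measure α) :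
    eLpNorm g p (μ + ν) ≤ eLpNorm g p μ + eLpNorm g p ν := by
  rcases eq_or_ne p ∞ with rfl | hpt
  · simp only [eLpNorm_exponent_top]
    refine essSup_le_of_ae_le _ ?_
    rw [Filter.EventuallyLE, ae_add_measure_iff]
    constructor
    · filter_upwards [enorm_ae_le_eLpNormEssSup g μ] with x hx
      exact hx.trans le_self_add
    · filter_upwards [enorm_ae_le_eLpNormEssSup g ν] with x hx
      exact hx.trans le_add_self
  · have hp0 : p ≠ 0 := (zero_lt_one.trans_le hp).ne'
    have hq : 1 ≤ p.toReal := by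
      simpa using ENNReal.toReal_mono hpt hp
    have hq0 : 0 < p.toReal := zero_lt_one.trans_le hq
    simp only [eLpNorm_eq_lintegral_rpow_enorm_toReal hp0 hpt]
    rw [lintegral_add_measure]
    exact ENNReal.rpow_add_le_add_rpow _ _ (by positivity) (by
      rw [div_le_one hq0]; exact hq)

end LpTools

/-! ### The weight `φ` and the maps `x ↦ x + b φ(x)` -/

theorem phi_nonneg (x : ℝ) : 0 ≤ phi x := Real.sqrt_nonneg _

theorem continuous_phi : Continuous phi := by unfold phi; fun_prop

@[fun_prop]
theorem measurable_phi : Measurable phi := continuous_phi.measurable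

theorem phi_sq {x : ℝ} (hx : |x| ≤ 1) : phi x ^ 2 = 1 - x ^ 2 := by
  unfold phi
  rw [Real.sq_sqrt]
  have := (sq_le_one_iff_abs_le_one x).2 hx
  linarith

theorem phi_pos {x : ℝ} (hx : |x| < 1) : 0 < phi x := by
  unfold phi
  have := (sq_lt_one_iff_abs_lt_one x).2 hx
  exact Real.sqrt_pos.2 (by linarith)

theorem phi_neg (x : ℝ) : phi (-x) = phi x := by simp [phi]

@[fun_prop]
theorem measurable_wt (δ : ℝ) : Measurable (wt δ) := by
  unfold wt
  fun_prop

theorem wt_nonneg (δ x : ℝ) : 0 ≤ wt δ x := Real.sqrt_nonneg _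

theorem mem_Dom_iff {δ x : ℝ} (hδ : 0 ≤ δ) :
    x ∈ Dom δ ↔ |x| < 1 ∧ |x| + δ / 2 * phi x ≤ 1 := by
  unfold Dom
  have h0 : 0 ≤ δ / 2 * phi x := mul_nonneg (by linarith) (phi_nonneg x)
  constructor
  · rintro ⟨h1, h2⟩
    simp only [mem_ofPred_eq] at h1
    have h3 : |x| + δ / 2 * phi x ≤ 1 := by linarith
    refine ⟨lt_of_le_of_ne (by linarith) ?_, h3⟩
    intro h
    rcases (abs_eq zero_le_one).1 h with rfl | rfl <;> simp at h2
  · rintro ⟨h1, h2⟩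
    refine ⟨by simp only [mem_ofPred_eq]; linarith, ?_⟩
    rintro (rfl | rfl) <;> simp at h1

theorem measurableSet_Dom (δ : ℝ) : MeasurableSet (Dom δ) := by
  unfold Dom
  refine (measurableSet_le (by fun_prop) (by fun_prop)).diff (by measurability)

/-- If `[x - aφ(x), x + aφ(x)]` fits into `[-1,1]`, then `a|φ'(x)| = a|x|/φ(x) ≤ 1/2`, so that the
maps `x ↦ x + bφ(x)` with `|b| ≤ a` have derivative at least `1/2`. -/
theorem two_mul_abs_le_phi {a x : ℝ} (hx1 : |x| < 1) (hx : |x| + a * phi x ≤ 1) :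
    2 * a * |x| ≤ phi x := by
  have hp := phi_pos hx1
  have hsq := phi_sq hx1.le
  rw [← sq_abs x] at hsq
  have h0 := abs_nonneg x
  have : (2 * a * |x|) * phi x ≤ phi x * phi x := by
    nlinarith [mul_le_mul_of_nonneg_left hx h0]
  exact le_of_mul_le_mul_right this hp

/-- `aφ` is a contraction with constant `1/2` on the points `x` for which `[x - aφ(x), x + aφ(x)]`
fits into `[-1,1]`. -/
theorem abs_phi_sub_phi_le {a x y : ℝ} (ha : 0 ≤ a) (hx1 : |x| < 1) (hx : |x| + a * phi x ≤ 1)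
    (hy1 : |y| < 1) (hy : |y| + a * phi y ≤ 1) : a * |phi x - phi y| ≤ |x - y| / 2 := by
  have h1 := two_mul_abs_le_phi hx1 hx
  have h2 := two_mul_abs_le_phi hy1 hy
  have hpx := phi_pos hx1
  have hpy := phi_pos hy1
  have e1 := phi_sq hx1.le
  have e2 := phi_sq hy1.le
  have key : |phi x - phi y| * (phi x + phi y) = |x - y| * |x + y| := by
    calc |phi x - phi y| * (phi x + phi y) = |(phi x - phi y) * (phi x + phi y)| := by
          rw [abs_mul, abs_of_pos (add_pos hpx hpy)]
      _ = |(y - x) * (x + y)| := by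
          congr 1
          linear_combination e1 - e2
      _ = |x - y| * |x + y| := by rw [abs_mul, abs_sub_comm]
  have h3 : 2 * a * |x + y| ≤ phi x + phi y := by
    have := abs_add_le x y
    nlinarith
  have : (a * |phi x - phi y|) * (phi x + phi y) ≤ (|x - y| / 2) * (phi x + phi y) := by
    rw [mul_assoc, key]
    nlinarith [mul_le_mul_of_nonneg_left h3 (abs_nonneg (x - y))]
  exact le_of_mul_le_mul_right this (add_pos hpx hpy)

theorem half_sub_le_of_mem {a b x y : ℝ} (hb : |b| ≤ a) (hx1 : |x| < 1)
    (hx : |x| + a * phi x ≤ 1) (hy1 : |y| < 1) (hy : |y| + a * phi y ≤ 1) (hxy : x ≤ y) :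
    (y - x) / 2 ≤ (y + b * phi y) - (x + b * phi x) := by
  have h := abs_phi_sub_phi_le ((abs_nonneg b).trans hb) hx1 hx hy1 hy
  have h1 : b * (phi x - phi y) ≤ a * |phi x - phi y| := by
    calc b * (phi x - phi y) ≤ |b * (phi x - phi y)| := le_abs_self _
      _ = |b| * |phi x - phi y| := abs_mul _ _
      _ ≤ _ := by gcongr
  rw [abs_of_nonpos (by linarith : x - y ≤ 0)] at h
  linarith

theorem abs_add_mul_phi_le {a b x : ℝ} (hb : |b| ≤ a) (hx : |x| + a * phi x ≤ 1) :
    |x + b * phi x| ≤ 1 := by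
  calc |x + b * phi x| ≤ |x| + |b * phi x| := abs_add_le _ _
    _ = |x| + |b| * phi x := by rw [abs_mul, abs_of_nonneg (phi_nonneg x)]
    _ ≤ |x| + a * phi x := by gcongr; exact phi_nonneg x
    _ ≤ 1 := hx

theorem hasDerivAt_phi {x : ℝ} (hx : |x| < 1) : HasDerivAt phi (-x / phi x) x := by
  have h := (sq_lt_one_iff_abs_lt_one x).2 hx
  have h1 : HasDerivAt (fun y : ℝ => 1 - y ^ 2) (-x * 2) x := by
    simpa [mul_comm] using ((hasDerivAt_pow 2 x).const_sub 1)
  have h2 := h1.sqrt (by linarith : (1 - x ^ 2) ≠ 0 |> fun h => h)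
  have e : -x * 2 / (2 * Real.sqrt (1 - x ^ 2)) = -x / phi x := by
    rw [mul_comm 2, mul_div_mul_right _ _ two_ne_zero]; rfl
  rw [e] at h2
  exact h2

/-- The nodes `x + bφ(x)` of the symmetric differences are distributed with density at most `2`:
the map is injective on `Dom δ` with derivative at least `1/2`. -/
theorem map_add_mul_phi_le {δ b : ℝ} (hδ : 0 ≤ δ) (hb : |b| ≤ δ / 2) :
    (volume.restrict (Dom δ)).map (fun x => x + b * phi x) ≤
      (2 : ℝ≥0∞) • volume.restrict (Icc (-1 : ℝ) 1) := by
  refine Measure.le_iff.2 fun s hs => ?_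
  set T : ℝ → ℝ := fun x => x + b * phi x with hT
  have hTm : Measurable T := by fun_prop
  rw [Measure.map_apply hTm hs, Measure.restrict_apply (hTm hs), Measure.smul_apply,
    Measure.restrict_apply hs]
  set A : Set ℝ := T ⁻¹' s ∩ Dom δ with hA
  have hAm : MeasurableSet A := (hTm hs).inter (measurableSet_Dom δ)
  have hmem : ∀ x ∈ A, |x| < 1 ∧ |x| + δ / 2 * phi x ≤ 1 := fun x hx => (mem_Dom_iff hδ).1 hx.2
  have hinj : InjOn T A := by
    intro x hx y hy hxy
    have key : ∀ u ∈ A, ∀ v ∈ A, T u = T v → u ≤ v → u = v := by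
      intro u hu v hv huv hle
      have := half_sub_le_of_mem hb (hmem u hu).1 (hmem u hu).2 (hmem v hv).1 (hmem v hv).2 hle
      simp only [hT] at huv
      linarith
    rcases le_total x y with h | h
    · exact key x hx y hy hxy h
    · exact (key y hy x hx hxy.symm h).symm
  have hder : ∀ x ∈ A, HasDerivWithinAt T (1 + b * (-x / phi x)) A x := fun x hx =>
    ((hasDerivAt_id x).add ((hasDerivAt_phi (hmem x hx).1).const_mul b)).hasDerivWithinAt
  have hcv := lintegral_image_eq_lintegral_abs_deriv_mul hAm hder hinj (fun _ => 1)
  have himg : T '' A ⊆ s ∩ Icc (-1) 1 := by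
    rintro _ ⟨x, hx, rfl⟩
    exact ⟨hx.1, abs_le.1 (abs_add_mul_phi_le hb (hmem x hx).2)⟩
  have hlow : ∀ x ∈ A, (2 : ℝ≥0∞)⁻¹ ≤ ENNReal.ofReal |1 + b * (-x / phi x)| * 1 := by
    intro x hx
    have hp := phi_pos (hmem x hx).1
    have h2 := two_mul_abs_le_phi (hmem x hx).1 (hmem x hx).2
    have h3 : b * (x / phi x) ≤ 1 / 2 := by
      calc b * (x / phi x) ≤ |b * (x / phi x)| := le_abs_self _
        _ = |b| * |x| / phi x := by rw [abs_mul, abs_div, abs_of_pos hp]; ring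
        _ ≤ (δ / 2) * |x| / phi x := by gcongr
        _ ≤ 1 / 2 := by rw [div_le_iff₀ hp]; linarith
    have h4 : (1 / 2 : ℝ) ≤ |1 + b * (-x / phi x)| := by
      refine le_trans ?_ (le_abs_self _)
      rw [neg_div, mul_neg]; linarith
    calc (2 : ℝ≥0∞)⁻¹ = ENNReal.ofReal (1 / 2) := by
          rw [one_div, ENNReal.ofReal_inv_of_pos two_pos]; simp
      _ ≤ _ := by rw [mul_one]; exact ENNReal.ofReal_le_ofReal h4
  have hfin : (2 : ℝ≥0∞)⁻¹ * volume A ≤ volume (s ∩ Icc (-1) 1) := by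
    calc (2 : ℝ≥0∞)⁻¹ * volume A = ∫⁻ _x in A, (2 : ℝ≥0∞)⁻¹ := by simp
      _ ≤ ∫⁻ x in A, ENNReal.ofReal |1 + b * (-x / phi x)| * 1 :=
          setLIntegral_mono' hAm hlow
      _ = volume (T '' A) := by rw [← hcv]; simp
      _ ≤ _ := measure_mono himg
  calc volume A = 2 * ((2 : ℝ≥0∞)⁻¹ * volume A) := by
        rw [← mul_assoc, ENNReal.mul_inv_cancel (by simp) (by simp), one_mul]
    _ ≤ 2 * volume (s ∩ Icc (-1) 1) := by gcongr
    _ = _ := rfl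

/-- The weight `W_δ(x)` is dominated by `φ` at every point of the interval on which the symmetric
difference centred at `x` lives. -/
theorem wt_le_phi {δ x y : ℝ} (hx : |x| + δ / 2 * phi x ≤ 1)
    (hy : |y - x| ≤ δ / 2 * phi x) : wt δ x ≤ phi y := by
  unfold wt
  rw [phi]
  have h1 := abs_le.1 hy
  have h2 := le_abs_self x
  have h3 := neg_abs_le x
  refine Real.sqrt_le_sqrt ?_
  have : (1 - x - δ * phi x / 2) * (1 + x - δ * phi x / 2) ≤ (1 - y) * (1 + y) := by
    apply mul_le_mul <;> linarith
  calc _ ≤ (1 - y) * (1 + y) := this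
    _ = _ := by ring

/-! ### Differences -/

/-- The `k`-th forward difference `∑ (-1)^{k-i} (k choose i) F(y + iu)`, without truncation; the
step `u` may be negative. -/
noncomputable def fd (k : ℕ) (u : ℝ) (F : ℝ → ℝ) (y : ℝ) : ℝ :=
  ∑ i ∈ Finset.range (k + 1), (k.choose i : ℝ) * (-1) ^ (k - i) * F (y + i * u)

theorem symmDelta_eq_fd {k : ℕ} {h x : ℝ} {F : ℝ → ℝ}
    (h1 : x + k * h / 2 ∈ Icc (-1 : ℝ) 1) (h2 : x - k * h / 2 ∈ Icc (-1 : ℝ) 1) :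
    symmDelta k h F x = fd k h F (x - k * h / 2) := by
  unfold symmDelta symmDiffOn fd
  rw [if_pos ⟨h1, h2⟩]
  refine Finset.sum_congr rfl fun i _ => ?_
  congr 2
  ring

theorem fits_iff {k : ℕ} {h x : ℝ} (hh : 0 ≤ h) :
    (x + k * (h * phi x) / 2 ∈ Icc (-1 : ℝ) 1 ∧ x - k * (h * phi x) / 2 ∈ Icc (-1 : ℝ) 1) ↔
      |x| + k * h / 2 * phi x ≤ 1 := by
  have h0 : 0 ≤ k * h / 2 * phi x := mul_nonneg (by positivity) (phi_nonneg x)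
  have e : k * (h * phi x) / 2 = k * h / 2 * phi x := by ring
  rw [e]
  constructor
  · rintro ⟨⟨h1, h2⟩, ⟨h3, h4⟩⟩
    rcases abs_cases x with ⟨h, _⟩ | ⟨h, _⟩ <;> rw [h] <;> linarith
  · intro h
    have h1 := le_abs_self x
    have h2 := neg_abs_le x
    exact ⟨⟨by linarith, by linarith⟩, ⟨by linarith, by linarith⟩⟩

theorem symmDelta_eq_zero_of_not_mem {k : ℕ} {h x : ℝ} {F : ℝ → ℝ} (hh : 0 ≤ h)
    (hx : x ∉ Dom (k * h)) (h1 : x ≠ 1) (h2 : x ≠ -1) : symmDelta k (h * phi x) F x = 0 := by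
  unfold symmDelta symmDiffOn
  rw [if_neg]
  rw [fits_iff hh]
  intro hfit
  refine hx ((mem_Dom_iff (by positivity)).2 ⟨lt_of_le_of_ne ?_ ?_, hfit⟩)
  · have : 0 ≤ k * h / 2 * phi x := mul_nonneg (by positivity) (phi_nonneg x)
    linarith
  · intro h3
    rcases (abs_eq zero_le_one).1 h3 with h3 | h3
    · exact h1 h3
    · exact h2 h3

theorem symmDelta_eq_sum {k : ℕ} {h x : ℝ} {F : ℝ → ℝ} (hh : 0 ≤ h) (hx : x ∈ Dom (k * h)) :
    symmDelta k (h * phi x) F x = ∑ i ∈ Finset.range (k + 1),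
      (k.choose i : ℝ) * (-1) ^ (k - i) * F (x + (((i : ℝ) - (k : ℝ) / 2) * h) * phi x) := by
  unfold symmDelta symmDiffOn
  rw [if_pos ((fits_iff hh).2 ((mem_Dom_iff (by positivity)).1 hx).2)]
  refine Finset.sum_congr rfl fun i _ => ?_
  rw [mul_assoc ((i : ℝ) - (k : ℝ) / 2)]

theorem abs_node_le {k i : ℕ} {h : ℝ} (hh : 0 ≤ h) (hi : i ∈ Finset.range (k + 1)) :
    |((i : ℝ) - (k : ℝ) / 2) * h| ≤ k * h / 2 := by
  have hi' : (i : ℝ) ≤ k := by exact_mod_cast Finset.mem_range_succ_iff.1 hi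
  have hi0 : (0 : ℝ) ≤ i := by positivity
  rw [abs_mul, abs_of_nonneg hh]
  have : |(i : ℝ) - (k : ℝ) / 2| ≤ k / 2 := abs_le.2 ⟨by linarith, by linarith⟩
  nlinarith

theorem Dom_subset {δ : ℝ} (hδ : 0 ≤ δ) : Dom δ ⊆ Icc (-1) 1 := fun _ hx =>
  abs_le.1 ((mem_Dom_iff hδ).1 hx).1.le

theorem quasi_node {k i : ℕ} {h : ℝ} (hh : 0 ≤ h) (hi : i ∈ Finset.range (k + 1)) :
    Measure.QuasiMeasurePreserving (fun x => x + (((i : ℝ) - (k : ℝ) / 2) * h) * phi x)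
      (volume.restrict (Dom (k * h))) (volume.restrict (Icc (-1 : ℝ) 1)) :=
  ⟨by fun_prop, (Measure.absolutelyContinuous_of_le (map_add_mul_phi_le (by positivity)
    (by simpa [mul_div_assoc] using abs_node_le hh hi))).trans Measure.smul_absolutelyContinuous⟩

theorem ae_ne_one_and_ne_neg_one : ∀ᵐ x : ℝ, x ≠ 1 ∧ x ≠ -1 := by
  filter_upwards [Measure.ae_ne volume (1 : ℝ), Measure.ae_ne volume (-1 : ℝ)] with x h1 h2
  exact ⟨h1, h2⟩

/-- Symmetric differences with variable step do not see changes on null sets. -/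
theorem symmDelta_ae_eq {k : ℕ} {h : ℝ} (hh : 0 ≤ h) {F F' : ℝ → ℝ}
    (hF : F =ᵐ[volume.restrict (Icc (-1 : ℝ) 1)] F') :
    (fun x => symmDelta k (h * phi x) F x) =ᵐ[volume] fun x => symmDelta k (h * phi x) F' x := by
  have h1 : ∀ᵐ x ∂(volume.restrict (Dom (k * h))), ∀ i ∈ Finset.range (k + 1),
      F (x + (((i : ℝ) - (k : ℝ) / 2) * h) * phi x) =
        F' (x + (((i : ℝ) - (k : ℝ) / 2) * h) * phi x) := by
    rw [Finset.eventually_all]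
    intro i hi
    exact (quasi_node hh hi).ae hF
  rw [ae_restrict_iff' (measurableSet_Dom _)] at h1
  filter_upwards [h1, ae_ne_one_and_ne_neg_one] with x hx hne
  by_cases hD : x ∈ Dom (k * h)
  · rw [symmDelta_eq_sum hh hD, symmDelta_eq_sum hh hD]
    exact Finset.sum_congr rfl fun i hi => by rw [hx hD i hi]
  · rw [symmDelta_eq_zero_of_not_mem hh hD hne.1 hne.2,
      symmDelta_eq_zero_of_not_mem hh hD hne.1 hne.2]

/-- The weighted symmetric difference `W_{kh}^r Δ^k_{hφ} F` entering the moduli. -/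
noncomputable def wdiff (k r : ℕ) (F : ℝ → ℝ) (h x : ℝ) : ℝ :=
  wt (k * h) x ^ r * symmDelta k (h * phi x) F x

theorem measurable_symmDiffOn_uncurry {k : ℕ} {F : ℝ → ℝ} (hF : Measurable F) :
    Measurable fun z : ℝ × ℝ => symmDelta k z.1 F z.2 := by
  unfold symmDelta symmDiffOn
  refine Measurable.ite ?_ ?_ measurable_const
  · exact (measurableSet_preimage (f := fun z : ℝ × ℝ => z.2 + k * z.1 / 2) (by fun_prop)
      measurableSet_Icc).inter (measurableSet_preimage
      (f := fun z : ℝ × ℝ => z.2 - k * z.1 / 2) (by fun_prop) measurableSet_Icc)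
  · fun_prop

theorem measurable_wdiff_uncurry {k r : ℕ} {F : ℝ → ℝ} (hF : Measurable F) :
    Measurable fun z : ℝ × ℝ => wdiff k r F z.1 z.2 := by
  unfold wdiff
  have h1 : Measurable fun z : ℝ × ℝ => wt (k * z.1) z.2 := by unfold wt; fun_prop
  have h2 : Measurable fun z : ℝ × ℝ => symmDelta k (z.1 * phi z.2) F z.2 :=
    (measurable_symmDiffOn_uncurry hF).comp
      (f := fun z : ℝ × ℝ => (z.1 * phi z.2, z.2)) (by fun_prop)
  exact (h1.pow_const r).mul h2

theorem aestronglyMeasurable_wdiff {k r : ℕ} {h : ℝ} (hh : 0 ≤ h) {F : ℝ → ℝ}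
    (hF : AEStronglyMeasurable F (volume.restrict (Icc (-1 : ℝ) 1))) :
    AEStronglyMeasurable (wdiff k r F h) volume := by
  obtain ⟨F', hF', hFF'⟩ := hF.aemeasurable
  have h1 : Measurable (wdiff k r F' h) :=
    (measurable_wdiff_uncurry (k := k) (r := r) hF').comp (f := fun x => (h, x)) (by fun_prop)
  refine ⟨wdiff k r F' h, h1.stronglyMeasurable, ?_⟩
  filter_upwards [symmDelta_ae_eq (k := k) hh hFF'] with x hx
  unfold wdiff
  rw [hx]

theorem eLpNorm_eq_restrict_Dom {k : ℕ} {h : ℝ} (hh : 0 ≤ h) {r : ℕ} {F : ℝ → ℝ} {p : ℝ≥0∞} :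
    eLpNorm (wdiff k r F h) p (volume.restrict (Icc (-1 : ℝ) 1)) =
      eLpNorm (wdiff k r F h) p (volume.restrict (Dom (k * h))) := by
  rw [← eLpNorm_indicator_eq_eLpNorm_restrict measurableSet_Icc,
    ← eLpNorm_indicator_eq_eLpNorm_restrict (measurableSet_Dom _)]
  refine eLpNorm_congr_ae ?_
  filter_upwards [ae_ne_one_and_ne_neg_one] with x hne
  by_cases hD : x ∈ Dom (k * h)
  · rw [indicator_of_mem hD, indicator_of_mem (Dom_subset (by positivity) hD)]
  · rw [indicator_of_notMem hD]
    rw [indicator_apply, wdiff, symmDelta_eq_zero_of_not_mem hh hD hne.1 hne.2]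
    simp

theorem eLpNorm_wt_mul_comp_le {δ b : ℝ} (hδ : 0 ≤ δ) (hb : |b| ≤ δ / 2) {r : ℕ} {F : ℝ → ℝ}
    {p : ℝ≥0∞} (hp : 1 ≤ p)
    (hF : AEStronglyMeasurable F (volume.restrict (Icc (-1 : ℝ) 1))) :
    eLpNorm (fun x => wt δ x ^ r * F (x + b * phi x)) p (volume.restrict (Dom δ)) ≤
      2 * normP p (fun x => F x * phi x ^ r) := by
  have hmono : eLpNorm (fun x => wt δ x ^ r * F (x + b * phi x)) p (volume.restrict (Dom δ)) ≤
      eLpNorm (fun x => F (x + b * phi x) * phi (x + b * phi x) ^ r) p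
        (volume.restrict (Dom δ)) := by
    refine eLpNorm_mono_ae ?_
    rw [ae_restrict_iff' (measurableSet_Dom _)]
    refine Filter.Eventually.of_forall fun x hx => ?_
    have hx' := (mem_Dom_iff hδ).1 hx
    have hw : wt δ x ≤ phi (x + b * phi x) := by
      refine wt_le_phi hx'.2 ?_
      rw [add_sub_cancel_left, abs_mul, abs_of_nonneg (phi_nonneg x)]
      gcongr
      exact phi_nonneg x
    rw [norm_mul, norm_mul, norm_pow, norm_pow, mul_comm, Real.norm_of_nonneg (wt_nonneg _ _),
      Real.norm_of_nonneg (phi_nonneg _)]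
    gcongr
    exact wt_nonneg _ _
  refine hmono.trans ?_
  have hFp : AEStronglyMeasurable (fun x => F x * phi x ^ r)
      (volume.restrict (Icc (-1 : ℝ) 1)) :=
    hF.mul (by fun_prop)
  exact eLpNorm_comp_le_of_map_le (T := fun x => x + b * phi x)
    (g := fun x => F x * phi x ^ r) one_le_two hp (by fun_prop) (map_add_mul_phi_le hδ hb) hFp

theorem sum_choose_ennreal (k : ℕ) :
    ∑ i ∈ Finset.range (k + 1), (k.choose i : ℝ≥0∞) = 2 ^ k := by
  have h := Nat.sum_range_choose k
  rw [← Nat.cast_sum, h, Nat.cast_pow, Nat.cast_ofNat]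

theorem enorm_choose_mul_neg_one_pow (k i j : ℕ) :
    ‖(k.choose i : ℝ) * (-1) ^ j‖ₑ = (k.choose i : ℝ≥0∞) := by
  rw [enorm_mul, enorm_pow, enorm_neg, enorm_one, one_pow, mul_one]
  simp

/-- The weighted differences of a function are bounded by its weighted norm. -/
theorem eLpNorm_wdiff_le {k r : ℕ} {h : ℝ} (hh : 0 ≤ h) {F : ℝ → ℝ} {p : ℝ≥0∞} (hp : 1 ≤ p)
    (hF : AEStronglyMeasurable F (volume.restrict (Icc (-1 : ℝ) 1))) :
    eLpNorm (wdiff k r F h) p (volume.restrict (Icc (-1 : ℝ) 1)) ≤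
      2 ^ (k + 1) * normP p (fun x => F x * phi x ^ r) := by
  rw [eLpNorm_eq_restrict_Dom hh]
  have hδ : (0 : ℝ) ≤ k * h := by positivity
  have hsum : eLpNorm (wdiff k r F h) p (volume.restrict (Dom (k * h))) ≤
      eLpNorm (∑ i ∈ Finset.range (k + 1), ((k.choose i : ℝ) * (-1) ^ (k - i)) • fun x =>
      (wt (k * h) x ^ r * F (x + (((i : ℝ) - (k : ℝ) / 2) * h) * phi x))) p
      (volume.restrict (Dom (k * h))) := by
    refine eLpNorm_mono_ae ?_
    rw [ae_restrict_iff' (measurableSet_Dom _)]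
    refine Filter.Eventually.of_forall fun x hx => le_of_eq ?_
    rw [wdiff, symmDelta_eq_sum hh hx, Finset.sum_apply, Finset.mul_sum]
    congr 1
    refine Finset.sum_congr rfl fun i _ => ?_
    rw [Pi.smul_apply, smul_eq_mul]
    ring
  refine hsum.trans ?_
  refine (eLpNorm_sum_le (fun i hi => ?_) hp).trans ?_
  · have h1 : AEStronglyMeasurable (fun x => F (x + (((i : ℝ) - (k : ℝ) / 2) * h) * phi x))
        (volume.restrict (Dom (k * h))) :=
      hF.comp_quasiMeasurePreserving (quasi_node hh hi)
    have h2 : Measurable (fun x => wt (k * h) x ^ r) := by fun_prop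
    exact (h2.aestronglyMeasurable.mul h1).const_smul _
  calc _ ≤ ∑ i ∈ Finset.range (k + 1), (k.choose i : ℝ≥0∞) *
        (2 * normP p (fun x => F x * phi x ^ r)) := by
        refine Finset.sum_le_sum fun i hi => ?_
        rw [eLpNorm_const_smul, enorm_choose_mul_neg_one_pow]
        gcongr
        exact eLpNorm_wt_mul_comp_le hδ (by simpa [mul_div_assoc] using abs_node_le hh hi) hp hF
    _ = 2 ^ (k + 1) * normP p (fun x => F x * phi x ^ r) := by
        rw [← Finset.sum_mul, sum_choose_ennreal, pow_succ]; ring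

/-! ### Taylor's formula with an absolutely continuous derivative -/

open Polynomial in
theorem exists_antiderivative {k : ℕ} {P : ℝ[X]} (hP : P ∈ degreeLT ℝ k) (x c : ℝ) :
    ∃ R ∈ degreeLT ℝ (k + 1), derivative R = P ∧ R.eval x = c := by
  have h : ∃ R ∈ degreeLT ℝ (k + 1), derivative R = P := by
    refine ⟨∑ i ∈ Finset.range k, monomial (i + 1) (P.coeff i / (i + 1)), ?_, ?_⟩
    · refine Submodule.sum_mem _ fun i hi => ?_
      rw [mem_degreeLT]
      refine (degree_monomial_le _ _).trans_lt ?_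
      have := Finset.mem_range.1 hi
      exact_mod_cast Nat.succ_lt_succ this
    · rw [derivative_sum]
      have hdeg : ∀ m, k ≤ m → P.coeff m = 0 := fun m hm =>
        coeff_eq_zero_of_degree_lt ((mem_degreeLT.1 hP).trans_le (by exact_mod_cast hm))
      ext m
      simp only [derivative_monomial, finsetSum_coeff, coeff_monomial, Nat.add_sub_cancel]
      rw [Finset.sum_ite_eq' (Finset.range k) m]
      split_ifs with hm
      · push_cast
        field_simp
      · exact (hdeg m (by simpa using hm)).symm
  obtain ⟨R, hR, hRP⟩ := h
  refine ⟨R + C (c - R.eval x), Submodule.add_mem _ hR ?_, by simp [hRP], by simp⟩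
  rw [mem_degreeLT]
  exact (degree_C_le).trans_lt (by exact_mod_cast Nat.succ_pos k)

theorem enorm_intervalIntegral_le (f : ℝ → ℝ) (x y : ℝ) :
    ‖∫ w in x..y, f w‖ₑ ≤ ∫⁻ w in uIoc x y, ‖f w‖ₑ := by
  have h := intervalIntegral.norm_intervalIntegral_eq f x y volume
  rw [← ofReal_norm, h, ofReal_norm]
  exact enorm_integral_le_lintegral_enorm _

/-- The iteration of the remainder term in Taylor's formula, by Tonelli's theorem. -/
theorem lintegral_uIoc_iterate_le {a : ℝ → ℝ≥0∞} (ha : Measurable a) (m : ℕ) (x y : ℝ) :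
    ∫⁻ w in uIoc x y, ∫⁻ z in uIoc x w, a z * ENNReal.ofReal (|w - z| ^ m) ≤
      ∫⁻ z in uIoc x y, a z * ENNReal.ofReal (|y - z| ^ (m + 1)) := by
  set S : Set (ℝ × ℝ) := {q | q.2 ∈ uIoc x q.1} with hS
  have hSm : MeasurableSet S := by
    have : S = {q : ℝ × ℝ | (x < q.2 ∧ q.2 ≤ q.1) ∨ (q.1 < q.2 ∧ q.2 ≤ x)} := by
      ext q; exact mem_uIoc
    rw [this]
    measurability
  have h1 : ∀ w ∈ uIoc x y, ∫⁻ z in uIoc x w, a z * ENNReal.ofReal (|w - z| ^ m) ≤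
      ∫⁻ z in uIoc x y, S.indicator (fun q => a q.2 * ENNReal.ofReal (|y - q.2| ^ m)) (w, z) := by
    intro w hw
    rw [← lintegral_indicator measurableSet_uIoc, ← lintegral_indicator measurableSet_uIoc]
    refine lintegral_mono fun z => ?_
    by_cases hz : z ∈ uIoc x w
    · have hz' : z ∈ uIoc x y := by
        rw [mem_uIoc] at hz hw ⊢
        rcases hz with h | h <;> rcases hw with h' | h'
        · left; constructor <;> linarith
        · linarith
        · linarith
        · right; constructor <;> linarith
      rw [indicator_of_mem hz, indicator_of_mem hz', indicator_of_mem (show (w, z) ∈ S from hz)]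
      have habs : |w - z| ≤ |y - z| := by
        rcases mem_uIoc.1 hz with h | h <;> rcases mem_uIoc.1 hw with h' | h'
        · rw [abs_of_nonneg, abs_of_nonneg] <;> linarith
        · linarith
        · linarith
        · rw [abs_of_nonpos, abs_of_nonpos] <;> linarith
      have := ENNReal.ofReal_le_ofReal (pow_le_pow_left₀ (abs_nonneg _) habs m)
      exact mul_le_mul' le_rfl this
    · rw [indicator_of_notMem hz]; exact zero_le
  calc _ ≤ ∫⁻ w in uIoc x y, ∫⁻ z in uIoc x y,
        S.indicator (fun q => a q.2 * ENNReal.ofReal (|y - q.2| ^ m)) (w, z) :=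
        setLIntegral_mono' measurableSet_uIoc h1
    _ = ∫⁻ z in uIoc x y, ∫⁻ w in uIoc x y,
        S.indicator (fun q => a q.2 * ENNReal.ofReal (|y - q.2| ^ m)) (w, z) := by
        refine lintegral_lintegral_swap ?_
        refine (Measurable.indicator ?_ hSm).aemeasurable
        fun_prop
    _ ≤ _ := by
        refine setLIntegral_mono' measurableSet_uIoc fun z hz => ?_
        have h2 : ∀ w ∈ uIoc x y,
            S.indicator (fun q => a q.2 * ENNReal.ofReal (|y - q.2| ^ m)) (w, z) ≤
            (uIcc z y).indicator (fun _ => a z * ENNReal.ofReal (|y - z| ^ m)) w := by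
          intro w hw
          by_cases hzw : z ∈ uIoc x w
          · have hm : w ∈ uIcc z y := by
              rw [mem_uIoc] at hzw hw
              rw [mem_uIcc]
              rcases hzw with h | h <;> rcases hw with h' | h'
              · left; constructor <;> linarith
              · linarith
              · linarith
              · right; constructor <;> linarith
            rw [indicator_of_mem (show (w, z) ∈ S from hzw), indicator_of_mem hm]
          · rw [indicator_of_notMem (show (w, z) ∉ S from hzw)]; exact zero_le
        calc _ ≤ ∫⁻ w in uIoc x y,
              (uIcc z y).indicator (fun _ => a z * ENNReal.ofReal (|y - z| ^ m)) w :=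
              setLIntegral_mono' measurableSet_uIoc h2
          _ ≤ ∫⁻ w, (uIcc z y).indicator (fun _ => a z * ENNReal.ofReal (|y - z| ^ m)) w :=
              setLIntegral_le_lintegral _ _
          _ = a z * ENNReal.ofReal (|y - z| ^ (m + 1)) := by
              rw [lintegral_indicator_const measurableSet_uIcc, Real.volume_interval, mul_assoc,
                ← ENNReal.ofReal_mul (by positivity), pow_succ]

open Polynomial in
/-- Taylor's formula: up to a polynomial of degree `< m + 1`, a function is controlled by the
integral remainder. Only the size of the remainder is recorded, without the factor `1 / m!`. -/
theorem exists_taylor_polynomial (m : ℕ) : ∀ G : ℝ → ℝ, ContDiffOn ℝ m G (Ioo (-1) 1) →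
    ACLoc (iteratedDeriv m G) → ∀ x ∈ Ioo (-1 : ℝ) 1, ∃ Q ∈ degreeLT ℝ (m + 1),
      ∀ y ∈ Ioo (-1 : ℝ) 1, ‖G y - Q.eval y‖ₑ ≤
        ∫⁻ z in uIoc x y, ‖iteratedDeriv (m + 1) G z‖ₑ * ENNReal.ofReal (|y - z| ^ m) := by
  induction m with
  | zero =>
    intro G _ hAC x hx
    refine ⟨C (G x), by rw [mem_degreeLT]; exact degree_C_le.trans_lt (by norm_num),
      fun y hy => ?_⟩
    have hac : AbsolutelyContinuousOnInterval G x y := by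
      rw [iteratedDeriv_zero] at hAC
      rcases le_total x y with h | h
      · exact hAC x y hx.1 h hy.2
      · exact (hAC y x hy.1 h hx.2).symm
    rw [eval_C, ← hac.integral_deriv_eq_sub]
    refine (enorm_intervalIntegral_le _ _ _).trans_eq ?_
    simp [iteratedDeriv_one]
  | succ m ih =>
    intro G hG hAC x hx
    have hG' : ContDiffOn ℝ ((m : WithTop ℕ∞) + 1) G (Ioo (-1) 1) := by exact_mod_cast hG
    rw [contDiffOn_succ_iff_deriv_of_isOpen isOpen_Ioo] at hG'
    obtain ⟨Q', hQ', hbound⟩ := ih (deriv G) hG'.2.2 (by rwa [← iteratedDeriv_succ']) x hx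
    obtain ⟨Q, hQ, hder, hval⟩ := exists_antiderivative hQ' x (G x)
    refine ⟨Q, hQ, fun y hy => ?_⟩
    have hsub : uIcc x y ⊆ Ioo (-1 : ℝ) 1 := by
      intro w hw
      rw [mem_uIcc] at hw
      rcases hw with h | h
      · exact ⟨hx.1.trans_le h.1, h.2.trans_lt hy.2⟩
      · exact ⟨hy.1.trans_le h.1, h.2.trans_lt hx.2⟩
    have hFTC : ∫ w in x..y, (deriv G w - Q'.eval w) = G y - Q.eval y := by
      have h := intervalIntegral.integral_eq_sub_of_hasDerivAt (a := x) (b := y)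
        (f := fun w => G w - Q.eval w) (f' := fun w => deriv G w - Q'.eval w) (fun w hw => by
          have h1 : HasDerivAt G (deriv G w) w :=
            ((hG'.1 w (hsub hw)).differentiableAt (isOpen_Ioo.mem_nhds (hsub hw))).hasDerivAt
          have h2 := Q.hasDerivAt w
          rw [hder] at h2
          exact h1.sub h2)
        (((hG'.2.2.continuousOn.mono hsub).sub Q'.continuous.continuousOn).intervalIntegrable)
      rw [h]; simp [hval]
    rw [← hFTC]
    calc _ ≤ ∫⁻ w in uIoc x y, ‖deriv G w - Q'.eval w‖ₑ := enorm_intervalIntegral_le _ _ _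
      _ ≤ ∫⁻ w in uIoc x y, ∫⁻ z in uIoc x w,
          ‖iteratedDeriv (m + 1 + 1) G z‖ₑ * ENNReal.ofReal (|w - z| ^ m) := by
          refine setLIntegral_mono' measurableSet_uIoc fun w hw => ?_
          rw [iteratedDeriv_succ']
          exact hbound w (hsub (uIoc_subset_uIcc hw))
      _ ≤ _ := by
          refine lintegral_uIoc_iterate_le ?_ m x y
          rw [iteratedDeriv_succ]
          exact (measurable_deriv _).enorm

open Polynomial in
theorem fd_polynomial_eq_zero {k : ℕ} {Q : ℝ[X]} (hQ : Q ∈ degreeLT ℝ k) (u y : ℝ) :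
    fd k u (fun x => Q.eval x) y = 0 := by
  rcases Nat.eq_zero_or_pos k with rfl | hk
  · have : Q = 0 := by rw [mem_degreeLT] at hQ; simpa using hQ
    simp [fd, this]
  set P : ℝ[X] := Q.comp (C y + C u * X) with hP
  have hdeg : P.natDegree < k := by
    have h1 : Q.natDegree < k := by
      rcases eq_or_ne Q 0 with rfl | h0
      · simpa using hk
      · exact (natDegree_lt_iff_degree_lt h0).2 (mem_degreeLT.1 hQ)
    have h2 : (C y + C u * X : ℝ[X]).natDegree ≤ 1 := by
      rw [add_comm]
      exact natDegree_linear_le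
    calc P.natDegree ≤ Q.natDegree * (C y + C u * X : ℝ[X]).natDegree := natDegree_comp_le
      _ ≤ Q.natDegree * 1 := by gcongr
      _ < k := by simpa using h1
  have h := congrFun (fwdDiff_iter_eq_zero_of_degree_lt hdeg) 0
  rw [fwdDiff_iter_eq_sum_shift] at h
  rw [fd]
  refine Eq.trans ?_ h
  refine Finset.sum_congr rfl fun i _ => ?_
  simp [hP]
  ring_nf

/-! ### The modulus of a smooth function -/

/-- Schur's test for a kernel with a density. -/
theorem eLpNorm_le_of_kernel {lam μ : Measure ℝ} [SFinite lam] [SFinite μ] {K : ℝ × ℝ → ℝ≥0∞}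
    (hK : Measurable K) {c : ℝ≥0∞} (hc : c ≠ ∞)
    (h1 : ∀ᵐ x ∂lam, ∫⁻ z, K (x, z) ∂μ ≤ c) (h2 : ∀ᵐ z ∂μ, ∫⁻ x, K (x, z) ∂lam ≤ c)
    {E g : ℝ → ℝ} (hg : Measurable g)
    (hE : ∀ᵐ x ∂lam, ‖E x‖ₑ ≤ ∫⁻ z, K (x, z) * ‖g z‖ₑ ∂μ) {p : ℝ≥0∞} (hp : 1 ≤ p) :
    eLpNorm E p lam ≤ c * eLpNorm g p μ := by
  have hKx : ∀ x, Measurable fun z => K (x, z) := fun x => hK.comp (by fun_prop)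
  have h := eLpNorm_le_of_enorm_le_lintegral (lam := lam) (μ := μ) (E := E) (g := g)
    (fun x => μ.withDensity fun z => K (x, z)) (c₁ := c) (c₂ := c) ?_ ?_ ?_ hc hc hg ?_ hp
  · simpa using h
  · filter_upwards [h1] with x hx
    rwa [withDensity_apply _ MeasurableSet.univ, setLIntegral_univ]
  · intro s hs
    calc ∫⁻ x, (μ.withDensity fun z => K (x, z)) s ∂lam = ∫⁻ x, ∫⁻ z in s, K (x, z) ∂μ ∂lam :=
          lintegral_congr fun x => withDensity_apply _ hs
      _ = ∫⁻ z in s, ∫⁻ x, K (x, z) ∂lam ∂μ := lintegral_lintegral_swap hK.aemeasurable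
      _ ≤ ∫⁻ _z in s, c ∂μ := lintegral_mono_ae (ae_restrict_of_ae h2)
      _ = c * μ s := by simp
  · intro s hs
    have : (fun x => (μ.withDensity fun z => K (x, z)) s) = fun x => ∫⁻ z in s, K (x, z) ∂μ :=
      funext fun x => withDensity_apply _ hs
    rw [this]
    exact hK.lintegral_prod_right'
  · filter_upwards [hE] with x hx
    rwa [lintegral_withDensity_eq_lintegral_mul _ (hKx x) hg.enorm]

theorem lintegral_inv_sqrt_le {x d : ℝ} (hxd : x ≤ d) (hd : d < 1) :
    ∫⁻ z in Icc x d, ENNReal.ofReal (1 / Real.sqrt (1 - z)) ≤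
      ENNReal.ofReal (2 * (d - x) / Real.sqrt (1 - x)) := by
  have hpos : ∀ z ∈ Icc x d, 0 < 1 - z := fun z hz => by linarith [hz.2]
  have hder : ∀ z ∈ uIcc x d, HasDerivAt (fun z => -2 * Real.sqrt (1 - z))
      (1 / Real.sqrt (1 - z)) z := by
    intro z hz
    rw [uIcc_of_le hxd] at hz
    have h1 : HasDerivAt (fun y : ℝ => 1 - y) (-1) z := by
      simpa using (hasDerivAt_id z).const_sub 1
    have h2 := (h1.sqrt (hpos z hz).ne').const_mul (-2)
    have := (Real.sqrt_pos.2 (hpos z hz)).ne'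
    exact h2.congr_deriv (by field_simp)
  have hcont : ContinuousOn (fun z => 1 / Real.sqrt (1 - z)) (uIcc x d) := by
    refine ContinuousOn.div continuousOn_const (by fun_prop) fun z hz => ?_
    rw [uIcc_of_le hxd] at hz
    exact (Real.sqrt_pos.2 (hpos z hz)).ne'
  have hint := hcont.intervalIntegrable (μ := volume)
  have hFTC := intervalIntegral.integral_eq_sub_of_hasDerivAt hder hint
  rw [intervalIntegral.integral_of_le hxd] at hFTC
  have hx0 := Real.sqrt_pos.2 (hpos x ⟨le_rfl, hxd⟩)
  have hd0 := Real.sqrt_pos.2 (hpos d ⟨hxd, le_rfl⟩)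
  have ex := Real.sq_sqrt (hpos x ⟨le_rfl, hxd⟩).le
  have ed := Real.sq_sqrt (hpos d ⟨hxd, le_rfl⟩).le
  rw [setLIntegral_congr Ioc_ae_eq_Icc.symm, ← ofReal_integral_eq_lintegral_ofReal
    ((intervalIntegrable_iff_integrableOn_Ioc_of_le hxd).1 hint)
    (Filter.Eventually.of_forall fun z => by positivity), hFTC]
  refine ENNReal.ofReal_le_ofReal ?_
  rw [le_div_iff₀ hx0]
  nlinarith [sq_nonneg (Real.sqrt (1 - x) - Real.sqrt (1 - d))]

/-- The mean of `1/φ` over `[x, d]` is at most `2/φ(x)`, however close `d` is to `1`. -/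
theorem lintegral_inv_phi_right_le {x d : ℝ} (hx : -1 < x) (hxd : x ≤ d) (hd : d < 1) :
    ∫⁻ z in Icc x d, ENNReal.ofReal (1 / phi z) ≤ ENNReal.ofReal (2 * (d - x) / phi x) := by
  have hx1 : 0 < Real.sqrt (1 + x) := Real.sqrt_pos.2 (by linarith)
  have hphi : ∀ z : ℝ, -1 ≤ z → phi z = Real.sqrt (1 + z) * Real.sqrt (1 - z) := fun z hz => by
    rw [← Real.sqrt_mul (by linarith), phi]; congr 1; ring
  calc ∫⁻ z in Icc x d, ENNReal.ofReal (1 / phi z)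
      ≤ ∫⁻ z in Icc x d, ENNReal.ofReal (1 / Real.sqrt (1 + x)) *
          ENNReal.ofReal (1 / Real.sqrt (1 - z)) := by
        refine setLIntegral_mono' measurableSet_Icc fun z hz => ?_
        rw [← ENNReal.ofReal_mul (by positivity)]
        refine ENNReal.ofReal_le_ofReal ?_
        have hz1 : 0 < Real.sqrt (1 - z) := Real.sqrt_pos.2 (by linarith [hz.2])
        rw [hphi z (by linarith [hz.1]), ← one_div_mul_one_div_rev, mul_comm]
        gcongr
        exact hz.1
    _ = ENNReal.ofReal (1 / Real.sqrt (1 + x)) *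
          ∫⁻ z in Icc x d, ENNReal.ofReal (1 / Real.sqrt (1 - z)) :=
        lintegral_const_mul' _ _ ENNReal.ofReal_ne_top
    _ ≤ ENNReal.ofReal (1 / Real.sqrt (1 + x)) *
          ENNReal.ofReal (2 * (d - x) / Real.sqrt (1 - x)) := by
        gcongr; exact lintegral_inv_sqrt_le hxd hd
    _ = _ := by
        rw [← ENNReal.ofReal_mul (by positivity), hphi x hx.le]
        congr 1
        field_simp

theorem setLIntegral_comp_neg (g : ℝ → ℝ≥0∞) (s : Set ℝ) :
    ∫⁻ z in -s, g (-z) = ∫⁻ z in s, g z := by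
  have h := (Measure.measurePreserving_neg (volume : Measure ℝ)).setLIntegral_comp_preimage_emb
    (MeasurableEquiv.neg ℝ).measurableEmbedding g s
  simpa using h

theorem lintegral_inv_phi_left_le {x d : ℝ} (hx : x < 1) (hxd : d ≤ x) (hd : -1 < d) :
    ∫⁻ z in Icc d x, ENNReal.ofReal (1 / phi z) ≤ ENNReal.ofReal (2 * (x - d) / phi x) := by
  have h := lintegral_inv_phi_right_le (x := -x) (d := -d) (by linarith) (by linarith)
    (by linarith)
  have h2 := setLIntegral_comp_neg (fun z => ENNReal.ofReal (1 / phi z)) (Icc d x)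
  rw [← h2]
  simp only [phi_neg] at h ⊢
  rw [Set.neg_Icc]
  refine h.trans_eq ?_
  congr 2
  ring

/-- Distance to the end of the interval `[x, x + aφ(x)]` is controlled by `aφ` at the point
itself, although `φ` may be much smaller there than at `x`. -/
theorem add_mul_phi_sub_le {a x z : ℝ} (ha : 0 ≤ a) (hx1 : |x| < 1) (hx : |x| + a * phi x ≤ 1)
    (hxz : x ≤ z) (hz : z ≤ x + a * phi x) : x + a * phi x - z ≤ 2 * a * phi z := by
  have hle : x + a * phi x ≤ 1 := by linarith [le_abs_self x]
  have hxl := (abs_lt.1 hx1).1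
  have hz1 : |z| ≤ 1 := abs_le.2 ⟨by linarith, by linarith⟩
  have e1 := phi_sq hx1.le
  have e2 := phi_sq hz1
  have hp := phi_nonneg z
  have hpx := phi_nonneg x
  refine (le_abs_self _).trans (abs_le_of_sq_le_sq ?_ (by positivity))
  have heq : (2 * a * phi z) ^ 2 = 4 * a ^ 2 * ((1 - z) * (1 + z)) := by
    rw [mul_pow, e2]; ring
  rw [heq]
  set e := x + a * phi x - z with he
  have he0 : 0 ≤ e := by linarith
  have h1 : e ≤ 1 - z := by linarith
  have h2 : e ≤ a * phi x := by linarith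
  have h3 : (a * phi x) ^ 2 = a ^ 2 * ((1 - x) * (1 + x)) := by rw [mul_pow, e1]; ring
  have hzz : (1 + x) * (1 - z) ≤ (1 + z) * (1 - z) := by
    apply mul_le_mul_of_nonneg_right <;> linarith
  have ha2 : 0 ≤ a ^ 2 := sq_nonneg a
  -- If `z` is not much closer to `1` than `x`, then `φ z` is comparable to `φ x`; otherwise the
  -- distance to `1` has dropped by a factor, which forces `1 - x ≲ a²(1 + x)`.
  by_cases hcase : (1 - x) / 4 ≤ 1 - z
  · calc e ^ 2 ≤ (a * phi x) ^ 2 := by gcongr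
      _ = a ^ 2 * ((1 + x) * (1 - x)) := by rw [h3]; ring
      _ ≤ a ^ 2 * ((1 + x) * (4 * (1 - z))) := by gcongr <;> linarith
      _ = 4 * a ^ 2 * ((1 + x) * (1 - z)) := by ring
      _ ≤ 4 * a ^ 2 * ((1 + z) * (1 - z)) := by gcongr
      _ = _ := by ring
  · push Not at hcase
    have h4 : 3 / 4 * (1 - x) ≤ a * phi x := by linarith
    have h5 : (3 / 4 * (1 - x)) ^ 2 ≤ a ^ 2 * ((1 - x) * (1 + x)) := by
      rw [← h3]; gcongr; linarith
    have h6 : (1 - x) ≤ 16 / 9 * (a ^ 2 * (1 + x)) := by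
      have hpos : 0 < 1 - x := by linarith [le_abs_self x]
      have : (9 / 16 * (1 - x)) * (1 - x) ≤ (a ^ 2 * (1 + x)) * (1 - x) := by nlinarith
      have := le_of_mul_le_mul_right this hpos
      linarith
    have hq0 : 0 ≤ 1 - z := by linarith
    calc e ^ 2 ≤ (1 - z) ^ 2 := by gcongr
      _ = (1 - z) * (1 - z) := by ring
      _ ≤ (16 / 9 * (a ^ 2 * (1 + x))) * (1 - z) := by gcongr; linarith
      _ = 16 / 9 * a ^ 2 * ((1 + x) * (1 - z)) := by ring
      _ ≤ 16 / 9 * a ^ 2 * ((1 + z) * (1 - z)) := by gcongr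
      _ ≤ 4 * a ^ 2 * ((1 - z) * (1 + z)) := by
          have : 0 ≤ a ^ 2 * ((1 + z) * (1 - z)) :=
            mul_nonneg ha2 (mul_nonneg (by linarith) hq0)
          nlinarith

theorem sub_sub_mul_phi_le {a x z : ℝ} (ha : 0 ≤ a) (hx1 : |x| < 1) (hx : |x| + a * phi x ≤ 1)
    (hzx : z ≤ x) (hz : x - a * phi x ≤ z) : z - (x - a * phi x) ≤ 2 * a * phi z := by
  have := add_mul_phi_sub_le (x := -x) (z := -z) ha (by rwa [abs_neg]) (by rwa [abs_neg, phi_neg])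
    (by linarith) (by rw [phi_neg]; linarith)
  rw [phi_neg, phi_neg] at this
  linarith

theorem volume_right_fibre_le {a z : ℝ} (ha : 0 ≤ a) :
    volume {x : ℝ | |x| < 1 ∧ |x| + a * phi x ≤ 1 ∧ x ≤ z ∧ z ≤ x + a * phi x} ≤
      ENNReal.ofReal (4 * a * phi z) := by
  refine (Real.volume_le_diam _).trans (Metric.ediam_le fun x hx y hy => ?_)
  have key : ∀ x y : ℝ, (|x| < 1 ∧ |x| + a * phi x ≤ 1 ∧ x ≤ z ∧ z ≤ x + a * phi x) →
      (|y| < 1 ∧ |y| + a * phi y ≤ 1 ∧ y ≤ z ∧ z ≤ y + a * phi y) → x ≤ y →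
      y - x ≤ 4 * a * phi z := by
    intro x y hx hy hxy
    have h1 := half_sub_le_of_mem (b := a) (abs_of_nonneg ha).le hx.1 hx.2.1 hy.1 hy.2.1 hxy
    have h2 := add_mul_phi_sub_le ha hy.1 hy.2.1 hy.2.2.1 hy.2.2.2
    linarith [hx.2.2.2]
  rw [edist_dist]
  refine ENNReal.ofReal_le_ofReal ?_
  rw [Real.dist_eq]
  rcases le_total x y with h | h
  · rw [abs_of_nonpos (by linarith)]; linarith [key x y hx hy h]
  · rw [abs_of_nonneg (by linarith)]; linarith [key y x hy hx h]

/-- The centres `x` of the intervals `[x - aφ(x), x + aφ(x)]` through a given point `z` form a set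
of measure at most `8aφ(z)`. -/
theorem volume_fibre_le {a z : ℝ} (ha : 0 ≤ a) :
    volume {x : ℝ | |x| < 1 ∧ |x| + a * phi x ≤ 1 ∧ |z - x| ≤ a * phi x} ≤
      ENNReal.ofReal (8 * a * phi z) := by
  have hsub : {x : ℝ | |x| < 1 ∧ |x| + a * phi x ≤ 1 ∧ |z - x| ≤ a * phi x} ⊆
      {x : ℝ | |x| < 1 ∧ |x| + a * phi x ≤ 1 ∧ x ≤ z ∧ z ≤ x + a * phi x} ∪
      -{x : ℝ | |x| < 1 ∧ |x| + a * phi x ≤ 1 ∧ x ≤ -z ∧ -z ≤ x + a * phi x} := by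
    rintro x ⟨h1, h2, h3⟩
    have := abs_le.1 h3
    rcases le_total x z with h | h
    · exact Or.inl ⟨h1, h2, h, by linarith⟩
    · refine Or.inr ?_
      rw [Set.mem_neg]
      exact ⟨by rwa [abs_neg], by rwa [abs_neg, phi_neg], by linarith, by rw [phi_neg]; linarith⟩
  refine (measure_mono hsub).trans ((measure_union_le _ _).trans ?_)
  rw [Measure.measure_neg]
  calc _ ≤ ENNReal.ofReal (4 * a * phi z) + ENNReal.ofReal (4 * a * phi (-z)) :=
        add_le_add (volume_right_fibre_le ha) (volume_right_fibre_le ha)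
    _ = _ := by
        have := phi_nonneg z
        rw [phi_neg, ← ENNReal.ofReal_add (by positivity) (by positivity)]
        congr 1; ring

/-- Schur's test with a constant in front of the kernel. -/
theorem eLpNorm_le_mul_of_kernel {lam μ : Measure ℝ} [SFinite lam] [SFinite μ]
    {K : ℝ × ℝ → ℝ≥0∞} (hK : Measurable K) {B c : ℝ≥0∞} (hB : B ≠ ∞) (hc : c ≠ ∞)
    (h1 : ∀ᵐ x ∂lam, ∫⁻ z, K (x, z) ∂μ ≤ c) (h2 : ∀ᵐ z ∂μ, ∫⁻ x, K (x, z) ∂lam ≤ c)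
    {E g : ℝ → ℝ} (hg : Measurable g)
    (hE : ∀ᵐ x ∂lam, ‖E x‖ₑ ≤ B * ∫⁻ z, K (x, z) * ‖g z‖ₑ ∂μ) {p : ℝ≥0∞} (hp : 1 ≤ p) :
    eLpNorm E p lam ≤ B * c * eLpNorm g p μ := by
  refine eLpNorm_le_of_kernel (K := fun q => B * K q) (hK.const_mul _) (ENNReal.mul_ne_top hB hc)
    ?_ ?_ hg ?_ hp
  · filter_upwards [h1] with x hx
    rw [lintegral_const_mul' _ _ hB]; gcongr
  · filter_upwards [h2] with x hx
    rw [lintegral_const_mul' _ _ hB]; gcongr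
  · filter_upwards [hE] with x hx
    simp_rw [mul_assoc]
    rwa [lintegral_const_mul' _ _ hB]

theorem measurableSet_and {α : Type*} [MeasurableSpace α] {p q : α → Prop}
    (hp : MeasurableSet {x | p x}) (hq : MeasurableSet {x | q x}) :
    MeasurableSet {x | p x ∧ q x} := hp.inter hq

theorem abs_node_sub_le {a x y z : ℝ} (ha : 0 ≤ a) (hx1 : |x| < 1) (hx : |x| + a * phi x ≤ 1)
    (hy : |y - x| ≤ a * phi x) (hz : z ∈ uIoc x y) :
    |y - z| ≤ 2 * a * phi z ∧ |z - x| ≤ a * phi x := by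
  have hy' := abs_le.1 hy
  rcases mem_uIoc.1 hz with h | h
  · have := add_mul_phi_sub_le ha hx1 hx h.1.le (by linarith)
    rw [abs_of_nonneg (by linarith), abs_of_nonneg (by linarith)]
    constructor <;> linarith
  · have := sub_sub_mul_phi_le ha hx1 hx h.2 (by linarith)
    rw [abs_of_nonpos (by linarith), abs_of_nonpos (by linarith)]
    constructor <;> linarith

theorem fd_eq_fd_sub_polynomial {k : ℕ} {Q : Polynomial ℝ} (hQ : Q ∈ Polynomial.degreeLT ℝ k)
    (G : ℝ → ℝ) (u y : ℝ) : fd k u G y = fd k u (fun x => G x - Q.eval x) y := by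
  have h := fd_polynomial_eq_zero hQ u y
  have : fd k u (fun x => G x - Q.eval x) y = fd k u G y - fd k u (fun x => Q.eval x) y := by
    simp only [fd, ← Finset.sum_sub_distrib, mul_sub]
  rw [this, h, sub_zero]

theorem enorm_fd_le (k : ℕ) (u : ℝ) (G : ℝ → ℝ) (y : ℝ) :
    ‖fd k u G y‖ₑ ≤ ∑ i ∈ Finset.range (k + 1), (k.choose i : ℝ≥0∞) * ‖G (y + i * u)‖ₑ := by
  refine (enorm_sum_le _ _).trans (Finset.sum_le_sum fun i _ => ?_)
  rw [enorm_mul, enorm_choose_mul_neg_one_pow]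

/-- Pointwise bound of the weighted difference of a smooth function by an integral of its
weighted derivative. The Taylor polynomial at the centre `x` is annihilated by the difference, and
in the remainder `|y - z| ≲ hφ(z)` and `W(x) ≤ φ(z)` distribute the powers of `φ`. -/
theorem enorm_wdiff_le {m r : ℕ} {h x : ℝ} (hh : 0 ≤ h)
    (hx : |x| + ((m + 1 : ℕ) : ℝ) * h / 2 * phi x < 1) {G : ℝ → ℝ}
    (hG : ContDiffOn ℝ m G (Ioo (-1) 1)) (hAC : ACLoc (iteratedDeriv m G)) :
    ‖wdiff (m + 1) r G h x‖ₑ ≤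
      2 ^ (m + 1) * ENNReal.ofReal ((2 * (((m + 1 : ℕ) : ℝ) * h / 2)) ^ m) *
        ∫⁻ z in {z | |z - x| ≤ ((m + 1 : ℕ) : ℝ) * h / 2 * phi x}, ENNReal.ofReal (1 / phi z) *
          ‖iteratedDeriv (m + 1) G z * phi z ^ (m + 1 + r)‖ₑ := by
  set k := m + 1 with hk
  set a : ℝ := (k : ℝ) * h / 2 with ha
  have ha0 : 0 ≤ a := by positivity
  have hpx := phi_nonneg x
  have hx1 : |x| < 1 := lt_of_le_of_lt (by nlinarith) hx
  obtain ⟨Q, hQ, hT⟩ := exists_taylor_polynomial m G hG hAC x (abs_lt.1 hx1)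
  have hfit := (fits_iff (k := k) hh).2 hx.le
  have hD : symmDelta k (h * phi x) G x =
      fd k (h * phi x) (fun y => G y - Q.eval y) (x - k * (h * phi x) / 2) := by
    rw [symmDelta_eq_fd hfit.1 hfit.2, fd_eq_fd_sub_polynomial hQ]
  set I := ∫⁻ z in {z | |z - x| ≤ a * phi x}, ENNReal.ofReal (1 / phi z) *
          ‖iteratedDeriv k G z * phi z ^ (k + r)‖ₑ with hI
  have hterm : ∀ i ∈ Finset.range (k + 1), ‖wt (k * h) x ^ r‖ₑ * ‖(fun y => G y - Q.eval y)
      (x - k * (h * phi x) / 2 + i * (h * phi x))‖ₑ ≤ ENNReal.ofReal ((2 * a) ^ m) * I := by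
    intro i hi
    set y := x - k * (h * phi x) / 2 + i * (h * phi x) with hy
    have hyx : |y - x| ≤ a * phi x := by
      have : y - x = ((i : ℝ) - (k : ℝ) / 2) * h * phi x := by rw [hy]; ring
      rw [this, abs_mul, abs_of_nonneg hpx]
      exact mul_le_mul_of_nonneg_right (abs_node_le hh hi) hpx
    have hy1 : |y| < 1 := by
      have := abs_add_le x (y - x)
      rw [add_sub_cancel] at this
      linarith
    have hTy := hT y (abs_lt.1 hy1)
    calc ‖wt (k * h) x ^ r‖ₑ * ‖G y - Q.eval y‖ₑ
        ≤ ‖wt (k * h) x ^ r‖ₑ *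
          ∫⁻ z in uIoc x y, ‖iteratedDeriv k G z‖ₑ * ENNReal.ofReal (|y - z| ^ m) := by gcongr
      _ = ∫⁻ z in uIoc x y, ‖wt (k * h) x ^ r‖ₑ *
            (‖iteratedDeriv k G z‖ₑ * ENNReal.ofReal (|y - z| ^ m)) :=
          (lintegral_const_mul' _ _ enorm_ne_top).symm
      _ ≤ ∫⁻ z in uIoc x y, ENNReal.ofReal ((2 * a) ^ m) * (ENNReal.ofReal (1 / phi z) *
            ‖iteratedDeriv k G z * phi z ^ (k + r)‖ₑ) := by
          refine setLIntegral_mono' measurableSet_uIoc fun z hz => ?_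
          obtain ⟨h1, h2⟩ := abs_node_sub_le ha0 hx1 hx.le hyx hz
          have hz1 : |z| < 1 := by
            have := abs_add_le x (z - x)
            rw [add_sub_cancel] at this
            linarith
          have hpz := phi_pos hz1
          have hw : wt (k * h) x ≤ phi z := wt_le_phi hx.le h2
          have hw0 := wt_nonneg (k * h) x
          rw [← ofReal_norm (iteratedDeriv k G z), ← ofReal_norm, ← ofReal_norm,
            ← ENNReal.ofReal_mul (by positivity), ← ENNReal.ofReal_mul (by positivity),
            ← ENNReal.ofReal_mul (by positivity), ← ENNReal.ofReal_mul (by positivity)]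
          refine ENNReal.ofReal_le_ofReal ?_
          rw [norm_mul, norm_pow, norm_pow, Real.norm_of_nonneg hpz.le, Real.norm_of_nonneg hw0]
          calc wt (k * h) x ^ r * (‖iteratedDeriv k G z‖ * |y - z| ^ m)
              ≤ phi z ^ r * (‖iteratedDeriv k G z‖ * (2 * a * phi z) ^ m) := by gcongr
            _ = _ := by
                rw [hk, mul_pow]
                field_simp
                ring
      _ ≤ ∫⁻ z in {z | |z - x| ≤ a * phi x}, ENNReal.ofReal ((2 * a) ^ m) *
            (ENNReal.ofReal (1 / phi z) * ‖iteratedDeriv k G z * phi z ^ (k + r)‖ₑ) :=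
          lintegral_mono_set fun z hz => (abs_node_sub_le ha0 hx1 hx.le hyx hz).2
      _ = _ := lintegral_const_mul' _ _ ENNReal.ofReal_ne_top
  rw [wdiff, enorm_mul, hD]
  calc _ ≤ ‖wt (k * h) x ^ r‖ₑ * ∑ i ∈ Finset.range (k + 1), (k.choose i : ℝ≥0∞) *
        ‖(fun y => G y - Q.eval y) (x - k * (h * phi x) / 2 + i * (h * phi x))‖ₑ := by
        gcongr; exact enorm_fd_le _ _ _ _
    _ = ∑ i ∈ Finset.range (k + 1), (k.choose i : ℝ≥0∞) * (‖wt (k * h) x ^ r‖ₑ *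
        ‖(fun y => G y - Q.eval y) (x - k * (h * phi x) / 2 + i * (h * phi x))‖ₑ) := by
        rw [Finset.mul_sum]; exact Finset.sum_congr rfl fun i _ => by ring
    _ ≤ ∑ i ∈ Finset.range (k + 1), (k.choose i : ℝ≥0∞) * (ENNReal.ofReal ((2 * a) ^ m) * I) := by
        refine Finset.sum_le_sum fun i hi => ?_
        exact mul_le_mul' le_rfl (hterm i hi)
    _ = _ := by rw [← Finset.sum_mul, sum_choose_ennreal]; ring

/-- For almost every centre, no node of the difference is one of the end points `±1`, where nothing
is known about a function in `B_p^r`. -/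
theorem ae_strict_fit {k : ℕ} {h : ℝ} (hh : 0 ≤ h) :
    ∀ᵐ x : ℝ, x ∈ Dom (k * h) → |x| + k * h / 2 * phi x < 1 := by
  have hne : ∀ᵐ x ∂(volume.restrict (Icc (-1 : ℝ) 1)), x ≠ 1 ∧ x ≠ -1 :=
    ae_restrict_of_ae ae_ne_one_and_ne_neg_one
  have h1 := (quasi_node (k := k) hh (i := k) (by simp)).ae hne
  have h2 := (quasi_node (k := k) hh (i := 0) (by simp)).ae hne
  rw [ae_restrict_iff' (measurableSet_Dom _)] at h1 h2
  filter_upwards [h1, h2] with x hx1 hx2 hD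
  have hx := ((mem_Dom_iff (by positivity)).1 hD).2
  refine lt_of_le_of_ne (by linarith) fun heq => ?_
  rcases abs_cases x with ⟨h, _⟩ | ⟨h, _⟩ <;> rw [h] at heq
  · refine (hx1 hD).1 ?_
    rw [← heq]; ring
  · refine (hx2 hD).2 ?_
    rw [← heq]; push_cast; ring

/-- The modulus of a smooth function is controlled by the weighted norm of its derivative. -/
theorem eLpNorm_wdiff_smooth_le {m r : ℕ} {h : ℝ} (hh : 0 ≤ h) {G : ℝ → ℝ}
    (hG : ContDiffOn ℝ m G (Ioo (-1) 1)) (hAC : ACLoc (iteratedDeriv m G))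
    {p : ℝ≥0∞} (hp : 1 ≤ p) :
    eLpNorm (wdiff (m + 1) r G h) p (volume.restrict (Icc (-1 : ℝ) 1)) ≤
      ENNReal.ofReal (4 * (2 * (m + 1)) ^ (m + 1)) * ENNReal.ofReal (h ^ (m + 1)) *
        normP p (fun x => iteratedDeriv (m + 1) G x * phi x ^ (m + 1 + r)) := by
  set a : ℝ := ((m + 1 : ℕ) : ℝ) * h / 2 with ha
  have ha0 : 0 ≤ a := by positivity
  let R : Set (ℝ × ℝ) := {q | |q.1| + a * phi q.1 < 1 ∧ |q.2 - q.1| ≤ a * phi q.1}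
  have hR : MeasurableSet R :=
    measurableSet_and (measurableSet_lt (by fun_prop) (by fun_prop))
      (measurableSet_le (by fun_prop) (by fun_prop))
  let K : ℝ × ℝ → ℝ≥0∞ := R.indicator fun q => ENNReal.ofReal (1 / phi q.2)
  have hKm : Measurable K := Measurable.indicator (by fun_prop) hR
  have hlt : ∀ x : ℝ, |x| + a * phi x < 1 → |x| < 1 := fun x hx =>
    lt_of_le_of_lt (le_add_of_nonneg_right (mul_nonneg ha0 (phi_nonneg x))) hx
  have hKx : ∀ x, |x| + a * phi x < 1 → (fun z => K (x, z)) =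
      ({z | |z - x| ≤ a * phi x} : Set ℝ).indicator fun z => ENNReal.ofReal (1 / phi z) := by
    intro x hx
    funext z
    by_cases hz : |z - x| ≤ a * phi x
    · rw [indicator_of_mem (show z ∈ {z | |z - x| ≤ a * phi x} from hz)]
      exact indicator_of_mem (show (x, z) ∈ R from ⟨hx, hz⟩) _
    · rw [indicator_of_notMem (show z ∉ {z | |z - x| ≤ a * phi x} from hz)]
      exact indicator_of_notMem (fun h : (x, z) ∈ R => hz h.2) _
  have hms : ∀ x, MeasurableSet {z : ℝ | |z - x| ≤ a * phi x} := fun x =>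
    measurableSet_le (by fun_prop) (by fun_prop)
  have hH : Measurable fun x => iteratedDeriv (m + 1) G x * phi x ^ (m + 1 + r) := by
    rw [iteratedDeriv_succ]
    exact (measurable_deriv _).mul (by fun_prop)
  -- Schur's test for the kernel `1/φ(z)` on the pairs with `|z - x| ≤ aφ(x)`: the row integrals are
  -- means of `1/φ`, the column integrals are the measures of the sets of centres through `z`.
  have hc1 : ∀ x, ∫⁻ z, K (x, z) ∂(volume.restrict (Icc (-1 : ℝ) 1)) ≤ ENNReal.ofReal (8 * a) := by
    intro x
    by_cases hx : |x| + a * phi x < 1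
    · refine (setLIntegral_le_lintegral _ _).trans ?_
      have hx1 := hlt x hx
      have hxx := abs_lt.1 hx1
      have hp := phi_pos hx1
      have hap : 0 ≤ a * phi x := by positivity
      rw [hKx x hx, lintegral_indicator (hms x)]
      have hset : {z : ℝ | |z - x| ≤ a * phi x} ⊆
          Icc (x - a * phi x) x ∪ Icc x (x + a * phi x) := by
        intro z hz
        have := abs_le.1 (show |z - x| ≤ a * phi x from hz)
        rcases le_total z x with h | h
        · exact Or.inl ⟨by linarith, h⟩
        · exact Or.inr ⟨h, by linarith⟩
      calc _ ≤ ∫⁻ z in Icc (x - a * phi x) x ∪ Icc x (x + a * phi x),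
            ENNReal.ofReal (1 / phi z) := lintegral_mono_set hset
        _ ≤ _ := lintegral_union_le _ _ _
        _ ≤ ENNReal.ofReal (2 * (x - (x - a * phi x)) / phi x) +
            ENNReal.ofReal (2 * (x + a * phi x - x) / phi x) := by
            refine add_le_add (lintegral_inv_phi_left_le hxx.2 (by linarith) ?_)
              (lintegral_inv_phi_right_le hxx.1 (by linarith) ?_)
            · linarith [neg_abs_le x]
            · linarith [le_abs_self x]
        _ = ENNReal.ofReal (2 * a + 2 * a) := by
            rw [ENNReal.ofReal_add (by positivity) (by positivity)]
            congr 2 <;> (field_simp; ring)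
        _ ≤ _ := ENNReal.ofReal_le_ofReal (by linarith)
    · have : (fun z => K (x, z)) = fun _ => 0 := by
        funext z
        exact indicator_of_notMem (fun h : (x, z) ∈ R => hx h.1) _
      rw [this]; simp
  have hc2 : ∀ᵐ z ∂(volume.restrict (Icc (-1 : ℝ) 1)),
      ∫⁻ x, K (x, z) ∂(volume.restrict (Icc (-1 : ℝ) 1)) ≤ ENNReal.ofReal (8 * a) := by
    rw [ae_restrict_iff' measurableSet_Icc]
    filter_upwards [ae_ne_one_and_ne_neg_one] with z hne hz
    have hz1 : |z| < 1 := lt_of_le_of_ne (abs_le.2 hz) fun h =>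
      ((abs_eq zero_le_one).1 h).elim hne.1 hne.2
    have hpz := phi_pos hz1
    refine (setLIntegral_le_lintegral _ _).trans ?_
    have hm : MeasurableSet {x : ℝ | |x| < 1 ∧ |x| + a * phi x ≤ 1 ∧ |z - x| ≤ a * phi x} :=
      measurableSet_and (measurableSet_lt (by fun_prop) (by fun_prop))
        (measurableSet_and (measurableSet_le (by fun_prop) (by fun_prop))
        (measurableSet_le (by fun_prop) (by fun_prop)))
    calc ∫⁻ x, K (x, z) ≤ ∫⁻ x,
          ({x : ℝ | |x| < 1 ∧ |x| + a * phi x ≤ 1 ∧ |z - x| ≤ a * phi x}).indicator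
            (fun _ => ENNReal.ofReal (1 / phi z)) x := by
          refine lintegral_mono fun x => ?_
          by_cases hx : (x, z) ∈ R
          · rw [indicator_of_mem (show x ∈ {x : ℝ | |x| < 1 ∧ |x| + a * phi x ≤ 1 ∧
              |z - x| ≤ a * phi x} from ⟨hlt x hx.1, hx.1.le, hx.2⟩)]
            exact (indicator_of_mem hx _).le
          · exact (indicator_of_notMem hx _).le.trans zero_le
      _ = ENNReal.ofReal (1 / phi z) * _ := lintegral_indicator_const hm _
      _ ≤ ENNReal.ofReal (1 / phi z) * ENNReal.ofReal (8 * a * phi z) := by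
          gcongr; exact volume_fibre_le ha0
      _ = _ := by
          rw [← ENNReal.ofReal_mul (by positivity)]
          congr 1; field_simp
  have hE : ∀ᵐ x ∂(volume.restrict (Icc (-1 : ℝ) 1)), ‖wdiff (m + 1) r G h x‖ₑ ≤
      (2 ^ (m + 1) * ENNReal.ofReal ((2 * a) ^ m)) *
      ∫⁻ z, K (x, z) * ‖(fun x => iteratedDeriv (m + 1) G x * phi x ^ (m + 1 + r)) z‖ₑ
        ∂(volume.restrict (Icc (-1 : ℝ) 1)) := by
    refine ae_restrict_of_ae ?_
    filter_upwards [ae_strict_fit (k := m + 1) hh, ae_ne_one_and_ne_neg_one] with x hx hne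
    by_cases hD : x ∈ Dom ((m + 1 : ℕ) * h)
    · have hfit : |x| + a * phi x < 1 := hx hD
      refine (enorm_wdiff_le hh hfit hG hAC).trans (mul_le_mul' le_rfl ?_)
      rw [← ha]
      rw [← lintegral_indicator (hms x)]
      have hsub : {z : ℝ | |z - x| ≤ a * phi x} ⊆ Icc (-1) 1 := by
        intro z hz
        have := abs_le.1 (show |z - x| ≤ a * phi x from hz)
        constructor
        · linarith [neg_abs_le x]
        · linarith [le_abs_self x]
      rw [← lintegral_indicator measurableSet_Icc]
      refine lintegral_mono fun z => ?_
      by_cases hz : |z - x| ≤ a * phi x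
      · rw [indicator_of_mem (show z ∈ {z | |z - x| ≤ a * phi x} from hz),
          indicator_of_mem (hsub hz)]
        have : K (x, z) = ENNReal.ofReal (1 / phi z) :=
          indicator_of_mem (show (x, z) ∈ R from ⟨hfit, hz⟩) _
        rw [this]
      · rw [indicator_of_notMem (show z ∉ {z | |z - x| ≤ a * phi x} from hz)]
        exact zero_le
    · rw [wdiff, symmDelta_eq_zero_of_not_mem hh hD hne.1 hne.2]
      simp
  have hnorm := eLpNorm_le_mul_of_kernel hKm
    (ENNReal.mul_ne_top (by simp) ENNReal.ofReal_ne_top) ENNReal.ofReal_ne_top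
    (Filter.Eventually.of_forall hc1) hc2 hH hE hp
  refine hnorm.trans_eq ?_
  unfold normP
  congr 1
  have h2 : (2 : ℝ≥0∞) ^ (m + 1) = ENNReal.ofReal (2 ^ (m + 1)) := by
    rw [ENNReal.ofReal_pow (by norm_num)]; simp
  rw [h2, ← ENNReal.ofReal_mul (by positivity), ← ENNReal.ofReal_mul (by positivity),
    ← ENNReal.ofReal_mul (by positivity)]
  congr 1
  have h3 : 2 * a = (m + 1) * h := by rw [ha]; push_cast; ring
  have h4 : 8 * a = 4 * ((m + 1) * h) := by rw [← h3]; ring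
  rw [h3, h4, mul_pow, mul_pow]
  ring

/-! ### One-sided differences near the end points -/

/-- `G` agrees near every point with a polynomial of degree at most `m`, up to a Taylor remainder
in which `D` plays the role of the derivative of order `m + 1`. -/
def HasTaylorBound (m : ℕ) (G D : ℝ → ℝ) : Prop :=
  ∀ x ∈ Ioo (-1 : ℝ) 1, ∃ Q ∈ Polynomial.degreeLT ℝ (m + 1), ∀ y ∈ Ioo (-1 : ℝ) 1,
    ‖G y - Q.eval y‖ₑ ≤ ∫⁻ z in uIcc x y, ‖D z‖ₑ * ENNReal.ofReal (|y - z| ^ m)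

theorem hasTaylorBound_iteratedDeriv {m : ℕ} {G : ℝ → ℝ} (hG : ContDiffOn ℝ m G (Ioo (-1) 1))
    (hAC : ACLoc (iteratedDeriv m G)) : HasTaylorBound m G (iteratedDeriv (m + 1) G) := by
  intro x hx
  obtain ⟨Q, hQ, h⟩ := exists_taylor_polynomial m G hG hAC x hx
  exact ⟨Q, hQ, fun y hy => (h y hy).trans (lintegral_mono_set uIoc_subset_uIcc)⟩

open Polynomial in
theorem comp_neg_X_mem_degreeLT {n : ℕ} {Q : ℝ[X]} (hQ : Q ∈ degreeLT ℝ n) :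
    Q.comp (-X) ∈ degreeLT ℝ n := by
  rw [mem_degreeLT] at hQ ⊢
  rcases eq_or_ne Q 0 with rfl | h0
  · simp
  refine lt_of_le_of_lt ?_ hQ
  rw [degree_eq_natDegree h0]
  refine degree_le_of_natDegree_le ?_
  refine natDegree_comp_le.trans ?_
  simp

theorem HasTaylorBound.comp_neg {m : ℕ} {G D : ℝ → ℝ} (h : HasTaylorBound m G D) :
    HasTaylorBound m (fun x => G (-x)) (fun x => D (-x)) := by
  intro x hx
  obtain ⟨Q, hQ, hb⟩ := h (-x) ⟨by linarith [hx.2], by linarith [hx.1]⟩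
  refine ⟨Q.comp (-Polynomial.X), comp_neg_X_mem_degreeLT hQ, fun y hy => ?_⟩
  have h1 := hb (-y) ⟨by linarith [hy.2], by linarith [hy.1]⟩
  rw [Polynomial.eval_comp, Polynomial.eval_neg, Polynomial.eval_X]
  refine h1.trans_eq ?_
  rw [← setLIntegral_comp_neg, ← image_neg_eq_neg, image_neg_uIcc, neg_neg, neg_neg]
  refine lintegral_congr fun z => ?_
  rw [show -y - -z = -(y - z) by ring, abs_neg]

theorem phi_le_phi {x y : ℝ} (hxy : x ≤ y) (hy : y ≤ 0) : phi x ≤ phi y := by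
  unfold phi
  refine Real.sqrt_le_sqrt ?_
  nlinarith

theorem forwardDelta_eq_fd {k : ℕ} {h x : ℝ} {F : ℝ → ℝ} (hh : 0 ≤ h) (hx : -1 ≤ x)
    (hxh : x + k * h ≤ 1) : forwardDelta k h F x = fd k h F x := by
  have hk : (0 : ℝ) ≤ k * h := by positivity
  unfold forwardDelta
  rw [symmDelta_eq_fd ⟨by linarith, by linarith⟩ ⟨by linarith, by linarith⟩]
  congr 1
  ring

theorem one_add_le_phi_sq {z : ℝ} (hz : -1 ≤ z) (hz0 : z ≤ 0) : 1 + z ≤ phi z ^ 2 := by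
  rw [phi_sq (abs_le.2 ⟨hz, by linarith⟩)]
  nlinarith

theorem sqrt_one_add_le_phi {z : ℝ} (hz : -1 ≤ z) (hz0 : z ≤ 0) : Real.sqrt (1 + z) ≤ phi z := by
  rw [← Real.sqrt_sq (phi_nonneg z)]
  exact Real.sqrt_le_sqrt (one_add_le_phi_sq hz hz0)

/-- The distance from `z` to a point at most `q` to its left, but not left of `-1`, is at most
`√q φ(z)`. -/
theorem min_le_sqrt_mul_phi {q z : ℝ} (hq : 0 ≤ q) (hz : -1 ≤ z) (hz0 : z ≤ 0) :
    min q (1 + z) ≤ Real.sqrt q * phi z := by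
  have h1 : 0 ≤ 1 + z := by linarith
  have h2 : 0 ≤ min q (1 + z) := le_min hq h1
  calc min q (1 + z) = Real.sqrt (min q (1 + z)) * Real.sqrt (min q (1 + z)) :=
        (Real.mul_self_sqrt h2).symm
    _ ≤ Real.sqrt q * Real.sqrt (1 + z) := by
        gcongr
        · exact min_le_left _ _
        · exact min_le_right _ _
    _ ≤ _ := by gcongr; exact sqrt_one_add_le_phi hz hz0

theorem map_add_le {b c : ℝ} (hc : 0 ≤ c) (hbc : b + c ≤ 0) :
    (volume.restrict (Icc (-1 : ℝ) b)).map (fun x => x + c) ≤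
      (1 : ℝ≥0∞) • volume.restrict (Icc (-1 : ℝ) 1) := by
  refine Measure.le_iff.2 fun s hs => ?_
  have hm : Measurable fun x : ℝ => x + c := by fun_prop
  rw [Measure.map_apply hm hs, Measure.restrict_apply (hm hs), one_smul, Measure.restrict_apply hs]
  calc volume ((fun x => x + c) ⁻¹' s ∩ Icc (-1) b)
      ≤ volume ((fun x => x + c) ⁻¹' (s ∩ Icc (-1) 1)) := by
        refine measure_mono ?_
        rintro x ⟨h1, h2⟩
        exact ⟨h1, by linarith [h2.1], by linarith [h2.2]⟩
    _ = volume (s ∩ Icc (-1) 1) := measure_preimage_add_right volume c _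

theorem aestronglyMeasurable_fd {k : ℕ} {h b : ℝ} (hh : 0 ≤ h) (hb : b + k * h ≤ 0) {F : ℝ → ℝ}
    (hF : AEStronglyMeasurable F (volume.restrict (Icc (-1 : ℝ) 1))) :
    AEStronglyMeasurable (fd k h F) (volume.restrict (Icc (-1 : ℝ) b)) := by
  unfold fd
  refine Finset.aestronglyMeasurable_fun_sum _ fun i hi => ?_
  refine AEStronglyMeasurable.const_mul ?_ _
  have hi' : (i : ℝ) ≤ k := by exact_mod_cast Finset.mem_range_succ_iff.1 hi
  have hle := map_add_le (b := b) (c := i * h) (by positivity) (by nlinarith)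
  rw [one_smul] at hle
  exact hF.comp_quasiMeasurePreserving ⟨by fun_prop, Measure.absolutelyContinuous_of_le hle⟩

theorem eLpNorm_phi_mul_fd_le {k r : ℕ} {h b : ℝ} (hh : 0 ≤ h) (hb : b + k * h ≤ 0) {F : ℝ → ℝ}
    {p : ℝ≥0∞} (hp : 1 ≤ p)
    (hF : AEStronglyMeasurable F (volume.restrict (Icc (-1 : ℝ) 1))) :
    eLpNorm (fun x => phi x ^ r * fd k h F x) p (volume.restrict (Icc (-1 : ℝ) b)) ≤
      2 ^ k * normP p (fun x => F x * phi x ^ r) := by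
  have hmap : ∀ i ∈ Finset.range (k + 1), (volume.restrict (Icc (-1 : ℝ) b)).map
      (fun x => x + i * h) ≤ (1 : ℝ≥0∞) • volume.restrict (Icc (-1 : ℝ) 1) := by
    intro i hi
    have hi' : (i : ℝ) ≤ k := by exact_mod_cast Finset.mem_range_succ_iff.1 hi
    exact map_add_le (by positivity) (by nlinarith)
  have hsum : (fun x => phi x ^ r * fd k h F x) = ∑ i ∈ Finset.range (k + 1),
      ((k.choose i : ℝ) * (-1) ^ (k - i)) • fun x => phi x ^ r * F (x + i * h) := by
    funext x
    rw [fd, Finset.mul_sum, Finset.sum_apply]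
    refine Finset.sum_congr rfl fun i _ => ?_
    rw [Pi.smul_apply, smul_eq_mul]
    ring
  rw [hsum]
  refine (eLpNorm_sum_le (fun i hi => ?_) hp).trans ?_
  · have hle := hmap i hi
    rw [one_smul] at hle
    have h1 : AEStronglyMeasurable (fun x => F (x + i * h)) (volume.restrict (Icc (-1 : ℝ) b)) :=
      hF.comp_quasiMeasurePreserving ⟨by fun_prop, Measure.absolutelyContinuous_of_le hle⟩
    have h2 : Measurable (fun x => phi x ^ r) := by fun_prop
    exact (h2.aestronglyMeasurable.mul h1).const_smul _
  calc _ ≤ ∑ i ∈ Finset.range (k + 1), (k.choose i : ℝ≥0∞) *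
        normP p (fun x => F x * phi x ^ r) := by
        refine Finset.sum_le_sum fun i hi => ?_
        have hi' : (i : ℝ) ≤ k := by exact_mod_cast Finset.mem_range_succ_iff.1 hi
        rw [eLpNorm_const_smul, enorm_choose_mul_neg_one_pow]
        refine mul_le_mul' le_rfl ?_
        have hmono : eLpNorm (fun x => phi x ^ r * F (x + i * h)) p
            (volume.restrict (Icc (-1 : ℝ) b)) ≤ eLpNorm
            (fun x => F (x + i * h) * phi (x + i * h) ^ r) p
            (volume.restrict (Icc (-1 : ℝ) b)) := by
          refine eLpNorm_mono_ae ?_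
          rw [ae_restrict_iff' measurableSet_Icc]
          refine Filter.Eventually.of_forall fun x hx => ?_
          have h0 : 0 ≤ i * h := by positivity
          have hw : phi x ≤ phi (x + i * h) :=
            phi_le_phi (by linarith) (by nlinarith [hx.2])
          rw [norm_mul, norm_mul, norm_pow, norm_pow, mul_comm, Real.norm_of_nonneg (phi_nonneg _),
            Real.norm_of_nonneg (phi_nonneg _)]
          gcongr
          exact phi_nonneg _
        refine hmono.trans ?_
        have hFp : AEStronglyMeasurable (fun x => F x * phi x ^ r)
            (volume.restrict (Icc (-1 : ℝ) 1)) := hF.mul (by fun_prop)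
        have := eLpNorm_comp_le_of_map_le (T := fun x => x + i * h)
          (g := fun x => F x * phi x ^ r) le_rfl hp (by fun_prop) (hmap i hi) hFp
        rwa [one_mul] at this
    _ = 2 ^ k * normP p (fun x => F x * phi x ^ r) := by
        rw [← Finset.sum_mul, sum_choose_ennreal]

/-- Pointwise bound of a one-sided difference of a smooth function near the end point `-1`. The
Taylor polynomial is taken at the node farthest from the end point, where `φ` is largest. -/
theorem enorm_phi_mul_fd_le {m r : ℕ} {h x : ℝ} (hh : 0 ≤ h) (hx : -1 < x)
    (hxh : x + ((m + 1 : ℕ) : ℝ) * h ≤ 0) {G D : ℝ → ℝ} (hG : HasTaylorBound m G D) :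
    ‖phi x ^ r * fd (m + 1) h G x‖ₑ ≤
      2 ^ (m + 1) * ENNReal.ofReal (Real.sqrt (((m + 1 : ℕ) : ℝ) * h) ^ m) *
        ∫⁻ z in Icc x (x + ((m + 1 : ℕ) : ℝ) * h), ENNReal.ofReal (1 / phi z) *
          ‖D z * phi z ^ (m + 1 + r)‖ₑ := by
  set k := m + 1 with hk
  have hkh : 0 ≤ (k : ℝ) * h := by positivity
  obtain ⟨Q, hQ, hT⟩ := hG (x + k * h) ⟨by linarith, by linarith⟩
  rw [fd_eq_fd_sub_polynomial hQ]
  set I := ∫⁻ z in Icc x (x + k * h), ENNReal.ofReal (1 / phi z) *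
          ‖D z * phi z ^ (k + r)‖ₑ with hI
  have hterm : ∀ i ∈ Finset.range (k + 1), ‖phi x ^ r‖ₑ * ‖(fun y => G y - Q.eval y)
      (x + i * h)‖ₑ ≤ ENNReal.ofReal (Real.sqrt (k * h) ^ m) * I := by
    intro i hi
    have hi' : (i : ℝ) ≤ k := by exact_mod_cast Finset.mem_range_succ_iff.1 hi
    have hi0 : 0 ≤ (i : ℝ) * h := by positivity
    have hik : (i : ℝ) * h ≤ k * h := by gcongr
    set y := x + i * h with hy
    have hTy := hT y ⟨by linarith, by linarith⟩
    have hu : uIcc (x + k * h) y = Icc y (x + k * h) := by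
      rw [uIcc_comm, uIcc_of_le]; linarith
    rw [hu] at hTy
    calc ‖phi x ^ r‖ₑ * ‖G y - Q.eval y‖ₑ
        ≤ ‖phi x ^ r‖ₑ *
          ∫⁻ z in Icc y (x + k * h), ‖D z‖ₑ * ENNReal.ofReal (|y - z| ^ m) := by gcongr
      _ = ∫⁻ z in Icc y (x + k * h), ‖phi x ^ r‖ₑ *
            (‖D z‖ₑ * ENNReal.ofReal (|y - z| ^ m)) :=
          (lintegral_const_mul' _ _ enorm_ne_top).symm
      _ ≤ ∫⁻ z in Icc y (x + k * h), ENNReal.ofReal (Real.sqrt (k * h) ^ m) *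
            (ENNReal.ofReal (1 / phi z) * ‖D z * phi z ^ (k + r)‖ₑ) := by
          refine setLIntegral_mono' measurableSet_Icc fun z hz => ?_
          have hz0 : z ≤ 0 := by linarith [hz.2]
          have hz1 : -1 < z := by linarith [hz.1]
          have hpz := phi_pos (abs_lt.2 ⟨hz1, by linarith⟩)
          have hw : phi x ≤ phi z := phi_le_phi (by linarith [hz.1]) hz0
          have hw0 := phi_nonneg x
          have hdist : |y - z| ≤ Real.sqrt (k * h) * phi z := by
            rw [abs_of_nonpos (by linarith [hz.1])]
            refine le_trans (le_min ?_ ?_) (min_le_sqrt_mul_phi hkh hz1.le hz0)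
            · linarith [hz.2]
            · linarith
          rw [← ofReal_norm (D z), ← ofReal_norm, ← ofReal_norm,
            ← ENNReal.ofReal_mul (by positivity), ← ENNReal.ofReal_mul (by positivity),
            ← ENNReal.ofReal_mul (by positivity), ← ENNReal.ofReal_mul (by positivity)]
          refine ENNReal.ofReal_le_ofReal ?_
          rw [norm_mul, norm_pow, norm_pow, Real.norm_of_nonneg hpz.le, Real.norm_of_nonneg hw0]
          calc phi x ^ r * (‖D z‖ * |y - z| ^ m)
              ≤ phi z ^ r * (‖D z‖ * (Real.sqrt (k * h) * phi z) ^ m) := by gcongr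
            _ = _ := by
                rw [hk, mul_pow]
                field_simp
                ring
      _ ≤ ∫⁻ z in Icc x (x + k * h), ENNReal.ofReal (Real.sqrt (k * h) ^ m) *
            (ENNReal.ofReal (1 / phi z) * ‖D z * phi z ^ (k + r)‖ₑ) :=
          lintegral_mono_set (Icc_subset_Icc (by linarith) le_rfl)
      _ = _ := lintegral_const_mul' _ _ ENNReal.ofReal_ne_top
  rw [enorm_mul]
  calc _ ≤ ‖phi x ^ r‖ₑ * ∑ i ∈ Finset.range (k + 1), (k.choose i : ℝ≥0∞) *
        ‖(fun y => G y - Q.eval y) (x + i * h)‖ₑ := by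
        gcongr; exact enorm_fd_le _ _ _ _
    _ = ∑ i ∈ Finset.range (k + 1), (k.choose i : ℝ≥0∞) * (‖phi x ^ r‖ₑ *
        ‖(fun y => G y - Q.eval y) (x + i * h)‖ₑ) := by
        rw [Finset.mul_sum]; exact Finset.sum_congr rfl fun i _ => by ring
    _ ≤ ∑ i ∈ Finset.range (k + 1), (k.choose i : ℝ≥0∞) *
          (ENNReal.ofReal (Real.sqrt (k * h) ^ m) * I) := by
        refine Finset.sum_le_sum fun i hi => ?_
        exact mul_le_mul' le_rfl (hterm i hi)
    _ = _ := by rw [← Finset.sum_mul, sum_choose_ennreal]; ring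

/-- One-sided differences of a smooth function near `-1`: the step `h` acts like `√h`, which is the
scale on which `φ` varies at the end point. -/
theorem eLpNorm_phi_mul_fd_smooth_le {m r : ℕ} {h b : ℝ} (hh : 0 < h)
    (hb : b + ((m + 1 : ℕ) : ℝ) * h ≤ 0) {G D : ℝ → ℝ} (hG : HasTaylorBound m G D)
    (hD : Measurable D) {p : ℝ≥0∞} (hp : 1 ≤ p) :
    eLpNorm (fun x => phi x ^ r * fd (m + 1) h G x) p (volume.restrict (Icc (-1 : ℝ) b)) ≤
      2 ^ (m + 1) * ENNReal.ofReal (Real.sqrt (((m + 1 : ℕ) : ℝ) * h) ^ m) *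
        ENNReal.ofReal (2 * Real.sqrt (((m + 1 : ℕ) : ℝ) * h)) *
        normP p (fun x => D x * phi x ^ (m + 1 + r)) := by
  set q : ℝ := ((m + 1 : ℕ) : ℝ) * h with hq
  have hq0 : 0 < q := by positivity
  let R : Set (ℝ × ℝ) := {w | (-1 < w.1 ∧ w.1 ≤ b) ∧ w.1 ≤ w.2 ∧ w.2 ≤ w.1 + q}
  have hR : MeasurableSet R :=
    measurableSet_and (measurableSet_and (measurableSet_lt (by fun_prop) (by fun_prop))
      (measurableSet_le (by fun_prop) (by fun_prop)))
      (measurableSet_and (measurableSet_le (by fun_prop) (by fun_prop))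
      (measurableSet_le (by fun_prop) (by fun_prop)))
  let K : ℝ × ℝ → ℝ≥0∞ := R.indicator fun w => ENNReal.ofReal (1 / phi w.2)
  have hKm : Measurable K := Measurable.indicator (by fun_prop) hR
  have hKx : ∀ x, -1 < x → x ≤ b → (fun z => K (x, z)) =
      (Icc x (x + q)).indicator fun z => ENNReal.ofReal (1 / phi z) := by
    intro x hx hxb
    funext z
    by_cases hz : z ∈ Icc x (x + q)
    · rw [indicator_of_mem hz]
      exact indicator_of_mem (show (x, z) ∈ R from ⟨⟨hx, hxb⟩, hz.1, hz.2⟩) _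
    · rw [indicator_of_notMem hz]
      exact indicator_of_notMem (fun h : (x, z) ∈ R => hz h.2) _
  have hH : Measurable fun x => D x * phi x ^ (m + 1 + r) := hD.mul (by fun_prop)
  have hmemb : ∀ᵐ x ∂(volume.restrict (Icc (-1 : ℝ) b)), -1 < x ∧ x ≤ b := by
    rw [ae_restrict_iff' measurableSet_Icc]
    filter_upwards [ae_ne_one_and_ne_neg_one] with x hne hx
    exact ⟨lt_of_le_of_ne hx.1 hne.2.symm, hx.2⟩
  have hc1 : ∀ᵐ x ∂(volume.restrict (Icc (-1 : ℝ) b)),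
      ∫⁻ z, K (x, z) ∂(volume.restrict (Icc (-1 : ℝ) 1)) ≤ ENNReal.ofReal (2 * Real.sqrt q) := by
    filter_upwards [hmemb] with x hx
    refine (setLIntegral_le_lintegral _ _).trans ?_
    rw [hKx x hx.1 hx.2, lintegral_indicator measurableSet_Icc]
    refine (lintegral_inv_phi_left_le (by linarith) (by linarith) hx.1).trans ?_
    refine ENNReal.ofReal_le_ofReal ?_
    have h1 : Real.sqrt q ≤ phi (x + q) :=
      (Real.sqrt_le_sqrt (by linarith)).trans (sqrt_one_add_le_phi (by linarith) (by linarith))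
    have h2 : 0 < Real.sqrt q := Real.sqrt_pos.2 hq0
    rw [div_le_iff₀ (h2.trans_le h1)]
    have h3 := Real.mul_self_sqrt hq0.le
    nlinarith
  have hc2 : ∀ᵐ z ∂(volume.restrict (Icc (-1 : ℝ) 1)),
      ∫⁻ x, K (x, z) ∂(volume.restrict (Icc (-1 : ℝ) b)) ≤ ENNReal.ofReal (2 * Real.sqrt q) := by
    rw [ae_restrict_iff' measurableSet_Icc]
    filter_upwards [ae_ne_one_and_ne_neg_one] with z hne hz
    refine (setLIntegral_le_lintegral _ _).trans ?_
    by_cases hz0 : z ≤ 0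
    · have hz1 : -1 < z := lt_of_le_of_ne hz.1 hne.2.symm
      have hpz := phi_pos (abs_lt.2 ⟨hz1, by linarith⟩)
      calc ∫⁻ x, K (x, z) ≤ ∫⁻ x, (Icc (z - min q (1 + z)) z).indicator
              (fun _ => ENNReal.ofReal (1 / phi z)) x := by
            refine lintegral_mono fun x => ?_
            by_cases hx : (x, z) ∈ R
            · have hmem : x ∈ Icc (z - min q (1 + z)) z := by
                obtain ⟨⟨h1, h2⟩, h3, h4⟩ := hx
                simp only at h1 h2 h3 h4
                refine ⟨?_, h3⟩
                have := le_min (show z - x ≤ q by linarith) (show z - x ≤ 1 + z by linarith)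
                linarith
              rw [indicator_of_mem hmem]
              exact (indicator_of_mem hx _).le
            · exact (indicator_of_notMem hx _).le.trans zero_le
        _ = ENNReal.ofReal (1 / phi z) * ENNReal.ofReal (min q (1 + z)) := by
            rw [lintegral_indicator_const measurableSet_Icc, Real.volume_Icc]
            congr 2; ring
        _ = ENNReal.ofReal (1 / phi z * min q (1 + z)) := by
            rw [ENNReal.ofReal_mul (by positivity)]
        _ ≤ _ := by
            refine ENNReal.ofReal_le_ofReal ?_
            rw [one_div_mul_eq_div, div_le_iff₀ hpz]
            have := min_le_sqrt_mul_phi hq0.le hz1.le hz0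
            have h0 : 0 ≤ Real.sqrt q * phi z := by positivity
            linarith
    · have : (fun x => K (x, z)) = fun _ => 0 := by
        funext x
        refine indicator_of_notMem (fun h : (x, z) ∈ R => hz0 ?_) _
        obtain ⟨⟨h1, h2⟩, h3, h4⟩ := h
        simp only at h1 h2 h3 h4
        linarith
      rw [this]; simp
  refine eLpNorm_le_mul_of_kernel hKm (ENNReal.mul_ne_top (by simp) ENNReal.ofReal_ne_top)
    ENNReal.ofReal_ne_top hc1 hc2 hH ?_ hp
  filter_upwards [hmemb] with x hx
  refine (enorm_phi_mul_fd_le hh.le hx.1 (by linarith) hG).trans (mul_le_mul' le_rfl ?_)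
  rw [← lintegral_indicator measurableSet_Icc, ← lintegral_indicator measurableSet_Icc]
  refine lintegral_mono fun z => ?_
  by_cases hz : z ∈ Icc x (x + q)
  · rw [indicator_of_mem hz, indicator_of_mem (show z ∈ Icc (-1 : ℝ) 1 from
      ⟨by linarith [hz.1], by linarith [hz.2]⟩)]
    have : K (x, z) = ENNReal.ofReal (1 / phi z) := by
      rw [show K (x, z) = (fun z => K (x, z)) z from rfl, hKx x hx.1 hx.2, indicator_of_mem hz]
    rw [this]
  · rw [indicator_of_notMem hz]
    exact zero_le

/-! ### Reflection -/

theorem eLpNorm_restrict_neg (f : ℝ → ℝ) (s : Set ℝ) (p : ℝ≥0∞) :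
    eLpNorm (fun x => f (-x)) p (volume.restrict (-s)) = eLpNorm f p (volume.restrict s) := by
  have h := (MeasurableEquiv.neg ℝ).restrict_map volume s
  have h2 : (volume : Measure ℝ).map (MeasurableEquiv.neg ℝ) = volume :=
    (Measure.measurePreserving_neg (volume : Measure ℝ)).map_eq
  rw [h2] at h
  have h3 := (MeasurableEquiv.neg ℝ).measurableEmbedding.eLpNorm_map_measure
    (μ := volume.restrict (MeasurableEquiv.neg ℝ ⁻¹' s)) (g := f) (p := p)
  rw [h, h3]
  rfl

theorem neg_Icc_one : -Icc (-1 : ℝ) 1 = Icc (-1) 1 := by simp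

theorem normP_comp_neg (p : ℝ≥0∞) (f : ℝ → ℝ) : normP p (fun x => f (-x)) = normP p f := by
  unfold normP
  rw [← eLpNorm_restrict_neg f, neg_Icc_one]

theorem sum_choose_reflect (k : ℕ) (a : ℕ → ℝ) :
    ∑ i ∈ Finset.range (k + 1), (k.choose i : ℝ) * (-1) ^ (k - i) * a (k - i) =
      (-1) ^ k * ∑ i ∈ Finset.range (k + 1), (k.choose i : ℝ) * (-1) ^ (k - i) * a i := by
  rw [← Finset.sum_flip, Finset.mul_sum]
  refine Finset.sum_congr rfl fun i hi => ?_
  have hi' : i ≤ k := Finset.mem_range_succ_iff.1 hi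
  rw [Nat.choose_symm hi', Nat.sub_sub_self hi']
  have h1 : ((-1 : ℝ)) ^ i = (-1) ^ k * (-1) ^ (k - i) := by
    rw [← pow_add, show k + (k - i) = i + 2 * (k - i) by omega, pow_add, pow_mul]
    simp
  rw [h1]
  ring

theorem fd_neg (k : ℕ) (u : ℝ) (F : ℝ → ℝ) (y : ℝ) :
    fd k (-u) F y = (-1) ^ k * fd k u F (y - k * u) := by
  unfold fd
  rw [← sum_choose_reflect k fun i => F (y - k * u + i * u)]
  refine Finset.sum_congr rfl fun i hi => ?_
  have hi' : i ≤ k := Finset.mem_range_succ_iff.1 hi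
  rw [Nat.cast_sub hi']
  congr 2
  ring

theorem fd_comp_neg (k : ℕ) (u : ℝ) (F : ℝ → ℝ) (y : ℝ) :
    fd k u (fun x => F (-x)) y = fd k (-u) F (-y) := by
  unfold fd
  refine Finset.sum_congr rfl fun i _ => ?_
  congr 2
  ring_nf

theorem symmDelta_comp_neg (k : ℕ) (h : ℝ) (F : ℝ → ℝ) (x : ℝ) :
    symmDelta k h (fun y => F (-y)) x = (-1) ^ k * symmDelta k h F (-x) := by
  have hiff : (x + k * h / 2 ∈ Icc (-1 : ℝ) 1 ∧ x - k * h / 2 ∈ Icc (-1 : ℝ) 1) ↔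
      (-x + k * h / 2 ∈ Icc (-1 : ℝ) 1 ∧ -x - k * h / 2 ∈ Icc (-1 : ℝ) 1) := by
    constructor <;> rintro ⟨⟨h1, h2⟩, ⟨h3, h4⟩⟩ <;>
      exact ⟨⟨by linarith, by linarith⟩, ⟨by linarith, by linarith⟩⟩
  by_cases hc : x + k * h / 2 ∈ Icc (-1 : ℝ) 1 ∧ x - k * h / 2 ∈ Icc (-1 : ℝ) 1
  · rw [symmDelta_eq_fd hc.1 hc.2, symmDelta_eq_fd (hiff.1 hc).1 (hiff.1 hc).2, fd_comp_neg,
      fd_neg]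
    congr 2
    ring
  · have h1 : symmDelta k h (fun y => F (-y)) x = 0 := if_neg hc
    have h2 : symmDelta k h F (-x) = 0 := if_neg fun h' => hc (hiff.2 h')
    rw [h1, h2, mul_zero]

theorem wt_neg (δ x : ℝ) : wt δ (-x) = wt δ x := by
  unfold wt
  rw [phi_neg]
  congr 1
  ring

theorem enorm_neg_one_pow_mul (k : ℕ) (x : ℝ) : ‖(-1) ^ k * x‖ₑ = ‖x‖ₑ := by
  rw [enorm_mul, enorm_pow, enorm_neg, enorm_one, one_pow, one_mul]

theorem enorm_wdiff_comp_neg (k r : ℕ) (F : ℝ → ℝ) (h x : ℝ) :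
    ‖wdiff k r (fun y => F (-y)) h x‖ₑ = ‖wdiff k r F h (-x)‖ₑ := by
  unfold wdiff
  rw [symmDelta_comp_neg, wt_neg, phi_neg, mul_left_comm, enorm_neg_one_pow_mul]

theorem enorm_backwardDelta (k : ℕ) (h : ℝ) (F : ℝ → ℝ) (x : ℝ) :
    ‖backwardDelta k h F x‖ₑ = ‖forwardDelta k h (fun y => F (-y)) (-x)‖ₑ := by
  unfold backwardDelta forwardDelta
  rw [symmDelta_comp_neg, enorm_neg_one_pow_mul]
  congr 2
  ring_nf

theorem eLpNorm_backwardDelta (k r : ℕ) (h : ℝ) (F : ℝ → ℝ) (p : ℝ≥0∞) (b : ℝ) :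
    eLpNorm (fun x => phi x ^ r * backwardDelta k h F x) p (volume.restrict (Icc (1 - b) 1)) =
      eLpNorm (fun x => phi x ^ r * forwardDelta k h (fun y => F (-y)) x) p
        (volume.restrict (Icc (-1) (-1 + b))) := by
  rw [← eLpNorm_restrict_neg _ (Icc (-1) (-1 + b)), Set.neg_Icc]
  rw [show -(-1 + b) = 1 - b by ring, neg_neg]
  refine eLpNorm_congr_enorm_ae (Filter.Eventually.of_forall fun x => ?_)
  rw [enorm_mul, enorm_mul, enorm_backwardDelta, phi_neg]

/-! ### The moduli are bounded by the `K`-functional -/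

theorem contDiffOn_iteratedDeriv {m : ℕ} (r : ℕ) : ∀ {g : ℝ → ℝ},
    ContDiffOn ℝ (m + r : ℕ) g (Ioo (-1) 1) → ContDiffOn ℝ m (iteratedDeriv r g) (Ioo (-1) 1) := by
  induction r with
  | zero => intro g hg; simpa using hg
  | succ r ih =>
    intro g hg
    rw [iteratedDeriv_succ']
    refine ih ?_
    have hg' : ContDiffOn ℝ (((m + r : ℕ) : WithTop ℕ∞) + 1) g (Ioo (-1) 1) := by
      exact_mod_cast hg
    exact ((contDiffOn_succ_iff_deriv_of_isOpen isOpen_Ioo).1 hg').2.2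

theorem iteratedDeriv_iteratedDeriv (m r : ℕ) (g : ℝ → ℝ) :
    iteratedDeriv m (iteratedDeriv r g) = iteratedDeriv (m + r) g := by
  rw [iteratedDeriv_eq_iterate, iteratedDeriv_eq_iterate, iteratedDeriv_eq_iterate,
    Function.iterate_add_apply]

theorem BSpace_succ {p : ℝ≥0∞} {m r : ℕ} {g : ℝ → ℝ} (hg : g ∈ BSpace p (m + 1 + r)) :
    ContDiffOn ℝ m (iteratedDeriv r g) (Ioo (-1) 1) ∧
      ACLoc (iteratedDeriv m (iteratedDeriv r g)) ∧
      iteratedDeriv (m + 1) (iteratedDeriv r g) = iteratedDeriv (m + 1 + r) g := by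
  rw [show m + 1 + r = (m + r) + 1 by omega] at hg
  obtain ⟨h1, h2, -⟩ := hg
  refine ⟨contDiffOn_iteratedDeriv r h1, ?_, iteratedDeriv_iteratedDeriv _ _ _⟩
  rwa [iteratedDeriv_iteratedDeriv]

theorem aestronglyMeasurable_of_continuousOn {G : ℝ → ℝ} (hG : ContinuousOn G (Ioo (-1) 1)) :
    AEStronglyMeasurable G (volume.restrict (Icc (-1 : ℝ) 1)) := by
  rw [← Measure.restrict_congr_set (Ioo_ae_eq_Icc (a := (-1 : ℝ)) (b := 1))]
  exact hG.aestronglyMeasurable measurableSet_Ioo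

theorem le_mul_iInf_mem {α : Type*} {s : Set α} {M C : ℝ≥0∞} {A : α → ℝ≥0∞} (h0 : C ≠ 0)
    (ht : C ≠ ∞) (h : ∀ g ∈ s, M ≤ C * A g) : M ≤ C * ⨅ g ∈ s, A g := by
  rw [mul_comm, ← ENNReal.div_le_iff h0 ht]
  refine le_iInf₂ fun g hg => ?_
  rw [ENNReal.div_le_iff h0 ht, mul_comm]
  exact h g hg

theorem wdiff_sub_add (k r : ℕ) (F G : ℝ → ℝ) (h : ℝ) :
    wdiff k r F h = wdiff k r (fun x => F x - G x) h + wdiff k r G h := by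
  funext x
  rw [Pi.add_apply]
  unfold wdiff symmDelta symmDiffOn
  rw [← mul_add]
  congr 1
  split_ifs
  · rw [← Finset.sum_add_distrib]
    exact Finset.sum_congr rfl fun i _ => by ring
  · simp

/-- The modulus is bounded by the `K`-functional: for every competitor `g` the difference of
`F - g^{(r)}` is bounded by its norm and that of `g^{(r)}` by Taylor's formula. -/
theorem exists_modulus_le_KFunctional (m r : ℕ) {p : ℝ≥0∞} (hp : 1 ≤ p) :
    ∃ C : ℝ≥0, 0 < C ∧ ∀ F : ℝ → ℝ,
      AEStronglyMeasurable F (volume.restrict (Icc (-1 : ℝ) 1)) → ∀ t : ℝ, 0 < t →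
      modulus (m + 1) r p F t ≤ C * KFunctional (m + 1) r p F (t ^ (m + 1)) := by
  set A : ℝ≥0 := 2 ^ (m + 1 + 1) with hA
  set B : ℝ≥0 := Real.toNNReal (4 * (2 * (m + 1)) ^ (m + 1)) with hB
  refine ⟨A + B, by positivity, fun F hF t ht => ?_⟩
  refine le_mul_iInf_mem (by simp [hA]) ENNReal.coe_ne_top fun g hg => ?_
  obtain ⟨hG, hAC, hder⟩ := BSpace_succ hg
  set G := iteratedDeriv r g with hGdef
  have hGm : AEStronglyMeasurable G (volume.restrict (Icc (-1 : ℝ) 1)) :=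
    aestronglyMeasurable_of_continuousOn hG.continuousOn
  refine iSup₂_le fun h hh => ?_
  change eLpNorm (wdiff (m + 1) r F h) p (volume.restrict (Icc (-1 : ℝ) 1)) ≤ _
  rw [wdiff_sub_add _ _ F G]
  refine (eLpNorm_add_le ((aestronglyMeasurable_wdiff hh.1 (hF.sub hGm)).restrict)
    ((aestronglyMeasurable_wdiff hh.1 hGm).restrict) hp).trans ?_
  have h1 := eLpNorm_wdiff_le (k := m + 1) (r := r) hh.1 hp (hF.sub hGm)
  have h2 := eLpNorm_wdiff_smooth_le (r := r) hh.1 hG hAC hp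
  rw [hder] at h2
  have hAe : ((A : ℝ≥0) : ℝ≥0∞) = 2 ^ (m + 1 + 1) := by rw [hA]; push_cast; rfl
  have hth : ENNReal.ofReal (h ^ (m + 1)) ≤ ENNReal.ofReal (t ^ (m + 1)) :=
    ENNReal.ofReal_le_ofReal (pow_le_pow_left₀ hh.1 hh.2 _)
  rw [mul_add]
  refine add_le_add (h1.trans ?_) (h2.trans ?_)
  · refine mul_le_mul' ?_ le_rfl
    rw [← hAe, ENNReal.coe_add]
    exact le_self_add
  · rw [mul_assoc]
    refine mul_le_mul' ?_ (mul_le_mul' hth le_rfl)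
    rw [ENNReal.coe_add]
    exact le_add_self

theorem fd_sub_add (k : ℕ) (u : ℝ) (F G : ℝ → ℝ) (y : ℝ) :
    fd k u F y = fd k u (fun x => F x - G x) y + fd k u G y := by
  simp only [fd, ← Finset.sum_add_distrib]
  exact Finset.sum_congr rfl fun i _ => by ring

/-- The one-sided differences in the left end point term of the weighted Ditzian–Totik modulus are
bounded by the two terms of the `K`-functional. -/
theorem eLpNorm_forwardDelta_le {m r : ℕ} {t h : ℝ} (ht : 0 < t)
    (ht0 : (12 + (m + 1)) * (2 * ((m + 1 : ℕ) : ℝ) ^ 2 * t ^ 2) ≤ 1)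
    (hh : h ∈ Ioc 0 (2 * ((m + 1 : ℕ) : ℝ) ^ 2 * t ^ 2)) {F G D : ℝ → ℝ}
    (hF : AEStronglyMeasurable F (volume.restrict (Icc (-1 : ℝ) 1)))
    (hG : AEStronglyMeasurable G (volume.restrict (Icc (-1 : ℝ) 1)))
    (hT : HasTaylorBound m G D) (hD : Measurable D) {p : ℝ≥0∞} (hp : 1 ≤ p) :
    eLpNorm (fun x => phi x ^ r * forwardDelta (m + 1) h F x) p
        (volume.restrict (Icc (-1) (-1 + 12 * (2 * ((m + 1 : ℕ) : ℝ) ^ 2 * t ^ 2)))) ≤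
      2 ^ (m + 1) * normP p (fun x => (F x - G x) * phi x ^ r) +
      ENNReal.ofReal (2 * (4 * (m + 1) ^ 2) ^ (m + 1)) * (ENNReal.ofReal (t ^ (m + 1)) *
        normP p (fun x => D x * phi x ^ (m + 1 + r))) := by
  set k := m + 1 with hk
  set ts : ℝ := 2 * (k : ℝ) ^ 2 * t ^ 2 with hts
  have hk1 : (1 : ℝ) ≤ k := by rw [hk]; push_cast; linarith [Nat.cast_nonneg (α := ℝ) m]
  have hts0 : 0 ≤ ts := by positivity
  have hkm : (k : ℝ) = m + 1 := by rw [hk]; push_cast; ring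
  have hkh : k * h ≤ k * ts := by gcongr; exact hh.2
  have hb : (-1 + 12 * ts) + k * h ≤ 0 := by rw [← hkm] at ht0; linarith
  have hcongr : eLpNorm (fun x => phi x ^ r * forwardDelta k h F x) p
      (volume.restrict (Icc (-1) (-1 + 12 * ts))) =
      eLpNorm ((fun x => phi x ^ r * fd k h (fun y => F y - G y) x) +
        fun x => phi x ^ r * fd k h G x) p (volume.restrict (Icc (-1) (-1 + 12 * ts))) := by
    refine eLpNorm_congr_ae ?_
    rw [Filter.EventuallyEq, ae_restrict_iff' measurableSet_Icc]
    refine Filter.Eventually.of_forall fun x hx => ?_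
    rw [Pi.add_apply, forwardDelta_eq_fd hh.1.le hx.1 (by linarith [hx.2]), fd_sub_add k h F G,
      mul_add]
  rw [hcongr]
  have hphi : Measurable fun x => phi x ^ r := by fun_prop
  refine (eLpNorm_add_le (hphi.aestronglyMeasurable.mul
    (aestronglyMeasurable_fd hh.1.le hb (hF.sub hG)))
    (hphi.aestronglyMeasurable.mul (aestronglyMeasurable_fd hh.1.le hb hG)) hp).trans ?_
  refine add_le_add (eLpNorm_phi_mul_fd_le hh.1.le hb hp (hF.sub hG)) ?_
  refine (eLpNorm_phi_mul_fd_smooth_le hh.1 hb hT hD hp).trans ?_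
  rw [← mul_assoc]
  refine mul_le_mul' ?_ le_rfl
  have h2 : (2 : ℝ≥0∞) ^ (m + 1) = ENNReal.ofReal (2 ^ (m + 1)) := by
    rw [ENNReal.ofReal_pow (by norm_num)]; simp
  rw [h2, ← ENNReal.ofReal_mul (by positivity), ← ENNReal.ofReal_mul (by positivity),
    ← ENNReal.ofReal_mul (by positivity)]
  refine ENNReal.ofReal_le_ofReal ?_
  have hsq : Real.sqrt (((m + 1 : ℕ) : ℝ) * h) ≤ 2 * k ^ 2 * t := by
    refine Real.sqrt_le_iff.2 ⟨by positivity, ?_⟩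
    refine hkh.trans ?_
    rw [hts]
    have h1 : (k : ℝ) ^ 3 ≤ k ^ 4 := pow_le_pow_right₀ hk1 (by norm_num)
    have h2 : 0 ≤ t ^ 2 := sq_nonneg t
    have h3 : 0 ≤ (k : ℝ) ^ 3 := by positivity
    nlinarith [mul_le_mul_of_nonneg_right h1 h2, mul_nonneg h3 h2]
  calc 2 ^ (m + 1) * Real.sqrt (((m + 1 : ℕ) : ℝ) * h) ^ m *
        (2 * Real.sqrt (((m + 1 : ℕ) : ℝ) * h))
      ≤ 2 ^ (m + 1) * (2 * k ^ 2 * t) ^ m * (2 * (2 * k ^ 2 * t)) := by gcongr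
    _ = 2 * (2 ^ (m + 1) * (2 * k ^ 2 * t) ^ (m + 1)) := by ring
    _ = 2 * (4 * (m + 1) ^ 2) ^ (m + 1) * t ^ (m + 1) := by
        rw [← mul_pow, hkm, show 2 * (2 * ((m : ℝ) + 1) ^ 2 * t) = (4 * (m + 1) ^ 2) * t by ring,
          mul_pow]
        ring

/-- Away from the end points the weights `φ` and `W_δ` are comparable. -/
theorem phi_le_two_mul_wt {δ x s : ℝ} (hδ : 2 * δ ^ 2 ≤ s) (hx : |x| ≤ 1 - s) :
    phi x ≤ 2 * wt δ x := by
  have hs : 0 ≤ s := le_trans (by positivity) hδ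
  have hx1 : |x| ≤ 1 := by linarith
  have hphi := phi_sq hx1
  rw [← sq_abs x] at hphi
  have h0 := abs_nonneg x
  have h1 : δ * phi x ≤ 1 - |x| := by
    refine (le_abs_self _).trans (abs_le_of_sq_le_sq ?_ (by linarith))
    rw [mul_pow, hphi]
    have : 1 - |x| ^ 2 ≤ 2 * (1 - |x|) := by nlinarith
    calc δ ^ 2 * (1 - |x| ^ 2) ≤ δ ^ 2 * (2 * (1 - |x|)) := by gcongr
      _ = (2 * δ ^ 2) * (1 - |x|) := by ring
      _ ≤ (1 - |x|) * (1 - |x|) := by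
          apply mul_le_mul_of_nonneg_right <;> linarith
      _ = _ := by ring
  have h2 := le_abs_self x
  have h3 := neg_abs_le x
  unfold wt
  rw [show (2 : ℝ) = Real.sqrt 4 by
    rw [show (4 : ℝ) = 2 ^ 2 by norm_num, Real.sqrt_sq (by norm_num)],
    ← Real.sqrt_mul (by norm_num), phi]
  refine Real.sqrt_le_sqrt ?_
  have : ((1 - x) / 2) * ((1 + x) / 2) ≤
      (1 - x - δ * phi x / 2) * (1 + x - δ * phi x / 2) := by
    apply mul_le_mul <;> linarith
  rw [phi] at this
  linarith

/-- On `[-1 + t*, 1 - t*]` the weight `φ` may be replaced by `W_{kh}`, so that the interior term of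
the weighted Ditzian–Totik modulus is part of the modulus. -/
theorem eLpNorm_phi_mul_symmDelta_le {k r : ℕ} {t h : ℝ} (hh : h ∈ Ioc 0 t) (F : ℝ → ℝ)
    (p : ℝ≥0∞) :
    eLpNorm (fun x => phi x ^ r * symmDelta k (h * phi x) F x) p
      (volume.restrict (Icc (-1 + 2 * (k : ℝ) ^ 2 * t ^ 2) (1 - 2 * (k : ℝ) ^ 2 * t ^ 2))) ≤
      2 ^ r * modulus k r p F t := by
  set s : ℝ := 2 * (k : ℝ) ^ 2 * t ^ 2 with hs
  have hs0 : 0 ≤ s := by positivity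
  have h1 : eLpNorm (fun x => phi x ^ r * symmDelta k (h * phi x) F x) p
      (volume.restrict (Icc (-1 + s) (1 - s))) ≤
      2 ^ r * eLpNorm (wdiff k r F h) p (volume.restrict (Icc (-1 + s) (1 - s))) := by
    refine eLpNorm_le_const_mul (by simp) ?_
    rw [ae_restrict_iff' measurableSet_Icc]
    refine Filter.Eventually.of_forall fun x hx => ?_
    have hw : phi x ≤ 2 * wt (k * h) x := by
      refine phi_le_two_mul_wt (s := s) ?_
        (abs_le.2 ⟨by linarith [hx.1], hx.2⟩)
      have := pow_le_pow_left₀ hh.1.le hh.2 2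
      rw [hs, mul_pow]
      nlinarith [sq_nonneg (k : ℝ)]
    unfold wdiff
    rw [enorm_mul, enorm_mul, ← mul_assoc, enorm_pow, enorm_pow, ← mul_pow,
      Real.enorm_of_nonneg (phi_nonneg x), Real.enorm_of_nonneg (wt_nonneg _ x)]
    gcongr
    rw [show (2 : ℝ≥0∞) = ENNReal.ofReal 2 by simp, ← ENNReal.ofReal_mul (by norm_num)]
    exact ENNReal.ofReal_le_ofReal hw
  refine h1.trans (mul_le_mul' le_rfl ?_)
  calc eLpNorm (wdiff k r F h) p (volume.restrict (Icc (-1 + s) (1 - s)))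
      ≤ eLpNorm (wdiff k r F h) p (volume.restrict (Icc (-1) 1)) :=
        eLpNorm_mono_measure _ (Measure.restrict_mono
          (Icc_subset_Icc (by linarith) (by linarith)) le_rfl)
    _ ≤ modulus k r p F t :=
        le_iSup₂ (f := fun h (_ : h ∈ Icc (0 : ℝ) t) =>
          normP p (fun x => wt (k * h) x ^ r * symmDelta k (h * phi x) F x)) h ⟨hh.1.le, hh.2⟩

/-- The weighted Ditzian–Totik modulus is bounded by the `K`-functional. -/
theorem exists_weightedDTModulus_le_KFunctional (m r : ℕ) {p : ℝ≥0∞} (hp : 1 ≤ p) :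
    ∃ C : ℝ≥0, 0 < C ∧ ∀ F : ℝ → ℝ,
      AEStronglyMeasurable F (volume.restrict (Icc (-1 : ℝ) 1)) → ∀ t : ℝ, 0 < t →
      (12 + (m + 1)) * (2 * ((m + 1 : ℕ) : ℝ) ^ 2 * t ^ 2) ≤ 1 →
      weightedDTModulus (m + 1) (fun x => phi x ^ r) p F t ≤
        C * KFunctional (m + 1) r p F (t ^ (m + 1)) := by
  obtain ⟨C₁, hC₁, h₁⟩ := exists_modulus_le_KFunctional m r hp
  set A : ℝ≥0 := 2 ^ (m + 1) with hA
  set B : ℝ≥0 := Real.toNNReal (2 * (4 * (m + 1) ^ 2) ^ (m + 1)) with hB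
  have hA0 : 0 < A := by positivity
  -- Stated for arbitrary `G` and `D`, so that it applies at the right end point after a reflection.
  have hend : ∀ F : ℝ → ℝ, AEStronglyMeasurable F (volume.restrict (Icc (-1 : ℝ) 1)) →
      ∀ t : ℝ, 0 < t → (12 + (m + 1)) * (2 * ((m + 1 : ℕ) : ℝ) ^ 2 * t ^ 2) ≤ 1 →
      ∀ h ∈ Ioc 0 (2 * ((m + 1 : ℕ) : ℝ) ^ 2 * t ^ 2), ∀ G D : ℝ → ℝ,
      AEStronglyMeasurable G (volume.restrict (Icc (-1 : ℝ) 1)) →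
      HasTaylorBound m G D → Measurable D →
      eLpNorm (fun x => phi x ^ r * forwardDelta (m + 1) h F x) p
        (volume.restrict (Icc (-1) (-1 + 12 * (2 * ((m + 1 : ℕ) : ℝ) ^ 2 * t ^ 2)))) ≤
      (A + B : ℝ≥0) * (normP p (fun x => (F x - G x) * phi x ^ r) +
        ENNReal.ofReal (t ^ (m + 1)) * normP p (fun x => D x * phi x ^ (m + 1 + r))) := by
    intro F hF t ht ht0 h hh G D hG hT hD
    refine (eLpNorm_forwardDelta_le ht ht0 hh hF hG hT hD hp).trans ?_
    rw [mul_add]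
    refine add_le_add (mul_le_mul' ?_ le_rfl) (mul_le_mul' ?_ le_rfl)
    · have hAe : ((A : ℝ≥0) : ℝ≥0∞) = 2 ^ (m + 1) := by rw [hA]; push_cast; rfl
      rw [← hAe, ENNReal.coe_add]
      exact le_self_add
    · rw [ENNReal.coe_add]
      exact le_add_self
  refine ⟨2 ^ r * C₁ + (A + B) + (A + B), by positivity, fun F hF t ht ht0 => ?_⟩
  have hne : ((A + B : ℝ≥0) : ℝ≥0∞) ≠ 0 := by
    rw [ENNReal.coe_ne_zero]; exact (lt_of_lt_of_le hA0 le_self_add).ne'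
  unfold weightedDTModulus
  simp only
  rw [ENNReal.coe_add, ENNReal.coe_add, add_mul, add_mul]
  refine add_le_add (add_le_add ?_ ?_) ?_
  · refine iSup₂_le fun h hh => (eLpNorm_phi_mul_symmDelta_le hh F p).trans ?_
    have : ((2 ^ r * C₁ : ℝ≥0) : ℝ≥0∞) = 2 ^ r * C₁ := by push_cast; rfl
    rw [this, mul_assoc]
    exact mul_le_mul' le_rfl (h₁ F hF t ht)
  · refine le_mul_iInf_mem hne ENNReal.coe_ne_top fun g hg => ?_
    obtain ⟨hG, hAC, hder⟩ := BSpace_succ hg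
    refine iSup₂_le fun h hh => ?_
    rw [← hder]
    exact hend F hF t ht ht0 h hh _ _ (aestronglyMeasurable_of_continuousOn hG.continuousOn)
      (hasTaylorBound_iteratedDeriv hG hAC) (by rw [iteratedDeriv_succ]; exact measurable_deriv _)
  · refine le_mul_iInf_mem hne ENNReal.coe_ne_top fun g hg => ?_
    obtain ⟨hG, hAC, hder⟩ := BSpace_succ hg
    refine iSup₂_le fun h hh => ?_
    rw [← hder, eLpNorm_backwardDelta]
    have hneg : Measure.QuasiMeasurePreserving (fun x : ℝ => -x)
        (volume.restrict (Icc (-1 : ℝ) 1)) (volume.restrict (Icc (-1 : ℝ) 1)) := by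
      have := ((Measure.measurePreserving_neg (volume : Measure ℝ)).restrict_preimage
        (measurableSet_Icc (a := (-1 : ℝ)) (b := 1))).quasiMeasurePreserving
      have e : (Neg.neg ⁻¹' Icc (-1 : ℝ) 1) = Icc (-1 : ℝ) 1 := neg_Icc_one
      rwa [e] at this
    have hGm := aestronglyMeasurable_of_continuousOn hG.continuousOn
    have hDm : Measurable (iteratedDeriv (m + 1) (iteratedDeriv r g)) := by
      rw [iteratedDeriv_succ]; exact measurable_deriv _
    have := hend (fun x => F (-x)) (hF.comp_quasiMeasurePreserving hneg) t ht ht0 h hh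
      (fun x => iteratedDeriv r g (-x)) (fun x => iteratedDeriv (m + 1) (iteratedDeriv r g) (-x))
      (hGm.comp_quasiMeasurePreserving hneg)
      (hasTaylorBound_iteratedDeriv hG hAC).comp_neg (hDm.comp measurable_neg)
    refine this.trans_eq ?_
    rw [← normP_comp_neg p (fun x => (F x - iteratedDeriv r g x) * phi x ^ r),
      ← normP_comp_neg p (fun x => iteratedDeriv (m + 1) (iteratedDeriv r g) x *
        phi x ^ (m + 1 + r))]
    simp only [phi_neg]

/-! ### Steklov means -/

/-- The Steklov mean of `f` over `[x, x + h]`. -/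
noncomputable def steklov (h : ℝ) (f : ℝ → ℝ) (x : ℝ) : ℝ := h⁻¹ * ∫ v in x..(x + h), f v

/-- The primitive of `f` vanishing at `x₀`. -/
noncomputable def primitiveFrom (x₀ : ℝ) (f : ℝ → ℝ) (x : ℝ) : ℝ := ∫ v in x₀..x, f v

/-- `f` is integrable on every bounded interval. -/
def IntervalInt (f : ℝ → ℝ) : Prop := ∀ a b : ℝ, IntervalIntegrable f volume a b

theorem _root_.Continuous.intervalInt {f : ℝ → ℝ} (hf : Continuous f) : IntervalInt f :=
  fun a b => hf.intervalIntegrable a b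

theorem IntervalInt.add {f g : ℝ → ℝ} (hf : IntervalInt f) (hg : IntervalInt g) :
    IntervalInt fun x => f x + g x := fun a b => (hf a b).add (hg a b)

theorem IntervalInt.sub {f g : ℝ → ℝ} (hf : IntervalInt f) (hg : IntervalInt g) :
    IntervalInt fun x => f x - g x := fun a b => (hf a b).sub (hg a b)

theorem IntervalInt.const_mul {f : ℝ → ℝ} (hf : IntervalInt f) (c : ℝ) :
    IntervalInt fun x => c * f x := fun a b => (hf a b).const_mul c

theorem IntervalInt.comp_add {f : ℝ → ℝ} (hf : IntervalInt f) (h : ℝ) :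
    IntervalInt fun x => f (x + h) := fun a b => by
  simpa using (hf (a + h) (b + h)).comp_add_right h

theorem IntervalInt.fwdDiff {f : ℝ → ℝ} (hf : IntervalInt f) (h : ℝ) :
    IntervalInt (fwdDiff h f) := (hf.comp_add h).sub hf

theorem IntervalInt.comp_add_mul {f : ℝ → ℝ} (hf : IntervalInt f) (y c : ℝ) :
    IntervalInt fun u => f (y + c * u) := fun a b => by
  rcases eq_or_ne c 0 with rfl | hc
  · simp
  have h1 := (hf (y + c * a) (y + c * b)).comp_add_left y
  have h2 := h1.comp_mul_left (c := c)
  simpa [hc] using h2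

theorem IntervalInt.continuous_primitiveFrom {f : ℝ → ℝ} (hf : IntervalInt f) (x₀ : ℝ) :
    Continuous (primitiveFrom x₀ f) := intervalIntegral.continuous_primitive hf x₀

theorem IntervalInt.continuous_steklov {f : ℝ → ℝ} (hf : IntervalInt f) (h : ℝ) :
    Continuous (steklov h f) := by
  have : steklov h f = fun x => h⁻¹ * (primitiveFrom 0 f (x + h) - primitiveFrom 0 f x) := by
    funext x
    rw [steklov, primitiveFrom, primitiveFrom,
      intervalIntegral.integral_interval_sub_left (hf _ _) (hf _ _)]
  rw [this]
  have := hf.continuous_primitiveFrom 0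
  fun_prop

theorem IntervalInt.steklov_iterate {f : ℝ → ℝ} (hf : IntervalInt f) (h : ℝ) (n : ℕ) :
    IntervalInt ((steklov h)^[n] f) := by
  induction n with
  | zero => exact hf
  | succ n ih =>
    rw [Function.iterate_succ_apply']
    exact (ih.continuous_steklov h).intervalInt

theorem IntervalInt.primitiveFrom_iterate {f : ℝ → ℝ} (hf : IntervalInt f) (x₀ : ℝ) (n : ℕ) :
    IntervalInt ((primitiveFrom x₀)^[n] f) := by
  induction n with
  | zero => exact hf
  | succ n ih =>
    rw [Function.iterate_succ_apply']
    exact (ih.continuous_primitiveFrom x₀).intervalInt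

theorem IntervalInt.fwdDiff_iterate {f : ℝ → ℝ} (hf : IntervalInt f) (h : ℝ) (n : ℕ) :
    IntervalInt ((_root_.fwdDiff h)^[n] f) := by
  induction n with
  | zero => exact hf
  | succ n ih =>
    rw [Function.iterate_succ_apply']
    exact ih.fwdDiff h

theorem steklov_add {f g : ℝ → ℝ} (hf : IntervalInt f) (hg : IntervalInt g) (h : ℝ) :
    steklov h (fun x => f x + g x) = fun x => steklov h f x + steklov h g x := by
  funext x
  rw [steklov, steklov, steklov, intervalIntegral.integral_add (hf _ _) (hg _ _), mul_add]

theorem steklov_const_mul (f : ℝ → ℝ) (h c : ℝ) :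
    steklov h (fun x => c * f x) = fun x => c * steklov h f x := by
  funext x
  rw [steklov, steklov, intervalIntegral.integral_const_mul]; ring

theorem steklov_const {h : ℝ} (hh : h ≠ 0) (c : ℝ) : steklov h (fun _ => c) = fun _ => c := by
  funext x
  rw [steklov, intervalIntegral.integral_const]
  simp [hh]

theorem steklov_iterate_const {h : ℝ} (hh : h ≠ 0) (c : ℝ) (n : ℕ) :
    (steklov h)^[n] (fun _ => c) = fun _ => c := by
  induction n with
  | zero => rfl
  | succ n ih => rw [Function.iterate_succ_apply', ih, steklov_const hh]

theorem steklov_iterate_add {f g : ℝ → ℝ} (hf : IntervalInt f) (hg : IntervalInt g) (h : ℝ)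
    (n : ℕ) : (steklov h)^[n] (fun x => f x + g x) =
      fun x => (steklov h)^[n] f x + (steklov h)^[n] g x := by
  induction n with
  | zero => rfl
  | succ n ih =>
    simp only [Function.iterate_succ_apply']
    rw [ih, steklov_add (hf.steklov_iterate h n) (hg.steklov_iterate h n)]

theorem steklov_iterate_const_mul (f : ℝ → ℝ) (h c : ℝ) (n : ℕ) :
    (steklov h)^[n] (fun x => c * f x) = fun x => c * (steklov h)^[n] f x := by
  induction n with
  | zero => rfl
  | succ n ih =>
    simp only [Function.iterate_succ_apply']
    rw [ih, steklov_const_mul]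

theorem IntervalInt.sum {ι : Type*} (s : Finset ι) {f : ι → ℝ → ℝ}
    (hf : ∀ i ∈ s, IntervalInt (f i)) : IntervalInt fun x => ∑ i ∈ s, f i x := by
  classical
  induction s using Finset.induction_on with
  | empty => simpa using (continuous_const (y := (0 : ℝ))).intervalInt
  | insert i s hi ih =>
    simp only [Finset.sum_insert hi]
    exact (hf i (Finset.mem_insert_self _ _)).add
      (ih fun j hj => hf j (Finset.mem_insert_of_mem hj))

theorem steklov_iterate_sum {ι : Type*} (s : Finset ι) {f : ι → ℝ → ℝ}
    (hf : ∀ i ∈ s, IntervalInt (f i)) {h : ℝ} (hh : h ≠ 0) (n : ℕ) (x : ℝ) :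
    (steklov h)^[n] (fun x => ∑ i ∈ s, f i x) x = ∑ i ∈ s, (steklov h)^[n] (f i) x := by
  classical
  induction s using Finset.induction_on with
  | empty => simp only [Finset.sum_empty, steklov_iterate_const hh]
  | insert i s hi ih =>
    simp only [Finset.sum_insert hi]
    have hs : ∀ j ∈ s, IntervalInt (f j) := fun j hj => hf j (Finset.mem_insert_of_mem hj)
    rw [steklov_iterate_add (hf i (Finset.mem_insert_self _ _)) (IntervalInt.sum s hs), ← ih hs]

/-- Steklov means of a dilated function. -/
theorem steklov_iterate_comp_add_mul (f : ℝ → ℝ) {c : ℝ} (hc : c ≠ 0) (h y : ℝ) (n : ℕ) :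
    (steklov h)^[n] (fun u => f (y + c * u)) = fun u => (steklov (c * h))^[n] f (y + c * u) := by
  induction n with
  | zero => rfl
  | succ n ih =>
    simp only [Function.iterate_succ_apply']
    rw [ih]
    funext u
    rw [steklov, steklov, intervalIntegral.integral_comp_add_mul _ hc]
    rw [mul_inv, smul_eq_mul, mul_add, add_assoc]
    ring

/-- The derivative of a Steklov mean is the normalized first difference. -/
theorem steklov_eq_add_primitive {f : ℝ → ℝ} (hf : IntervalInt f) (h x₀ x : ℝ) :
    steklov h f x = steklov h f x₀ + h⁻¹ * primitiveFrom x₀ (fwdDiff h f) x := by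
  unfold steklov primitiveFrom
  rw [← mul_add]
  congr 1
  have h1 : ∫ v in x₀..x, fwdDiff h f v = (∫ v in (x₀ + h)..(x + h), f v) - ∫ v in x₀..x, f v := by
    unfold fwdDiff
    rw [intervalIntegral.integral_sub ((hf.comp_add h) _ _) (hf _ _),
      intervalIntegral.integral_comp_add_right f]
  rw [h1]
  have h2 := intervalIntegral.integral_add_adjacent_intervals (hf x₀ (x₀ + h))
    (hf (x₀ + h) (x + h))
  have h3 := intervalIntegral.integral_add_adjacent_intervals (hf x₀ x) (hf x (x + h))
  linarith

theorem fwdDiff_steklov {f : ℝ → ℝ} (hf : IntervalInt f) (h : ℝ) :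
    fwdDiff h (steklov h f) = steklov h (fwdDiff h f) := by
  funext x
  unfold fwdDiff steklov
  rw [intervalIntegral.integral_sub ((hf.comp_add h) _ _) (hf _ _),
    intervalIntegral.integral_comp_add_right f]
  ring

theorem fwdDiff_steklov_iterate {f : ℝ → ℝ} (hf : IntervalInt f) (h : ℝ) (n : ℕ) :
    fwdDiff h ((steklov h)^[n] f) = (steklov h)^[n] (fwdDiff h f) := by
  induction n with
  | zero => rfl
  | succ n ih =>
    simp only [Function.iterate_succ_apply']
    rw [fwdDiff_steklov (hf.steklov_iterate h n), ih]

/-- An `n`-fold Steklov mean is a polynomial of degree `< n` plus the `n`-fold primitive of the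
normalized `n`-th difference. -/
theorem exists_steklov_iterate_eq (x₀ h : ℝ) (n : ℕ) : ∀ f : ℝ → ℝ, IntervalInt f →
    ∃ Q ∈ Polynomial.degreeLT ℝ n, ∀ x, (steklov h)^[n] f x =
      Q.eval x + (h⁻¹) ^ n * (primitiveFrom x₀)^[n] ((fwdDiff h)^[n] f) x := by
  induction n with
  | zero => intro f _; exact ⟨0, Submodule.zero_mem _, fun x => by simp⟩
  | succ n ih =>
    intro f hf
    obtain ⟨Q, hQ, hQf⟩ := ih (fwdDiff h f) (hf.fwdDiff h)
    obtain ⟨R, hR, hder, hval⟩ := exists_antiderivative hQ x₀ 0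
    set w := (steklov h)^[n] f with hw
    refine ⟨Polynomial.C (steklov h w x₀) + Polynomial.C h⁻¹ * R, ?_, fun x => ?_⟩
    · refine Submodule.add_mem _ ?_ ?_
      · rw [Polynomial.mem_degreeLT]
        exact Polynomial.degree_C_le.trans_lt (by exact_mod_cast Nat.succ_pos n)
      · rw [← Polynomial.smul_eq_C_mul]
        exact Submodule.smul_mem _ _ hR
    · rw [Function.iterate_succ_apply', ← hw,
        steklov_eq_add_primitive (hf.steklov_iterate h n) h x₀,
        hw, fwdDiff_steklov_iterate hf, ← hw]
      have hg : IntervalInt ((primitiveFrom x₀)^[n] ((fwdDiff h)^[n] (fwdDiff h f))) :=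
        ((hf.fwdDiff h).fwdDiff_iterate h n).primitiveFrom_iterate x₀ n
      have h1 : primitiveFrom x₀ ((steklov h)^[n] (fwdDiff h f)) x = R.eval x +
          (h⁻¹) ^ n *
            primitiveFrom x₀ ((primitiveFrom x₀)^[n] ((fwdDiff h)^[n] (fwdDiff h f))) x := by
        set g := (primitiveFrom x₀)^[n] ((fwdDiff h)^[n] (fwdDiff h f)) with hgdef
        change ∫ v in x₀..x, (steklov h)^[n] (fwdDiff h f) v = R.eval x + (h⁻¹) ^ n *
          ∫ v in x₀..x, g v
        simp only [hQf]
        rw [intervalIntegral.integral_add (Q.continuous.intervalInt _ _)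
          ((hg.const_mul _) _ _), intervalIntegral.integral_const_mul]
        congr 1
        have hd : ∀ z ∈ uIcc x₀ x, HasDerivAt (fun z => R.eval z) (Q.eval z) z := fun z _ => by
          have := R.hasDerivAt z
          rwa [hder] at this
        rw [intervalIntegral.integral_eq_sub_of_hasDerivAt hd (Q.continuous.intervalInt _ _), hval,
          sub_zero]
      rw [h1, ← Function.iterate_succ_apply' (primitiveFrom x₀), ← Function.iterate_succ_apply
        (fwdDiff h)]
      simp
      ring

theorem enorm_primitiveFrom_iterate_le {x₀ b : ℝ} (g : ℝ → ℝ) (n : ℕ) :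
    ∀ x ∈ Icc x₀ b, ‖(primitiveFrom x₀)^[n + 1] g x‖ₑ ≤
      ENNReal.ofReal ((b - x₀) ^ n) * ∫⁻ z in Icc x₀ b, ‖g z‖ₑ := by
  induction n with
  | zero =>
    intro x hx
    simp only [zero_add, Function.iterate_one, pow_zero, ENNReal.ofReal_one, one_mul]
    refine (enorm_intervalIntegral_le _ _ _).trans (lintegral_mono_set ?_)
    rw [uIoc_of_le hx.1]
    exact Ioc_subset_Icc_self.trans (Icc_subset_Icc le_rfl hx.2)
  | succ n ih =>
    intro x hx
    rw [Function.iterate_succ_apply']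
    refine (enorm_intervalIntegral_le _ _ _).trans ?_
    rw [uIoc_of_le hx.1]
    have hb : 0 ≤ b - x₀ := by linarith [hx.1, hx.2]
    calc _ ≤ ∫⁻ _w in Ioc x₀ x, ENNReal.ofReal ((b - x₀) ^ n) * ∫⁻ z in Icc x₀ b, ‖g z‖ₑ :=
          setLIntegral_mono' measurableSet_Ioc fun w hw => ih w ⟨hw.1.le, hw.2.trans hx.2⟩
      _ = ENNReal.ofReal ((b - x₀) ^ n) * (∫⁻ z in Icc x₀ b, ‖g z‖ₑ) * ENNReal.ofReal (x - x₀) := by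
          rw [setLIntegral_const, Real.volume_Ioc]
      _ ≤ ENNReal.ofReal ((b - x₀) ^ n) * (∫⁻ z in Icc x₀ b, ‖g z‖ₑ) * ENNReal.ofReal (b - x₀) := by
          gcongr; exact hx.2
      _ = _ := by
          rw [mul_right_comm, ← ENNReal.ofReal_mul (by positivity), pow_succ]

theorem enorm_steklov_le {h : ℝ} (hh : 0 < h) (g : ℝ → ℝ) (x : ℝ) :
    ‖steklov h g x‖ₑ ≤ ENNReal.ofReal (1 / h) * ∫⁻ v in Icc x (x + h), ‖g v‖ₑ := by
  rw [steklov, enorm_mul, Real.enorm_of_nonneg (by positivity), one_div]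
  refine mul_le_mul' le_rfl ((enorm_intervalIntegral_le _ _ _).trans (lintegral_mono_set ?_))
  rw [uIoc_of_le (by linarith)]
  exact Ioc_subset_Icc_self

theorem enorm_steklov_iterate_le {h : ℝ} (hh : 0 < h) (g : ℝ → ℝ) (n : ℕ) : ∀ x,
    ‖(steklov h)^[n + 1] g x‖ₑ ≤
      ENNReal.ofReal (1 / h) * ∫⁻ v in Icc x (x + (n + 1) * h), ‖g v‖ₑ := by
  induction n with
  | zero => intro x; simpa using enorm_steklov_le hh g x
  | succ n ih =>
    intro x
    rw [Function.iterate_succ_apply']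
    refine (enorm_steklov_le hh _ x).trans ?_
    have hn : (0 : ℝ) ≤ n := Nat.cast_nonneg n
    calc _ ≤ ENNReal.ofReal (1 / h) * ∫⁻ _v in Icc x (x + h), (ENNReal.ofReal (1 / h) *
          ∫⁻ v in Icc x (x + ((n + 1 : ℕ) + 1) * h), ‖g v‖ₑ) := by
          refine mul_le_mul' le_rfl (setLIntegral_mono' measurableSet_Icc fun v hv => ?_)
          refine (ih v).trans (mul_le_mul' le_rfl (lintegral_mono_set ?_))
          refine Icc_subset_Icc hv.1 ?_
          push_cast
          linarith [hv.2]
      _ = (ENNReal.ofReal (1 / h) * ENNReal.ofReal h) * (ENNReal.ofReal (1 / h) *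
          ∫⁻ v in Icc x (x + ((n + 1 : ℕ) + 1) * h), ‖g v‖ₑ) := by
          rw [setLIntegral_const, Real.volume_Icc]
          ring_nf
      _ = _ := by
          rw [← ENNReal.ofReal_mul (by positivity), one_div_mul_cancel hh.ne', ENNReal.ofReal_one,
            one_mul]

/-! ### Local polynomial approximation of Whitney type -/

theorem measurable_fd_uncurry {F : ℝ → ℝ} (hF : Measurable F) (k : ℕ) :
    Measurable fun q : ℝ × ℝ => fd k q.2 F q.1 := by
  unfold fd
  refine Finset.measurable_sum _ fun i _ => ?_
  exact (hF.comp (by fun_prop)).const_mul _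

theorem fwdDiff_iterate_eq_fd (k : ℕ) (u : ℝ) (F : ℝ → ℝ) (y : ℝ) :
    (fwdDiff u)^[k] F y = fd k u F y := by
  rw [fwdDiff_iter_eq_sum_shift, fd]
  refine Finset.sum_congr rfl fun i _ => ?_
  simp only [nsmul_eq_mul, zsmul_eq_mul]
  push_cast
  ring

/-- A change of variable in a lower integral over a dilated interval. -/
theorem setLIntegral_comp_mul_left {g : ℝ → ℝ≥0∞} (hg : Measurable g) {c : ℝ} (hc : 0 < c)
    (a b : ℝ) : ∫⁻ x in Icc a b, g (c * x) =
      ENNReal.ofReal c⁻¹ * ∫⁻ u in Icc (c * a) (c * b), g u := by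
  have h := Real.map_volume_mul_left hc.ne'
  rw [abs_of_pos (by positivity)] at h
  rw [← smul_eq_mul, ← lintegral_smul_measure, ← Measure.restrict_smul, ← h,
    setLIntegral_map measurableSet_Icc hg (measurable_const_mul c)]
  congr 2
  ext x
  simp only [mem_preimage, mem_Icc, mul_le_mul_iff_right₀ hc]

/-- There is a single step `h ∈ [H, 2H]` at which the `L_1` norms of all the differences with steps
`h, 2h, …, kh` are bounded by averages over the step: take `h` where the sum of these norms does
not exceed its mean. -/
theorem exists_good_step {F : ℝ → ℝ} (hF : Measurable F) (k : ℕ) {H : ℝ} (hH : 0 < H) (Z : Set ℝ) :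
    ∃ h ∈ Icc H (2 * H), ∀ i ∈ Finset.Icc 1 k, ∫⁻ z in Z, ‖fd k (i * h) F z‖ₑ ≤
      ENNReal.ofReal (k / H) * ∫⁻ u in Icc H ((2 * k + 1) * H), ∫⁻ z in Z, ‖fd k u F z‖ₑ := by
  set I : ℝ → ℝ≥0∞ := fun u => ∫⁻ z in Z, ‖fd k u F z‖ₑ with hI
  have hIm : Measurable I := by
    have h1 : Measurable (Function.uncurry fun u z : ℝ => ‖fd k u F z‖ₑ) :=
      ((measurable_fd_uncurry hF k).comp measurable_swap).enorm
    exact h1.lintegral_prod_right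
  have hvol : volume (Icc H (2 * H)) = ENNReal.ofReal H := by
    rw [Real.volume_Icc]; congr 1; ring
  obtain ⟨h, hh, hle⟩ := exists_le_setLAverage (μ := volume) (s := Icc H (2 * H))
    (f := fun h => ∑ i ∈ Finset.Icc 1 k, I (i * h)) (by rw [hvol]; simpa using hH)
    (by rw [hvol]; exact ENNReal.ofReal_ne_top)
    (Finset.measurable_sum _ fun i _ => hIm.comp (measurable_const_mul _)).aemeasurable
  refine ⟨h, hh, fun i hi => ?_⟩
  refine (Finset.single_le_sum (f := fun i : ℕ => I (i * h)) (fun _ _ => zero_le) hi).trans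
    (hle.trans ?_)
  have hIc : ∀ i : ℕ, Measurable fun x : ℝ => I (i * x) := fun i =>
    hIm.comp (measurable_const_mul _)
  rw [setLAverage_eq, hvol, lintegral_finsetSum _ fun i _ => hIc i]
  have hterm : ∀ i ∈ Finset.Icc 1 k, ∫⁻ x in Icc H (2 * H), I (i * x) ≤
      ∫⁻ u in Icc H ((2 * k + 1) * H), I u := by
    intro i hi
    obtain ⟨h1, hk⟩ := Finset.mem_Icc.1 hi
    have h1' : (1 : ℝ) ≤ i := by exact_mod_cast h1
    have hk' : (i : ℝ) ≤ k := by exact_mod_cast hk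
    rw [setLIntegral_comp_mul_left hIm (by linarith)]
    calc _ ≤ 1 * ∫⁻ u in Icc (i * H) (i * (2 * H)), I u := by
          refine mul_le_mul' ?_ le_rfl
          rw [ENNReal.ofReal_le_one]
          exact inv_le_one_of_one_le₀ h1'
      _ ≤ _ := by
          rw [one_mul]
          refine lintegral_mono_set (Icc_subset_Icc ?_ ?_) <;> nlinarith
  calc _ ≤ (∑ _i ∈ Finset.Icc 1 k, ∫⁻ u in Icc H ((2 * k + 1) * H), I u) / ENNReal.ofReal H :=
        ENNReal.div_le_div_right (Finset.sum_le_sum hterm) _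
    _ = _ := by
        rw [Finset.sum_const, Nat.card_Icc, Nat.add_sub_cancel, nsmul_eq_mul,
          ENNReal.ofReal_div_of_pos hH, ENNReal.ofReal_natCast, ENNReal.div_eq_inv_mul,
          ENNReal.div_eq_inv_mul]
        ring

/-- A pointwise Whitney estimate with `k = m + 1`: on `[a, a + H]` a function is as close to a
polynomial of degree `< k` as the averages of its `k`-th differences with steps comparable to `H`
allow. The `k`-fold Steklov mean of `u ↦ fd k u F y` at `u = H` is `±F y` plus a combination of
`k`-fold Steklov means of `F` with the steps `ih` at the points `y + iH`, `1 ≤ i ≤ k`, and each of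
the latter is a polynomial up to a `k`-fold primitive of a `k`-th difference. -/
theorem exists_whitney_polynomial (m : ℕ) {F : ℝ → ℝ} (hF : Measurable F) {a b H : ℝ} (hH : 0 < H)
    (hb : a + (((m + 1 : ℕ) : ℝ) + 1) * H
      + ((m + 1 : ℕ) : ℝ) * (2 * ((m + 1 : ℕ) : ℝ) + 1) * H ≤ b)
    (hint : IntegrableOn F (Icc (a + H) b)) :
    ∃ P ∈ Polynomial.degreeLT ℝ (m + 1), ∀ y ∈ Icc a (a + H), ‖F y - P.eval y‖ₑ ≤
      ENNReal.ofReal (1 / H) *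
        (∫⁻ u in Icc H ((2 * ((m + 1 : ℕ) : ℝ) + 1) * H), ‖fd (m + 1) u F y‖ₑ) +
      ENNReal.ofReal ((2 * ((m + 1 : ℕ) : ℝ)) ^ (m + 2) / H ^ 2) *
        ∫⁻ u in Icc H ((2 * ((m + 1 : ℕ) : ℝ) + 1) * H),
          ∫⁻ z in Icc (a + H) (a + (((m + 1 : ℕ) : ℝ) + 1) * H), ‖fd (m + 1) u F z‖ₑ := by
  set k : ℕ := m + 1 with hk
  have hk1 : (1 : ℝ) ≤ k := by rw [hk]; push_cast; linarith [(Nat.cast_nonneg m : (0 : ℝ) ≤ m)]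
  set Z := Icc (a + H) (a + ((k : ℝ) + 1) * H) with hZ
  obtain ⟨h, hh, hgood⟩ := exists_good_step hF k hH Z
  set D := ∫⁻ u in Icc H ((2 * (k : ℝ) + 1) * H), ∫⁻ z in Z, ‖fd k u F z‖ₑ with hD
  have hh0 : 0 < h := hH.trans_le hh.1
  -- `F` need not be integrable near `a`, but only its values on `[a + H, b]` are averaged.
  set F1 := (Icc (a + H) b).indicator F with hF1
  have hF1eq : ∀ x, a + H ≤ x → x ≤ b → F1 x = F x := fun x h1 h2 =>
    indicator_of_mem (show x ∈ Icc (a + H) b from ⟨h1, h2⟩) F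
  have hF1i : IntervalInt F1 := fun c d =>
    ((integrable_indicator_iff measurableSet_Icc).2 hint).intervalIntegrable
  -- The Steklov means with steps `ih` are polynomials up to remainders.
  choose Q hQ hQe using fun i : ℕ =>
    exists_steklov_iterate_eq (a + H) (i * h) k F1 hF1i
  set c : ℕ → ℝ := fun i => (k.choose i : ℝ) * (-1) ^ (k - i) with hc
  set R : ℕ → ℝ → ℝ := fun i x =>
    ((i * h)⁻¹) ^ k * (primitiveFrom (a + H))^[k] ((fwdDiff (i * h))^[k] F1) x with hR
  refine ⟨(-(-1) ^ k : ℝ) • ∑ i ∈ Finset.Icc 1 k, c i • Polynomial.taylor (i * H) (Q i),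
    Submodule.smul_mem _ _ (Submodule.sum_mem _ fun i _ => Submodule.smul_mem _ _ ?_), ?_⟩
  · rw [Polynomial.mem_degreeLT, Polynomial.degree_taylor]
    exact Polynomial.mem_degreeLT.1 (hQ i)
  intro y hy
  -- `ψ u` is the difference `fd k u F y`, with the node `y` itself split off.
  set ψ : ℝ → ℝ := fun u => (-1) ^ k * F y + ∑ i ∈ Finset.Icc 1 k, c i * F1 (y + i * u) with hψ
  have hbnd : ∀ i ∈ Finset.Icc 1 k, (1 : ℝ) ≤ i ∧ (i : ℝ) ≤ k := fun i hi => by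
    obtain ⟨h1, h2⟩ := Finset.mem_Icc.1 hi
    exact ⟨by exact_mod_cast h1, by exact_mod_cast h2⟩
  have hψu : ∀ u ∈ Icc H ((2 * (k : ℝ) + 1) * H), ψ u = fd k u F y := by
    intro u hu
    rw [hψ, fd, Finset.range_eq_Ico, Finset.sum_eq_sum_Ico_succ_bot (Nat.succ_pos k)]
    simp only [Nat.choose_zero_right, Nat.cast_one, one_mul, Nat.sub_zero, Nat.cast_zero, zero_mul,
      add_zero]
    congr 1
    refine Finset.sum_congr rfl fun i hi => ?_
    obtain ⟨h1, h2⟩ := hbnd i hi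
    have hu0 : 0 ≤ u := hH.le.trans hu.1
    rw [hF1eq]
    · nlinarith [hy.1, hu.1]
    · have : (i : ℝ) * u ≤ k * ((2 * (k : ℝ) + 1) * H) := by
        refine mul_le_mul h2 hu.2 hu0 (by linarith)
      nlinarith [hy.2]
  have hS : (steklov h)^[k] ψ H = (-1) ^ k * F y +
      ∑ i ∈ Finset.Icc 1 k, c i * ((Q i).eval (y + i * H) + R i (y + i * H)) := by
    have hii : ∀ i ∈ Finset.Icc 1 k, IntervalInt fun u => c i * F1 (y + i * u) := fun i _ =>
      (hF1i.comp_add_mul y i).const_mul (c i)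
    rw [hψ, steklov_iterate_add (continuous_const.intervalInt) (IntervalInt.sum _ hii),
      steklov_iterate_const hh0.ne']
    simp only
    rw [steklov_iterate_sum _ hii hh0.ne']
    congr 1
    refine Finset.sum_congr rfl fun i hi => ?_
    have hi0 : (i : ℝ) ≠ 0 := by have := (hbnd i hi).1; positivity
    rw [steklov_iterate_const_mul, steklov_iterate_comp_add_mul F1 hi0]
    simp only
    rw [hQe]
  have hid : F y - ((-(-1) ^ k : ℝ) • ∑ i ∈ Finset.Icc 1 k,
      c i • Polynomial.taylor (i * H) (Q i)).eval y =
      (-1) ^ k * ((steklov h)^[k] ψ H - ∑ i ∈ Finset.Icc 1 k, c i * R i (y + i * H)) := by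
    rw [hS]
    simp only [Polynomial.eval_smul, Polynomial.eval_finsetSum, Polynomial.taylor_eval,
      smul_eq_mul, mul_add, Finset.sum_add_distrib]
    have hs : ((-1 : ℝ) ^ k) * (-1) ^ k = 1 := by rw [← mul_pow]; simp
    linear_combination -(F y) * hs
  have hJ : ∀ i ∈ Finset.Icc 1 k, ‖c i * R i (y + i * H)‖ₑ ≤
      ENNReal.ofReal (2 ^ k * k ^ k / H ^ 2) * D := by
    intro i hi
    obtain ⟨h1, h2⟩ := hbnd i hi
    have hci : ‖c i‖ₑ ≤ ENNReal.ofReal (2 ^ k) := by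
      rw [hc, enorm_choose_mul_neg_one_pow, ← ENNReal.ofReal_natCast]
      refine ENNReal.ofReal_le_ofReal ?_
      exact_mod_cast Nat.choose_le_two_pow k i
    have hmem : y + i * H ∈ Icc (a + H) (a + ((k : ℝ) + 1) * H) :=
      ⟨by nlinarith [hy.1], by nlinarith [hy.2]⟩
    have hpow : ‖((i * h)⁻¹ : ℝ) ^ k‖ₑ ≤ ENNReal.ofReal ((1 / H) ^ k) := by
      rw [Real.enorm_of_nonneg (by positivity)]
      refine ENNReal.ofReal_le_ofReal (pow_le_pow_left₀ (by positivity) ?_ k)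
      rw [← one_div]
      exact one_div_le_one_div_of_le hH (by nlinarith [hh.1])
    have hprim := enorm_primitiveFrom_iterate_le (x₀ := a + H) (b := a + ((k : ℝ) + 1) * H)
      ((fwdDiff (i * h))^[k] F1) m (y + i * H) hmem
    have hfd : ∫⁻ z in Z, ‖(fwdDiff (i * h))^[k] F1 z‖ₑ = ∫⁻ z in Z, ‖fd k (i * h) F z‖ₑ := by
      refine setLIntegral_congr_fun measurableSet_Icc fun z hz => ?_
      rw [fwdDiff_iterate_eq_fd]
      congr 1
      refine Finset.sum_congr rfl fun j hj => ?_
      have hj' : (j : ℝ) ≤ k := by exact_mod_cast Finset.mem_range_succ_iff.1 hj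
      have hih : (i : ℝ) * h ≤ k * (2 * H) := mul_le_mul h2 hh.2 hh0.le (by linarith)
      have hih0 : 0 ≤ (i : ℝ) * h := by positivity
      have hjih : (j : ℝ) * (i * h) ≤ k * (k * (2 * H)) :=
        mul_le_mul hj' hih hih0 (by linarith)
      rw [hF1eq]
      · have : 0 ≤ (j : ℝ) * (i * h) := by positivity
        linarith [hz.1]
      · nlinarith [hz.2]
    rw [hfd] at hprim
    have hg := hgood i hi
    calc _ ≤ ENNReal.ofReal (2 ^ k) * (ENNReal.ofReal ((1 / H) ^ k) *
          (ENNReal.ofReal ((a + ((k : ℝ) + 1) * H - (a + H)) ^ m) * (ENNReal.ofReal (k / H) * D)))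
            := by
          rw [enorm_mul (c i), hR, enorm_mul (((i * h)⁻¹ : ℝ) ^ k)]
          exact mul_le_mul' hci (mul_le_mul' hpow (hprim.trans (mul_le_mul' le_rfl hg)))
      _ = _ := by
          rw [← mul_assoc, ← mul_assoc, ← mul_assoc, ← ENNReal.ofReal_mul (by positivity),
            ← ENNReal.ofReal_mul (by positivity), ← ENNReal.ofReal_mul
              (mul_nonneg (by positivity) (pow_nonneg (by nlinarith) _))]
          congr 2
          have : a + ((k : ℝ) + 1) * H - (a + H) = k * H := by ring
          rw [this, one_div_pow, hk, mul_pow]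
          field_simp
          ring
  have hmain : ‖(steklov h)^[k] ψ H‖ₑ ≤ ENNReal.ofReal (1 / H) *
      ∫⁻ u in Icc H ((2 * (k : ℝ) + 1) * H), ‖fd k u F y‖ₑ := by
    refine (enorm_steklov_iterate_le hh0 ψ m H).trans (mul_le_mul' ?_ ?_)
    · exact ENNReal.ofReal_le_ofReal (one_div_le_one_div_of_le hH hh.1)
    · refine (lintegral_mono_set (Icc_subset_Icc le_rfl ?_)).trans
        (setLIntegral_congr_fun measurableSet_Icc fun u hu => ?_).le
      · have : (k : ℝ) = m + 1 := by rw [hk]; push_cast; ring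
        rw [← this]
        nlinarith [hh.2]
      · rw [hψu u hu]
  rw [hid, enorm_mul, enorm_pow, enorm_neg, enorm_one, one_pow, one_mul]
  refine (enorm_sub_le).trans (add_le_add hmain ?_)
  refine (enorm_sum_le _ _).trans ((Finset.sum_le_sum hJ).trans ?_)
  rw [Finset.sum_const, Nat.card_Icc, Nat.add_sub_cancel, nsmul_eq_mul, ← mul_assoc,
    ← ENNReal.ofReal_natCast, ← ENNReal.ofReal_mul (by positivity)]
  refine mul_le_mul' (ENNReal.ofReal_le_ofReal ?_) le_rfl
  rw [← mul_div_assoc]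
  refine div_le_div_of_nonneg_right ?_ (by positivity)
  have : (k : ℝ) * (2 ^ k * k ^ k) = 2 ^ k * k ^ (k + 1) := by ring
  rw [this, show m + 2 = k + 1 from by omega, mul_pow]
  refine mul_le_mul_of_nonneg_right ?_ (by positivity)
  exact pow_le_pow_right₀ (by norm_num) (Nat.le_succ k)

/-! ### Smooth gluing of polynomials -/

open scoped ContDiff in
theorem exists_iteratedDeriv_eq_of_contDiff (r : ℕ) : ∀ {G : ℝ → ℝ}, ContDiff ℝ ∞ G →
    ∃ g : ℝ → ℝ, ContDiff ℝ ∞ g ∧ iteratedDeriv r g = G := by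
  induction r with
  | zero => intro G hG; exact ⟨G, hG, iteratedDeriv_zero⟩
  | succ r ih =>
    intro G hG
    obtain ⟨g, hg, hgG⟩ := ih hG
    have hd : deriv (fun x => ∫ w in (0 : ℝ)..x, g w) = g := by
      funext x
      exact hg.continuous.deriv_integral g 0 x
    refine ⟨fun x => ∫ w in (0 : ℝ)..x, g w, ?_, ?_⟩
    · rw [contDiff_infty_iff_deriv, hd]
      exact ⟨fun x => (hg.continuous.integral_hasStrictDerivAt 0 x).hasDerivAt.differentiableAt, hg⟩
    · rw [iteratedDeriv_succ', hd, hgG]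

theorem memLp_of_continuous {f : ℝ → ℝ} (hf : Continuous f) (p : ℝ≥0∞) :
    MemLp f p (volume.restrict (Icc (-1 : ℝ) 1)) := by
  obtain ⟨C, hC⟩ := (isCompact_Icc (a := (-1 : ℝ)) (b := 1)).exists_bound_of_continuousOn
    hf.continuousOn
  exact MemLp.of_bound hf.aestronglyMeasurable C
    ((ae_restrict_iff' measurableSet_Icc).2 (Filter.Eventually.of_forall hC))

open scoped ContDiff in
theorem mem_BSpace_of_contDiff {g : ℝ → ℝ} (hg : ContDiff ℝ ∞ g) (p : ℝ≥0∞) (n : ℕ) :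
    g ∈ BSpace p n := by
  cases n with
  | zero => exact memLp_of_continuous hg.continuous p
  | succ n =>
    refine ⟨(hg.of_le (by exact_mod_cast le_top)).contDiffOn, fun a b _ _ _ => ?_, ?_⟩
    · have h1 : ContDiff ℝ 1 (iteratedDeriv n g) := by
        rw [iteratedDeriv_eq_iterate]
        exact (ContDiff.iterate_deriv n hg).of_le (by exact_mod_cast le_top)
      exact h1.contDiffOn.absolutelyContinuousOnInterval
    · exact memLp_of_continuous ((hg.continuous_iteratedDeriv (n + 1)
        (by exact_mod_cast le_top)).mul (continuous_phi.pow _)) p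

open scoped ContDiff in
/-- Every smooth function is the derivative of order `r` of a competitor in the
`K`-functional. -/
theorem KFunctional_le_of_contDiff {G : ℝ → ℝ} (hG : ContDiff ℝ ∞ G) (k r : ℕ) (p : ℝ≥0∞)
    (F : ℝ → ℝ) (s : ℝ) : KFunctional k r p F s ≤
      normP p (fun x => (F x - G x) * phi x ^ r) +
        ENNReal.ofReal s * normP p (fun x => iteratedDeriv k G x * phi x ^ (k + r)) := by
  obtain ⟨g, hg, hgG⟩ := exists_iteratedDeriv_eq_of_contDiff r hG
  refine (iInf₂_le g (mem_BSpace_of_contDiff hg p (k + r))).trans ?_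
  rw [← iteratedDeriv_iteratedDeriv, hgG]

/-- Equivalence of norms on the polynomials of degree `< k`: the coefficients are controlled by the
`L_1` norm on `[0, 1]`. -/
theorem exists_coeff_le (m : ℕ) : ∃ C : ℝ, 0 < C ∧ ∀ r : Fin (m + 1) → ℝ,
    ‖r‖ ≤ C * ∫ x in (0 : ℝ)..1, |∑ i, r i * x ^ (i : ℕ)| := by
  set N : (Fin (m + 1) → ℝ) → ℝ := fun r => ∫ x in (0 : ℝ)..1, |∑ i, r i * x ^ (i : ℕ)| with hN
  have hcont : Continuous N := by
    refine intervalIntegral.continuous_parametric_intervalIntegral_of_continuous' ?_ 0 1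
    unfold Function.uncurry
    fun_prop
  have hsm : ∀ (c : ℝ) (r : Fin (m + 1) → ℝ), N (c • r) = |c| * N r := by
    intro c r
    simp only [hN]
    rw [← intervalIntegral.integral_const_mul]
    refine intervalIntegral.integral_congr fun x _ => ?_
    simp only [Pi.smul_apply, smul_eq_mul, mul_assoc, ← Finset.mul_sum, abs_mul]
  have hpos : ∀ r, r ≠ 0 → 0 < N r := by
    intro r hr
    set P : Polynomial ℝ := ((Polynomial.degreeLTEquiv ℝ (m + 1)).symm r : Polynomial ℝ) with hP
    have hPe : ∀ x, P.eval x = ∑ i, r i * x ^ (i : ℕ) := by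
      intro x
      rw [Polynomial.eval_eq_sum_degreeLTEquiv
        ((Polynomial.degreeLTEquiv ℝ (m + 1)).symm r).2 x]
      simp
    have hP0 : P ≠ 0 := by
      intro h0
      refine hr ?_
      have : (Polynomial.degreeLTEquiv ℝ (m + 1)).symm r = 0 := Subtype.ext h0
      simpa using this
    have hex : ∃ x ∈ Ioo (0 : ℝ) 1, P.eval x ≠ 0 := by
      by_contra hcon
      push Not at hcon
      refine hP0 (P.eq_zero_of_infinite_isRoot ?_)
      exact (Ioo_infinite (zero_lt_one (α := ℝ))).mono fun x hx => hcon x hx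
    obtain ⟨x, hx, hxP⟩ := hex
    simp only [hN]
    simp_rw [← hPe]
    refine intervalIntegral.integral_pos zero_lt_one
      (Polynomial.continuous P).abs.continuousOn (fun _ _ => abs_nonneg _)
      ⟨x, Ioo_subset_Icc_self hx, abs_pos.2 hxP⟩
  obtain ⟨r₀, hr₀, hmin⟩ := (isCompact_sphere (0 : Fin (m + 1) → ℝ) 1).exists_isMinOn
    (NormedSpace.sphere_nonempty.2 zero_le_one) hcont.continuousOn
  have hr₀' : r₀ ≠ 0 := by
    rintro rfl
    simp at hr₀
  have hδ := hpos r₀ hr₀'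
  refine ⟨(N r₀)⁻¹, inv_pos.2 hδ, fun r => ?_⟩
  rcases eq_or_ne r 0 with rfl | hr
  · simp
  have hr0 : 0 < ‖r‖ := norm_pos_iff.2 hr
  have h1 : N r₀ ≤ N (‖r‖⁻¹ • r) := hmin (by simp [norm_smul, hr0.ne'])
  rw [hsm, abs_of_pos (inv_pos.2 hr0)] at h1
  change ‖r‖ ≤ (N r₀)⁻¹ * N r
  rw [inv_mul_eq_div, le_div_iff₀ hδ]
  rw [inv_mul_eq_div, le_div_iff₀ hr0] at h1
  linarith

/-- A smooth function which is `0` to the left of `[a, a + d]` and `1` to the right of it. -/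
noncomputable def stepFun (a d x : ℝ) : ℝ := Real.smoothTransition (d⁻¹ * (x - a))

open scoped ContDiff in
theorem contDiff_stepFun (a d : ℝ) : ContDiff ℝ ∞ (stepFun a d) := by
  unfold stepFun
  exact Real.smoothTransition.contDiff.comp (by fun_prop)

theorem comp_mem_degreeLT {m : ℕ} {Q L : Polynomial ℝ} (hQ : Q ∈ Polynomial.degreeLT ℝ (m + 1))
    (hL : L.natDegree ≤ 1) : Q.comp L ∈ Polynomial.degreeLT ℝ (m + 1) := by
  rcases eq_or_ne Q 0 with rfl | hQ0
  · simp
  rw [Polynomial.mem_degreeLT] at hQ ⊢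
  rw [Polynomial.degree_lt_iff_coeff_zero]
  intro j hj
  refine Polynomial.coeff_eq_zero_of_natDegree_lt (lt_of_le_of_lt Polynomial.natDegree_comp_le ?_)
  have h1 : Q.natDegree < m + 1 := (Polynomial.natDegree_lt_iff_degree_lt hQ0).2 hQ
  nlinarith

/-- The derivative of order `k = m + 1` of a polynomial of degree `< k`, cut off at the scale `d`:
it is bounded by `d^{-k}` times the mean of the polynomial over the transition interval. -/
theorem exists_iteratedDeriv_stepFun_mul_le (m : ℕ) : ∃ C : ℝ, 0 < C ∧
    ∀ Q ∈ Polynomial.degreeLT ℝ (m + 1), ∀ a d : ℝ, 0 < d → ∀ y ∈ Icc a (a + d),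
      |iteratedDeriv (m + 1) (fun x => stepFun a d x * Q.eval x) y| ≤
        C * (d⁻¹) ^ (m + 2) * ∫ x in a..(a + d), |Q.eval x| := by
  obtain ⟨C, hC, hcoef⟩ := exists_coeff_le m
  set B : ℕ → ℝ → ℝ := fun i s => Real.smoothTransition s * s ^ i with hB
  have hBs : ∀ i, ContDiff ℝ (m + 1 : ℕ) (B i) := fun i =>
    (Real.smoothTransition.contDiff (n := ((m + 1 : ℕ) : ℕ∞))).mul (contDiff_id.pow i)
  have hM : ∀ i : ℕ, ∃ M : ℝ, ∀ s ∈ Icc (0 : ℝ) 1, ‖iteratedDeriv (m + 1) (B i) s‖ ≤ M := fun i =>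
    isCompact_Icc.exists_bound_of_continuousOn
      ((hBs i).continuous_iteratedDeriv' (m + 1)).continuousOn
  choose M hM using hM
  have hM0 : ∀ i, 0 ≤ M i := fun i => (norm_nonneg _).trans (hM i 0 ⟨le_rfl, zero_le_one⟩)
  set S : ℝ := ∑ i : Fin (m + 1), M i with hS
  have hS0 : 0 ≤ S := Finset.sum_nonneg fun i _ => hM0 i
  refine ⟨(S + 1) * C, by positivity, fun Q hQ a d hd y hy => ?_⟩
  set R : Polynomial ℝ := Q.comp (Polynomial.C a + Polynomial.C d * Polynomial.X) with hR
  have hRe : ∀ s, R.eval s = Q.eval (a + d * s) := fun s => by simp [hR]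
  have hRd : R ∈ Polynomial.degreeLT ℝ (m + 1) := comp_mem_degreeLT hQ (by compute_degree)
  set r := Polynomial.degreeLTEquiv ℝ (m + 1) ⟨R, hRd⟩ with hr
  have hRr : ∀ s, R.eval s = ∑ i, r i * s ^ (i : ℕ) := fun s =>
    Polynomial.eval_eq_sum_degreeLTEquiv hRd s
  have hfun : (fun x => stepFun a d x * Q.eval x) =
      fun x => ∑ i, r i * B i (d⁻¹ * (x - a)) := by
    funext x
    have : Q.eval x = R.eval (d⁻¹ * (x - a)) := by
      rw [hRe]; congr 1; field_simp; ring
    rw [this, hRr, Finset.mul_sum, stepFun]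
    exact Finset.sum_congr rfl fun i _ => by rw [hB]; ring
  have hder : iteratedDeriv (m + 1) (fun x => stepFun a d x * Q.eval x) y =
      ∑ i, r i * ((d⁻¹) ^ (m + 1) * iteratedDeriv (m + 1) (B i) (d⁻¹ * (y - a))) := by
    rw [hfun, iteratedDeriv_fun_sum]
    · refine Finset.sum_congr rfl fun i _ => ?_
      rw [iteratedDeriv_const_mul_field]
      congr 1
      have h1 := iteratedDeriv_comp_sub_const (m + 1) (fun z => B i (d⁻¹ * z)) a
      rw [h1, iteratedDeriv_comp_const_mul (hBs i)]
    · intro i _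
      exact ((contDiff_const.mul ((hBs i).comp (by fun_prop)))).contDiffAt
  have hs : d⁻¹ * (y - a) ∈ Icc (0 : ℝ) 1 := by
    rw [inv_mul_eq_div]
    exact ⟨div_nonneg (by linarith [hy.1]) hd.le, (div_le_one hd).2 (by linarith [hy.2])⟩
  have hint : ∫ s in (0 : ℝ)..1, |R.eval s| = d⁻¹ * ∫ x in a..(a + d), |Q.eval x| := by
    simp_rw [hRe]
    rw [intervalIntegral.integral_comp_add_mul (fun x => |Q.eval x|) hd.ne']
    simp
  have hnorm : ‖r‖ ≤ C * (d⁻¹ * ∫ x in a..(a + d), |Q.eval x|) := by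
    rw [← hint]
    simp_rw [hRr]
    exact hcoef r
  have hI0 : 0 ≤ ∫ x in a..(a + d), |Q.eval x| :=
    intervalIntegral.integral_nonneg (by linarith) fun _ _ => abs_nonneg _
  rw [hder]
  calc _ ≤ ∑ i : Fin (m + 1), ‖r‖ * ((d⁻¹) ^ (m + 1) * M i) := by
        refine (Finset.abs_sum_le_sum_abs _ _).trans (Finset.sum_le_sum fun i _ => ?_)
        rw [abs_mul, abs_mul, abs_of_nonneg (by positivity : (0 : ℝ) ≤ (d⁻¹) ^ (m + 1))]
        exact mul_le_mul (norm_le_pi_norm r i) (mul_le_mul_of_nonneg_left (hM i _ hs)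
          (by positivity)) (by positivity) (norm_nonneg _)
    _ = ‖r‖ * ((d⁻¹) ^ (m + 1) * S) := by rw [← Finset.mul_sum, ← Finset.mul_sum]
    _ ≤ C * (d⁻¹ * ∫ x in a..(a + d), |Q.eval x|) * ((d⁻¹) ^ (m + 1) * (S + 1)) := by
        refine mul_le_mul hnorm (mul_le_mul_of_nonneg_left (by linarith) (by positivity))
          (by positivity) (by positivity)
    _ = _ := by ring

theorem contDiff_polynomial {n : WithTop ℕ∞} (Q : Polynomial ℝ) :
    ContDiff ℝ n fun x => Q.eval x := by
  simpa using Q.contDiff_aeval (𝕜 := ℝ) n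

/-- The function which is glued together from the polynomials `P 0, …, P N`, with the transition
from `P j` to `P (j + 1)` taking place between the nodes `x j` and `x (j + 1)`. -/
noncomputable def glue (N : ℕ) (x : ℕ → ℝ) (P : ℕ → Polynomial ℝ) (y : ℝ) : ℝ :=
  (P 0).eval y + ∑ j ∈ Finset.range N,
    stepFun (x j) (x (j + 1) - x j) y * (P (j + 1) - P j).eval y

open scoped ContDiff in
theorem contDiff_glue (N : ℕ) (x : ℕ → ℝ) (P : ℕ → Polynomial ℝ) : ContDiff ℝ ∞ (glue N x P) := by
  unfold glue
  refine (contDiff_polynomial (P 0)).add (ContDiff.sum fun j _ => (contDiff_stepFun _ _).mul ?_)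
  exact contDiff_polynomial _

/-- Between two neighbouring nodes only one of the transitions is in progress. -/
theorem glue_eq_of_mem {N : ℕ} {x : ℕ → ℝ} (hx : ∀ i < N, x i < x (i + 1)) (P : ℕ → Polynomial ℝ)
    {j : ℕ} (hj : j < N) {y : ℝ} (hy : y ∈ Icc (x j) (x (j + 1))) :
    glue N x P y = (P j).eval y +
      stepFun (x j) (x (j + 1) - x j) y * (P (j + 1) - P j).eval y := by
  have hmono : ∀ i l, i ≤ l → l ≤ N → x i ≤ x l := by
    intro i l hil
    induction l, hil using Nat.le_induction with
    | base => intro _; exact le_rfl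
    | succ l _ ih => intro hl; exact (ih (by omega)).trans (hx l (by omega)).le
  have hone : ∀ i < j, stepFun (x i) (x (i + 1) - x i) y = 1 := by
    intro i hi
    have hd : 0 < x (i + 1) - x i := sub_pos.2 (hx i (by omega))
    refine Real.smoothTransition.one_of_one_le ?_
    rw [inv_mul_eq_div, le_div_iff₀ hd]
    linarith [hmono (i + 1) j hi hj.le, hy.1]
  have hzero : ∀ i, j < i → i < N → stepFun (x i) (x (i + 1) - x i) y = 0 := by
    intro i hi hiN
    have hd : 0 < x (i + 1) - x i := sub_pos.2 (hx i (by omega))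
    refine Real.smoothTransition.zero_of_nonpos ?_
    rw [inv_mul_eq_div]
    refine div_nonpos_of_nonpos_of_nonneg ?_ hd.le
    linarith [hmono (j + 1) i hi hiN.le, hy.2]
  unfold glue
  rw [← Finset.sum_range_add_sum_Ico _ (show j + 1 ≤ N from hj), Finset.sum_range_succ,
    Finset.sum_eq_zero (s := Finset.Ico (j + 1) N), add_zero, ← add_assoc]
  · congr 1
    rw [Finset.sum_congr rfl fun i hi => by rw [hone i (Finset.mem_range.1 hi), one_mul]]
    simp only [Polynomial.eval_sub]
    rw [Finset.sum_range_sub fun i => (P i).eval y]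
    ring
  · intro i hi
    obtain ⟨h1, h2⟩ := Finset.mem_Ico.1 hi
    rw [hzero i h1 h2, zero_mul]

theorem stepFun_mem_Icc (a d x : ℝ) : stepFun a d x ∈ Icc (0 : ℝ) 1 :=
  ⟨Real.smoothTransition.nonneg _, Real.smoothTransition.le_one _⟩

theorem abs_sub_glue_le {N : ℕ} {x : ℕ → ℝ} (hx : ∀ i < N, x i < x (i + 1)) (P : ℕ → Polynomial ℝ)
    {j : ℕ} (hj : j < N) {y : ℝ} (hy : y ∈ Icc (x j) (x (j + 1))) (c : ℝ) :
    |c - glue N x P y| ≤ |c - (P j).eval y| + |c - (P (j + 1)).eval y| := by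
  rw [glue_eq_of_mem hx P hj hy]
  obtain ⟨h0, h1⟩ := stepFun_mem_Icc (x j) (x (j + 1) - x j) y
  set s := stepFun (x j) (x (j + 1) - x j) y
  have : c - ((P j).eval y + s * (P (j + 1) - P j).eval y) =
      (1 - s) * (c - (P j).eval y) + s * (c - (P (j + 1)).eval y) := by
    rw [Polynomial.eval_sub]; ring
  rw [this]
  refine (abs_add_le _ _).trans (add_le_add ?_ ?_)
  · rw [abs_mul, abs_of_nonneg (by linarith)]
    exact mul_le_of_le_one_left (abs_nonneg _) (by linarith)
  · rw [abs_mul, abs_of_nonneg h0]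
    exact mul_le_of_le_one_left (abs_nonneg _) h1

/-- Between two nodes the derivative of order `m + 1` sees only the jump `P (j + 1) - P j`, since it
annihilates `P j`. -/
theorem iteratedDeriv_glue_eq {N m : ℕ} {x : ℕ → ℝ} (hx : ∀ i < N, x i < x (i + 1))
    {P : ℕ → Polynomial ℝ} (hP : ∀ i, P i ∈ Polynomial.degreeLT ℝ (m + 1)) {j : ℕ} (hj : j < N)
    {y : ℝ} (hy : y ∈ Ioo (x j) (x (j + 1))) :
    iteratedDeriv (m + 1) (glue N x P) y = iteratedDeriv (m + 1)
      (fun y => stepFun (x j) (x (j + 1) - x j) y * (P (j + 1) - P j).eval y) y := by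
  have hev : glue N x P =ᶠ[nhds y] ((fun y => (P j).eval y) +
      fun y => stepFun (x j) (x (j + 1) - x j) y * (P (j + 1) - P j).eval y) := by
    filter_upwards [Ioo_mem_nhds hy.1 hy.2] with z hz
    exact glue_eq_of_mem hx P hj (Ioo_subset_Icc_self hz)
  have hpoly : iteratedDeriv (m + 1) (fun y => (P j).eval y) = fun _ => 0 := by
    rw [iteratedDeriv_eq_iterate]
    have hit : ∀ n : ℕ, deriv^[n] (fun y => (P j).eval y) =
        fun y => (Polynomial.derivative^[n] (P j)).eval y := by
      intro n
      induction n with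
      | zero => rfl
      | succ n ih =>
        rw [Function.iterate_succ_apply', ih, Function.iterate_succ_apply']
        funext y
        exact Polynomial.deriv _
    rw [hit]
    have h0 : Polynomial.derivative^[m + 1] (P j) = 0 := by
      refine Polynomial.iterate_derivative_eq_zero ?_
      rcases eq_or_ne (P j) 0 with h | h
      · rw [h]; simp
      · exact (Polynomial.natDegree_lt_iff_degree_lt h).2 (Polynomial.mem_degreeLT.1 (hP j))
    simp [h0]
  rw [hev.iteratedDeriv_eq, iteratedDeriv_add, hpoly, zero_add]
  · exact (contDiff_polynomial (P j)).contDiffAt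
  · exact (((contDiff_stepFun _ _).of_le (by exact_mod_cast le_top)).mul
      (contDiff_polynomial _)).contDiffAt

/-! ### Cells of quadratically graded length -/

/-- The length `4(i + 1)/n²` of the `i`-th cell. It is comparable to `φ/n` at the centres of the
differences used there, and the cell reaches from `-1 + (i/n)²` to `-1 + ((i + 2)/n)²`. -/
noncomputable def cellStep (n i : ℕ) : ℝ := 4 * (i + 1) / (n : ℝ) ^ 2

/-- The left end point `-1 + (i/n)²` of the `i`-th cell. -/
noncomputable def cellLeft (n i : ℕ) : ℝ := -1 + ((i : ℝ) / n) ^ 2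

/-- The base points used in the `i`-th cell: the cell and its enlargement to the right. -/
def cellBase (k n i : ℕ) : Set ℝ :=
  Icc (cellLeft n i) (cellLeft n i + ((k : ℝ) + 1) * cellStep n i)

/-- The steps used in the `i`-th cell. -/
def cellSteps (k n i : ℕ) : Set ℝ := Icc (cellStep n i) ((2 * (k : ℝ) + 1) * cellStep n i)

/-- The measure on the pairs (base point, step) belonging to the `i`-th cell, normalized in the
step. -/
noncomputable def cellMeasure (k n i : ℕ) : Measure (ℝ × ℝ) :=
  ENNReal.ofReal (1 / cellStep n i) •
    (volume.restrict (cellBase k n i)).prod (volume.restrict (cellSteps k n i))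

/-- The sum of the measures of the cells which cover `[-1, 0]`. -/
noncomputable def leftMeasure (k n : ℕ) : Measure (ℝ × ℝ) := ∑ i ∈ Finset.range n, cellMeasure k n i

/-- The weighted difference as a function of the base point and the step. -/
noncomputable def weightedFd (k r : ℕ) (F : ℝ → ℝ) (q : ℝ × ℝ) : ℝ := phi q.1 ^ r * fd k q.2 F q.1

theorem measurable_weightedFd (k r : ℕ) {F : ℝ → ℝ} (hF : Measurable F) :
    Measurable (weightedFd k r F) :=
  ((measurable_phi.comp measurable_fst).pow_const r).mul (measurable_fd_uncurry hF k)

theorem cellStep_pos {n : ℕ} (hn : 0 < n) (i : ℕ) : 0 < cellStep n i := by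
  unfold cellStep
  have : (0 : ℝ) < n := by exact_mod_cast hn
  positivity

theorem cellStep_le {n i : ℕ} (hi : i < n) : cellStep n i ≤ 4 / n := by
  have h1 : (i : ℝ) + 1 ≤ n := by exact_mod_cast hi
  have h0 : (0 : ℝ) < n := by exact_mod_cast (Nat.zero_le i).trans_lt hi
  unfold cellStep
  rw [div_le_div_iff₀ (by positivity) h0]
  nlinarith

theorem neg_one_le_cellLeft (n i : ℕ) : -1 ≤ cellLeft n i := by
  unfold cellLeft
  nlinarith [sq_nonneg ((i : ℝ) / n)]

theorem cellLeft_le_zero {n i : ℕ} (hi : i ≤ n) : cellLeft n i ≤ 0 := by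
  unfold cellLeft
  have h1 : (i : ℝ) ≤ n := by exact_mod_cast hi
  have h2 : (i : ℝ) / n ≤ 1 := div_le_one_of_le₀ h1 (Nat.cast_nonneg n)
  have h3 : 0 ≤ (i : ℝ) / n := by positivity
  nlinarith

theorem cellLeft_add_cellStep {n : ℕ} (hn : 0 < n) (i : ℕ) :
    cellLeft n i + cellStep n i = -1 + (((i : ℝ) + 2) / n) ^ 2 := by
  have h0 : (n : ℝ) ≠ 0 := by exact_mod_cast hn.ne'
  unfold cellLeft cellStep
  field_simp
  ring

/-- The cells are so short that all nodes of the differences stay in `[-1, 1/2]`. -/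
theorem cell_reach_le {k n i : ℕ} (hn : 16 * (k + 1) ^ 2 ≤ n) (hi : i < n) :
    cellLeft n i + ((k : ℝ) + 1) * cellStep n i + k * (2 * (k : ℝ) + 1) * cellStep n i ≤ 1 / 2 := by
  have h0 : (0 : ℝ) < n := by exact_mod_cast (Nat.zero_le i).trans_lt hi
  have h1 := cellStep_le hi
  have h2 := cellLeft_le_zero hi.le
  have hn' : 16 * ((k : ℝ) + 1) ^ 2 ≤ n := by exact_mod_cast hn
  have hk : (0 : ℝ) ≤ k := Nat.cast_nonneg k
  have h4 : (2 * ((k : ℝ) + 1) ^ 2) * cellStep n i ≤ 1 / 2 := by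
    calc _ ≤ (2 * ((k : ℝ) + 1) ^ 2) * (4 / n) := by gcongr
      _ ≤ 1 / 2 := by
        rw [mul_div_assoc', div_le_div_iff₀ h0 (by norm_num)]
        linarith
  have h5 := cellStep_pos ((Nat.zero_le i).trans_lt hi) i
  nlinarith [mul_nonneg hk h5.le, mul_nonneg (mul_nonneg hk hk) h5.le]

theorem phi_le_two_mul_phi {y z : ℝ} (hy : -1 ≤ y) (hyz : y ≤ z) (hz : z ≤ 1 / 2) :
    phi y ≤ 2 * phi z := by
  have h1 : 0 ≤ phi z := phi_nonneg z
  refine abs_le_of_sq_le_sq' ?_ (by positivity) |>.2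
  rw [mul_pow, phi_sq (abs_le.2 ⟨hy, by linarith⟩), phi_sq (abs_le.2 ⟨by linarith, by linarith⟩)]
  nlinarith

/-- The weight may vanish only at the end points. -/
theorem integrableOn_of_integrable_mul_phi {F : ℝ → ℝ} (hF : Measurable F) {r : ℕ}
    (hint : Integrable (fun x => F x * phi x ^ r) (volume.restrict (Icc (-1 : ℝ) 1))) {c : ℝ}
    (hc : -1 < c) : IntegrableOn F (Icc c (1 / 2)) := by
  rcases lt_or_ge (1 / 2) c with hc2 | hc2
  · rw [Icc_eq_empty (not_le.2 hc2)]; exact integrableOn_empty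
  have hpc : 0 < phi c := phi_pos (abs_lt.2 ⟨hc, by linarith⟩)
  have h1 : IntegrableOn (fun x => F x * phi x ^ r) (Icc c (1 / 2)) :=
    IntegrableOn.mono_set hint (Icc_subset_Icc hc.le (by norm_num))
  refine Integrable.mono' (h1.norm.const_mul (((phi c / 2) ^ r)⁻¹)) hF.aestronglyMeasurable ?_
  rw [ae_restrict_iff' measurableSet_Icc]
  refine Filter.Eventually.of_forall fun x hx => ?_
  have h2 : phi c / 2 ≤ phi x := by linarith [phi_le_two_mul_phi hc.le hx.1 hx.2]
  have h3 : (phi c / 2) ^ r ≤ phi x ^ r := pow_le_pow_left₀ (by positivity) h2 r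
  rw [inv_mul_eq_div, le_div_iff₀ (by positivity), norm_mul, norm_pow,
    Real.norm_of_nonneg (phi_nonneg x)]
  exact mul_le_mul_of_nonneg_left h3 (norm_nonneg _)

theorem prod_restrict_mono {s s' t : Set ℝ} (h : s ⊆ s') :
    (volume.restrict s).prod (volume.restrict t) ≤
      (volume.restrict s').prod ((volume : Measure ℝ).restrict t) := by
  rw [Measure.prod_restrict, Measure.prod_restrict]
  exact Measure.restrict_mono (prod_mono h subset_rfl) le_rfl

/-- The Whitney estimate on a cell in the weighted `L_p` norm. The pointwise estimate is an integral
operator acting on `weightedFd`, to which Schur's test applies; the weight can be moved from `y` to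
`z` since `z` lies to the right of `y`, that is, away from the end point. -/
theorem exists_polynomial_eLpNorm_cell_le (m r : ℕ) {p : ℝ≥0∞} (hp : 1 ≤ p) :
    ∃ C : ℝ≥0, ∀ F : ℝ → ℝ, Measurable F →
      Integrable (fun x => F x * phi x ^ r) (volume.restrict (Icc (-1 : ℝ) 1)) →
      ∀ n i : ℕ, 16 * (m + 1 + 1) ^ 2 ≤ n → i < n → ∃ P ∈ Polynomial.degreeLT ℝ (m + 1),
        eLpNorm (fun y => phi y ^ r * (F y - P.eval y)) p
          (volume.restrict (Icc (cellLeft n i) (cellLeft n i + cellStep n i))) ≤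
        C * eLpNorm (weightedFd (m + 1) r F) p (cellMeasure (m + 1) n i) := by
  set k : ℕ := m + 1 with hk
  set Cw : ℝ := (2 * (k : ℝ)) ^ (m + 2) with hCw
  have hCw0 : 0 ≤ Cw := by positivity
  refine ⟨Real.toNNReal (1 + 2 * k + 2 ^ r * Cw * (1 + 2 * k ^ 2)), fun F hF hFi n i hn hi => ?_⟩
  have hn0 : 0 < n := (Nat.zero_le i).trans_lt hi
  set a := cellLeft n i with ha
  set H := cellStep n i with hH
  have hH0 : 0 < H := cellStep_pos hn0 i
  have hreach := cell_reach_le hn hi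
  rw [← ha, ← hH] at hreach
  have ha1 : -1 ≤ a := neg_one_le_cellLeft n i
  have hk1 : (1 : ℝ) ≤ k := by rw [hk]; push_cast; linarith [(Nat.cast_nonneg m : (0 : ℝ) ≤ m)]
  obtain ⟨P, hP, hPF⟩ := exists_whitney_polynomial m hF hH0 hreach
    (integrableOn_of_integrable_mul_phi hF hFi (by linarith))
  refine ⟨P, hP, ?_⟩
  rw [← hk] at hPF
  set U := Icc H ((2 * (k : ℝ) + 1) * H) with hU
  set Z := Icc (a + H) (a + ((k : ℝ) + 1) * H) with hZ
  set Y := Icc a (a + ((k : ℝ) + 1) * H) with hY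
  set I := Icc a (a + H) with hI
  have hIY : I ⊆ Y := Icc_subset_Icc le_rfl (by nlinarith)
  have hZY : Z ⊆ Y := Icc_subset_Icc (by linarith) le_rfl
  have hvU : volume U = ENNReal.ofReal (2 * k * H) := by
    rw [hU, Real.volume_Icc]; congr 1; ring
  have hvZ : volume Z = ENNReal.ofReal (k * H) := by
    rw [hZ, Real.volume_Icc]; congr 1; ring
  have hvI : volume I = ENNReal.ofReal H := by
    rw [hI, Real.volume_Icc]; congr 1; ring
  set κ : ℝ → Measure (ℝ × ℝ) := fun y =>
    ENNReal.ofReal (1 / H) • (volume.restrict U).map (Prod.mk y) +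
      ENNReal.ofReal (2 ^ r * Cw / H ^ 2) • (volume.restrict Z).prod (volume.restrict U) with hκ
  have hκs : ∀ (y : ℝ) (s : Set (ℝ × ℝ)), MeasurableSet s → κ y s =
      ENNReal.ofReal (1 / H) * volume.restrict U (Prod.mk y ⁻¹' s) +
        ENNReal.ofReal (2 ^ r * Cw / H ^ 2) * (volume.restrict Z).prod (volume.restrict U) s := by
    intro y s hs
    simp only [hκ, Measure.add_apply, Measure.smul_apply, smul_eq_mul]
    rw [Measure.map_apply measurable_prodMk_left hs]
  have hms : ∀ s : Set (ℝ × ℝ), MeasurableSet s → Measurable fun y : ℝ => volume.restrict U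
    (Prod.mk y ⁻¹' s) :=
    fun s hs => measurable_measure_prodMk_left hs
  have hmain := eLpNorm_le_of_enorm_le_lintegral (lam := volume.restrict I)
    (μ := cellMeasure k n i) (E := fun y => phi y ^ r * (F y - P.eval y))
    (g := weightedFd k r F) κ (c₁ := ENNReal.ofReal (2 * k + 2 ^ r * Cw * (2 * k ^ 2)))
    (c₂ := ENNReal.ofReal (1 + 2 ^ r * Cw)) ?_ ?_ ?_ ENNReal.ofReal_ne_top ENNReal.ofReal_ne_top
    (measurable_weightedFd k r hF) ?_ hp
  · refine hmain.trans (mul_le_mul' (max_le ?_ ?_) le_rfl) <;>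
    · refine ENNReal.ofReal_le_ofReal ?_
      have h1 : 0 ≤ 2 ^ r * Cw := by positivity
      have h2 : 0 ≤ 2 ^ r * Cw * (2 * (k : ℝ) ^ 2) := by positivity
      linarith
  · refine Filter.Eventually.of_forall fun y => ?_
    rw [hκs y _ MeasurableSet.univ, preimage_univ, Measure.restrict_apply_univ, hvU,
      ← univ_prod_univ, Measure.prod_prod, Measure.restrict_apply_univ,
      Measure.restrict_apply_univ, hvU, hvZ, ← ENNReal.ofReal_mul (by positivity),
      ← ENNReal.ofReal_mul (by positivity), ← ENNReal.ofReal_mul (by positivity),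
      ← ENNReal.ofReal_add (by positivity) (by positivity)]
    refine (congrArg ENNReal.ofReal ?_).le
    field_simp
  · intro s hs
    simp_rw [hκs _ s hs]
    rw [lintegral_add_right _ measurable_const, lintegral_const, Measure.restrict_apply_univ, hvI,
      lintegral_const_mul _ (hms s hs), ← Measure.prod_apply hs]
    have e1 : cellMeasure k n i s = ENNReal.ofReal (1 / H) *
      (volume.restrict Y).prod (volume.restrict U) s := rfl
    set M := (volume.restrict Y).prod (volume.restrict U) s with hM
    have h1 : (volume.restrict I).prod (volume.restrict U) s ≤ M := prod_restrict_mono hIY s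
    have h2 : (volume.restrict Z).prod (volume.restrict U) s ≤ M := prod_restrict_mono hZY s
    rw [e1]
    calc _ ≤ ENNReal.ofReal (1 / H) * M +
          ENNReal.ofReal (2 ^ r * Cw / H ^ 2) * M * ENNReal.ofReal H :=
        add_le_add (mul_le_mul' le_rfl h1) (mul_le_mul' (mul_le_mul' le_rfl h2) le_rfl)
      _ = ENNReal.ofReal (1 / H) * M + ENNReal.ofReal (2 ^ r * Cw / H ^ 2 * H) * M := by
        rw [ENNReal.ofReal_mul (by positivity)]; ring
      _ = _ := by
        rw [← mul_assoc, ← ENNReal.ofReal_mul (by positivity), ← add_mul,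
          ← ENNReal.ofReal_add (by positivity) (by positivity)]
        congr 2
        field_simp
  · intro s hs
    simp_rw [hκs _ s hs]
    exact ((hms s hs).const_mul _).add_const _
  · rw [ae_restrict_iff' measurableSet_Icc]
    refine Filter.Eventually.of_forall fun y hy => ?_
    have hgm : Measurable fun q => ‖weightedFd k r F q‖ₑ := (measurable_weightedFd k r hF).enorm
    have hI1 : ∫⁻ q, ‖weightedFd k r F q‖ₑ ∂κ y =
        ENNReal.ofReal (1 / H) * (∫⁻ u in U, ‖weightedFd k r F (y, u)‖ₑ) +
        ENNReal.ofReal (2 ^ r * Cw / H ^ 2) * ∫⁻ u in U, ∫⁻ z in Z, ‖weightedFd k r F (z, u)‖ₑ := by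
      simp only [hκ]
      rw [lintegral_add_measure, lintegral_smul_measure, lintegral_smul_measure,
        lintegral_map hgm measurable_prodMk_left, lintegral_prod_symm _ hgm.aemeasurable,
        smul_eq_mul, smul_eq_mul]
    rw [hI1, enorm_mul]
    refine (mul_le_mul' le_rfl (hPF y hy)).trans ?_
    rw [mul_add]
    refine add_le_add ?_ ?_
    · simp only [weightedFd, enorm_mul]
      rw [lintegral_const_mul' _ _ (by simp), mul_left_comm]
    · have hin : ∀ u, ‖phi y ^ r‖ₑ * ∫⁻ z in Z, ‖fd k u F z‖ₑ ≤
          ENNReal.ofReal (2 ^ r) * ∫⁻ z in Z, ‖weightedFd k r F (z, u)‖ₑ := by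
        intro u
        rw [← lintegral_const_mul' _ _ (by simp), ← lintegral_const_mul' _ _ (by simp)]
        refine setLIntegral_mono' measurableSet_Icc fun z hz => ?_
        simp only [weightedFd, enorm_mul]
        rw [← mul_assoc]
        refine mul_le_mul' ?_ le_rfl
        rw [Real.enorm_of_nonneg (pow_nonneg (phi_nonneg _) _),
          Real.enorm_of_nonneg (pow_nonneg (phi_nonneg _) _), ← ENNReal.ofReal_mul (by positivity),
          ← mul_pow]
        refine ENNReal.ofReal_le_ofReal (pow_le_pow_left₀ (phi_nonneg _) ?_ r)
        refine phi_le_two_mul_phi (ha1.trans hy.1) (hy.2.trans hz.1) (hz.2.trans ?_)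
        have : 0 ≤ (k : ℝ) * (2 * k + 1) * H := by positivity
        linarith
      calc _ = ENNReal.ofReal (Cw / H ^ 2) *
            ∫⁻ u in U, ‖phi y ^ r‖ₑ * ∫⁻ z in Z, ‖fd k u F z‖ₑ := by
            rw [lintegral_const_mul' _ _ (by simp), mul_left_comm]
        _ ≤ ENNReal.ofReal (Cw / H ^ 2) *
            ∫⁻ u in U, ENNReal.ofReal (2 ^ r) * ∫⁻ z in Z, ‖weightedFd k r F (z, u)‖ₑ :=
            mul_le_mul' le_rfl (lintegral_mono hin)
        _ = _ := by
            rw [lintegral_const_mul' _ _ (by simp), ← mul_assoc,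
              ← ENNReal.ofReal_mul (by positivity)]
            congr 2
            ring

/-! ### The quadratically graded partition of `[-1, 1]` -/

/-- The nodes of a partition of `[-1, 1]` into `2n` intervals which is symmetric about `0` and
quadratically graded towards both end points. -/
noncomputable def node (n j : ℕ) : ℝ := ((j : ℝ) / n - 1) * (2 - |(j : ℝ) / n - 1|)

theorem node_eq {n j : ℕ} (hj : j ≤ n) : node n j = -1 + ((j : ℝ) / n) ^ 2 := by
  have h1 : (j : ℝ) / n ≤ 1 := div_le_one_of_le₀ (by exact_mod_cast hj) (Nat.cast_nonneg n)
  rw [node, abs_of_nonpos (by linarith)]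
  ring

theorem node_le (n j : ℕ) : node n j ≤ -1 + ((j : ℝ) / n) ^ 2 := by
  rw [node]
  set s := (j : ℝ) / n - 1
  have : (j : ℝ) / n = s + 1 := by ring
  rw [this]
  nlinarith [abs_mul_abs_self s, abs_nonneg s, neg_abs_le s, le_abs_self s]

theorem node_reflect {n j : ℕ} (hn : 0 < n) (hj : j ≤ 2 * n) : node n (2 * n - j) = -node n j := by
  have h0 : (n : ℝ) ≠ 0 := by exact_mod_cast hn.ne'
  have h1 : ((2 * n - j : ℕ) : ℝ) / n - 1 = -((j : ℝ) / n - 1) := by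
    rw [Nat.cast_sub hj]; push_cast; field_simp; ring
  rw [node, node, h1, abs_neg]
  ring

theorem node_lt_node_succ {n j : ℕ} (hj : j < 2 * n) : node n j < node n (j + 1) := by
  have hn : 0 < n := by omega
  have h0 : (0 : ℝ) < n := by exact_mod_cast hn
  have key : ∀ i : ℕ, i + 1 ≤ n → node n i < node n (i + 1) := by
    intro i hi
    rw [node_eq hi, node_eq (by omega)]
    have : (i : ℝ) / n < ((i + 1 : ℕ) : ℝ) / n := by
      refine div_lt_div_of_pos_right ?_ h0
      push_cast; linarith
    have h2 : 0 ≤ (i : ℝ) / n := by positivity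
    nlinarith
  rcases Nat.lt_or_ge j n with h | h
  · exact key j h
  · have h1 := key (2 * n - 1 - j) (by omega)
    rw [show 2 * n - 1 - j + 1 = 2 * n - j by omega, node_reflect hn hj.le,
      show 2 * n - 1 - j = 2 * n - (j + 1) by omega, node_reflect hn (by omega)] at h1
    linarith

theorem node_zero {n : ℕ} : node n 0 = -1 := by rw [node_eq (Nat.zero_le n)]; simp

theorem node_two_mul {n : ℕ} (hn : 0 < n) : node n (2 * n) = 1 := by
  have := node_reflect (j := 0) hn (Nat.zero_le _)
  rw [Nat.sub_zero, node_zero] at this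
  linarith

theorem volume_restrict_Icc_le_sum (x : ℕ → ℝ) (N : ℕ) :
    (volume : Measure ℝ).restrict (Icc (x 0) (x N)) ≤
      ∑ j ∈ Finset.range N, volume.restrict (Icc (x j) (x (j + 1))) := by
  induction N with
  | zero => simp
  | succ N ih =>
    rw [Finset.sum_range_succ]
    refine (Measure.restrict_mono (Icc_subset_Icc_union_Icc (b := x N)) le_rfl).trans ?_
    exact (Measure.restrict_union_le _ _).trans (add_le_add ih le_rfl)

/-- The intervals of the partition on both sides of the node `j ≤ n` lie in the cell `j - 1`, so
that the approximation on one cell serves on two neighbouring intervals. For `j = 0` the truncated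
`j - 1 = 0` is intended: the first two nodes share the first cell. -/
theorem cell_subset {n j l : ℕ} (hn : 0 < n) (hj : j ≤ n) (hjl : j = l ∨ j = l + 1) :
    Icc (node n l) (node n (l + 1)) ⊆
      Icc (cellLeft n (j - 1)) (cellLeft n (j - 1) + cellStep n (j - 1)) := by
  have h0 : (0 : ℝ) < n := by exact_mod_cast hn
  refine Icc_subset_Icc ?_ ?_
  · rw [node_eq (by omega), cellLeft]
    have : ((j - 1 : ℕ) : ℝ) ≤ l := by exact_mod_cast (by omega : j - 1 ≤ l)
    gcongr
  · rw [cellLeft_add_cellStep hn]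
    refine (node_le n _).trans ?_
    have : ((l + 1 : ℕ) : ℝ) ≤ (j - 1 : ℕ) + 2 := by exact_mod_cast (by omega : l + 1 ≤ j - 1 + 2)
    gcongr

/-- On the intervals which do not touch `±1` the weight is essentially constant and at most `n`
times the length of the interval. -/
theorem phi_le_on_cell {n l : ℕ} (hl : 1 ≤ l) (hl2 : l + 1 < 2 * n) {y z : ℝ}
    (hy : y ∈ Icc (node n l) (node n (l + 1))) (hz : z ∈ Icc (node n l) (node n (l + 1))) :
    phi y ≤ 3 * phi z ∧ phi y ≤ n * (node n (l + 1) - node n l) := by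
  have hn : 0 < n := by omega
  have h0 : (0 : ℝ) < n := by exact_mod_cast hn
  have key : ∀ i : ℕ, 1 ≤ i → i + 1 ≤ n → ∀ y z : ℝ, y ∈ Icc (node n i) (node n (i + 1)) →
      z ∈ Icc (node n i) (node n (i + 1)) →
      phi y ≤ 3 * phi z ∧ phi y ≤ n * (node n (i + 1) - node n i) := by
    intro i hi hin y z hy hz
    have hi1 : (1 : ℝ) ≤ i := by exact_mod_cast hi
    have hin' : (i : ℝ) + 1 ≤ n := by exact_mod_cast hin
    rw [node_eq hin, node_eq (show i ≤ n by omega)] at hy hz ⊢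
    push_cast at hy hz ⊢
    set s := (1 : ℝ) / n with hs
    have hs0 : 0 < s := by positivity
    have e1 : (i : ℝ) / n = i * s := by rw [hs]; ring
    have e2 : ((i : ℝ) + 1) / n = (i + 1) * s := by rw [hs]; ring
    have hns : n * s = 1 := by rw [hs]; field_simp
    rw [e1, e2] at hy hz ⊢
    have hs1 : ((i : ℝ) + 1) * s ≤ 1 := by rw [← e2]; exact div_le_one_of_le₀ hin' h0.le
    have hs2 : (((i : ℝ) + 1) * s) ^ 2 ≤ 1 := pow_le_one₀ (by positivity) hs1
    have hy0 : y ≤ 0 := by linarith [hy.2]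
    have hz0 : z ≤ 0 := by linarith [hz.2]
    have hy1 : -1 ≤ y := by nlinarith [hy.1, sq_nonneg ((i : ℝ) * s)]
    have hz1 : -1 ≤ z := by nlinarith [hz.1, sq_nonneg ((i : ℝ) * s)]
    have hpy := phi_sq (abs_le.2 ⟨hy1, by linarith⟩)
    have hpz := phi_sq (abs_le.2 ⟨hz1, by linarith⟩)
    have hyb : phi y ^ 2 ≤ 2 * (((i : ℝ) + 1) * s) ^ 2 := by rw [hpy]; nlinarith [hy.2]
    have hzb : ((i : ℝ) * s) ^ 2 ≤ phi z ^ 2 := by rw [hpz]; nlinarith [hz.1]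
    constructor
    · refine abs_le_of_sq_le_sq' ?_ (by have := phi_nonneg z; positivity) |>.2
      have : (((i : ℝ) + 1) * s) ^ 2 ≤ 4 * ((i : ℝ) * s) ^ 2 := by
        rw [mul_pow, mul_pow, ← mul_assoc]
        refine mul_le_mul_of_nonneg_right ?_ (by positivity)
        nlinarith
      nlinarith [sq_nonneg ((i : ℝ) * s)]
    · have e3 : (n : ℝ) * (-1 + (((i : ℝ) + 1) * s) ^ 2 - (-1 + ((i : ℝ) * s) ^ 2)) =
          (2 * i + 1) * s := by
        have : (n : ℝ) * (-1 + (((i : ℝ) + 1) * s) ^ 2 - (-1 + ((i : ℝ) * s) ^ 2)) =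
          (2 * i + 1) * s * (n * s) := by ring
        rw [this, hns, mul_one]
      rw [e3]
      refine abs_le_of_sq_le_sq' (hyb.trans ?_) (by positivity) |>.2
      rw [mul_pow, mul_pow, ← mul_assoc]
      refine mul_le_mul_of_nonneg_right ?_ (by positivity)
      nlinarith
  rcases Nat.lt_or_ge l n with h | h
  · exact key l hl h y z hy hz
  · have e1 : node n (2 * n - 1 - l + 1) = -node n l := by
      rw [show 2 * n - 1 - l + 1 = 2 * n - l by omega, node_reflect hn (by omega)]
    have e2 : node n (2 * n - 1 - l) = -node n (l + 1) := by
      rw [show 2 * n - 1 - l = 2 * n - (l + 1) by omega, node_reflect hn (by omega)]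
    have h1 := key (2 * n - 1 - l) (by omega) (by omega) (-y) (-z)
      (by rw [e1, e2]; exact ⟨by linarith [hy.2], by linarith [hy.1]⟩)
      (by rw [e1, e2]; exact ⟨by linarith [hz.2], by linarith [hz.1]⟩)
    rw [e1, e2, phi_neg, phi_neg] at h1
    exact ⟨h1.1, by linarith [h1.2]⟩

/-- Every index occurs a bounded number of times when two families are joined at the middle of
the partition. -/
theorem sum_adjacent_le {n : ℕ} (hn : 0 < n) (a b : ℕ → ℝ≥0∞) :
    ∑ l ∈ Finset.range (2 * n),
      ((if l ≤ n then a (l - 1) else b (2 * n - l - 1)) +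
        (if l + 1 ≤ n then a (l + 1 - 1) else b (2 * n - (l + 1) - 1))) ≤
      4 * (∑ i ∈ Finset.range n, a i + ∑ i ∈ Finset.range n, b i) := by
  set ν : ℕ → ℝ≥0∞ := fun l => if l ≤ n then a (l - 1) else b (2 * n - l - 1) with hν
  change ∑ l ∈ Finset.range (2 * n), (ν l + ν (l + 1)) ≤ _
  have h1 : ∑ l ∈ Finset.range (2 * n), ν l ≤ ∑ l ∈ Finset.range (n + 1 + n), ν l :=
    Finset.sum_le_sum_of_subset (Finset.range_mono (by omega))
  have h2 : ∑ l ∈ Finset.range (2 * n), ν (l + 1) ≤ ∑ l ∈ Finset.range (n + 1 + n), ν l := by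
    rw [show n + 1 + n = 2 * n + 1 by omega, Finset.sum_range_succ']
    exact le_self_add
  have hpred : ∀ c : ℕ → ℝ≥0∞, ∑ i ∈ Finset.range n, c (i - 1) ≤ 2 * ∑ i ∈ Finset.range n, c i := by
    intro c
    obtain ⟨n', rfl⟩ : ∃ n', n = n' + 1 := ⟨n - 1, by omega⟩
    rw [Finset.sum_range_succ', two_mul]
    refine add_le_add ?_ ?_
    · exact Finset.sum_le_sum_of_subset (f := c) (Finset.range_mono (Nat.le_succ n'))
    · exact Finset.single_le_sum (f := c) (fun _ _ => zero_le) (Finset.mem_range.2 hn)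
  have h3 : ∑ l ∈ Finset.range (n + 1 + n), ν l ≤
      2 * (∑ i ∈ Finset.range n, a i + ∑ i ∈ Finset.range n, b i) := by
    rw [Finset.sum_range_add, mul_add]
    refine add_le_add ?_ ?_
    · rw [Finset.sum_range_succ', two_mul]
      refine add_le_add (le_of_eq ?_) ?_
      · refine Finset.sum_congr rfl fun i hi => ?_
        simp only [hν]
        rw [if_pos (by have := Finset.mem_range.1 hi; omega)]
        rfl
      · simp only [hν]
        rw [if_pos (Nat.zero_le _)]
        exact Finset.single_le_sum (f := a) (fun _ _ => zero_le) (Finset.mem_range.2 hn)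
    · refine le_trans (le_of_eq ?_) (hpred b)
      rw [← Finset.sum_range_reflect (fun i => b (i - 1))]
      refine Finset.sum_congr rfl fun i hi => ?_
      simp only [hν]
      rw [if_neg (by omega)]
      congr 1
      omega
  rw [Finset.sum_add_distrib]
  refine (add_le_add (h1.trans h3) (h2.trans h3)).trans (le_of_eq ?_)
  ring

/-! ### The competitor in the `K`-functional -/

theorem weightedFd_comp_neg (k r : ℕ) (F : ℝ → ℝ) (q : ℝ × ℝ) :
    weightedFd k r (fun x => F (-x)) q = weightedFd k r F (-q) := by
  simp only [weightedFd, Prod.fst_neg, Prod.snd_neg, phi_neg, fd_comp_neg]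

theorem eLpNorm_weightedFd_map_neg (k r : ℕ) {F : ℝ → ℝ} (hF : Measurable F) (p : ℝ≥0∞)
    (μ : Measure (ℝ × ℝ)) : eLpNorm (weightedFd k r F) p (μ.map fun q => -q) =
      eLpNorm (weightedFd k r fun x => F (-x)) p μ := by
  rw [eLpNorm_map_measure (measurable_weightedFd k r hF).aestronglyMeasurable
    measurable_neg.aemeasurable]
  congr 1
  funext q
  exact (weightedFd_comp_neg k r F q).symm

theorem integrable_comp_neg_mul_phi {F : ℝ → ℝ} (hF : Measurable F) {r : ℕ}
    (hint : Integrable (fun x => F x * phi x ^ r) (volume.restrict (Icc (-1 : ℝ) 1))) :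
    Integrable (fun x => F (-x) * phi x ^ r) (volume.restrict (Icc (-1 : ℝ) 1)) := by
  rw [← memLp_one_iff_integrable] at hint ⊢
  refine ⟨((hF.comp measurable_neg).mul (measurable_phi.pow_const r)).aestronglyMeasurable, ?_⟩
  have := normP_comp_neg 1 fun x => F x * phi x ^ r
  simp only [phi_neg] at this
  unfold normP at this
  rw [this]
  exact hint.2

/-- The weighted derivative of order `k = m + 1` of the glued function inside one interval of the
partition. On the first and the last interval, where the weight is not essentially constant, nothing
is glued. -/
theorem exists_enorm_iteratedDeriv_glue_le (m r : ℕ) : ∃ C : ℝ, 0 < C ∧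
    ∀ n l : ℕ, l < 2 * n → ∀ P : ℕ → Polynomial ℝ, (∀ j, P j ∈ Polynomial.degreeLT ℝ (m + 1)) →
      (l = 0 ∨ l + 1 = 2 * n → P (l + 1) = P l) → ∀ y ∈ Ioo (node n l) (node n (l + 1)),
        ‖iteratedDeriv (m + 1) (glue (2 * n) (node n) P) y * phi y ^ (m + 1 + r)‖ₑ ≤
          ENNReal.ofReal (C * (n : ℝ) ^ (m + 1)) * ∫⁻ z in Icc (node n l) (node n (l + 1)),
            ENNReal.ofReal (1 / (node n (l + 1) - node n l)) *
              ‖phi z ^ r * (P (l + 1) - P l).eval z‖ₑ := by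
  obtain ⟨C, hC, hbump⟩ := exists_iteratedDeriv_stepFun_mul_le m
  refine ⟨C * 3 ^ r, by positivity, fun n l hl P hP hend y hy => ?_⟩
  rw [iteratedDeriv_glue_eq (x := node n) (fun i hi => node_lt_node_succ hi) hP hl hy]
  set a := node n l with ha
  set b := node n (l + 1) with hb
  set Q := P (l + 1) - P l with hQ
  have hd : 0 < b - a := sub_pos.2 (node_lt_node_succ hl)
  by_cases hl' : l = 0 ∨ l + 1 = 2 * n
  · have : Q = 0 := by rw [hQ, hend hl', sub_self]
    rw [this]
    simp
  push Not at hl'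
  have hl1 : 1 ≤ l := Nat.one_le_iff_ne_zero.2 hl'.1
  have hl2 : l + 1 < 2 * n := lt_of_le_of_ne hl hl'.2
  have h1 := hbump Q (Submodule.sub_mem _ (hP _) (hP _)) a (b - a) hd y
    ⟨hy.1.le, by linarith [hy.2]⟩
  rw [add_sub_cancel] at h1
  have h2 : ENNReal.ofReal (∫ x in a..b, |Q.eval x|) ≤ ∫⁻ z in Icc a b, ‖Q.eval z‖ₑ := by
    have h3 : 0 ≤ ∫ x in a..b, |Q.eval x| :=
      intervalIntegral.integral_nonneg (by linarith) fun _ _ => abs_nonneg _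
    rw [← Real.enorm_of_nonneg h3]
    refine (enorm_intervalIntegral_le _ _ _).trans ?_
    rw [uIoc_of_le (by linarith)]
    refine (lintegral_mono_set Ioc_subset_Icc_self).trans (lintegral_mono fun z => ?_)
    rw [← Real.norm_eq_abs, enorm_norm]
  set D := iteratedDeriv (m + 1) (fun y => stepFun a (b - a) y * Q.eval y) y
  have hD : ‖D‖ₑ ≤ ENNReal.ofReal (C * ((b - a)⁻¹) ^ (m + 2)) * ∫⁻ z in Icc a b, ‖Q.eval z‖ₑ := by
    rw [← ofReal_norm, Real.norm_eq_abs]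
    refine (ENNReal.ofReal_le_ofReal h1).trans ?_
    rw [ENNReal.ofReal_mul (by positivity)]
    exact mul_le_mul' le_rfl h2
  rw [enorm_mul]
  have hphi : ∀ z ∈ Icc a b, ‖phi y ^ (m + 1 + r)‖ₑ * ‖Q.eval z‖ₑ ≤
      ENNReal.ofReal ((n * (b - a)) ^ (m + 1) * 3 ^ r) * ‖phi z ^ r * Q.eval z‖ₑ := by
    intro z hz
    obtain ⟨h3, h4⟩ := phi_le_on_cell hl1 hl2 (Ioo_subset_Icc_self hy) hz
    rw [enorm_mul, ← mul_assoc]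
    refine mul_le_mul' ?_ le_rfl
    rw [Real.enorm_of_nonneg (pow_nonneg (phi_nonneg _) _),
      Real.enorm_of_nonneg (pow_nonneg (phi_nonneg _) _), ← ENNReal.ofReal_mul (by positivity)]
    refine ENNReal.ofReal_le_ofReal ?_
    rw [pow_add, mul_assoc, ← mul_pow]
    exact mul_le_mul (pow_le_pow_left₀ (phi_nonneg _) h4 _) (pow_le_pow_left₀ (phi_nonneg _) h3 _)
      (pow_nonneg (phi_nonneg _) _) (by positivity)
  calc ‖D‖ₑ * ‖phi y ^ (m + 1 + r)‖ₑ
      ≤ (ENNReal.ofReal (C * ((b - a)⁻¹) ^ (m + 2)) * ∫⁻ z in Icc a b, ‖Q.eval z‖ₑ) *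
          ‖phi y ^ (m + 1 + r)‖ₑ := mul_le_mul' hD le_rfl
    _ = ENNReal.ofReal (C * ((b - a)⁻¹) ^ (m + 2)) *
          ∫⁻ z in Icc a b, ‖phi y ^ (m + 1 + r)‖ₑ * ‖Q.eval z‖ₑ := by
        rw [lintegral_const_mul' _ _ (by simp)]; ring
    _ ≤ ENNReal.ofReal (C * ((b - a)⁻¹) ^ (m + 2)) * ∫⁻ z in Icc a b,
          ENNReal.ofReal ((n * (b - a)) ^ (m + 1) * 3 ^ r) * ‖phi z ^ r * Q.eval z‖ₑ :=
        mul_le_mul' le_rfl (setLIntegral_mono' measurableSet_Icc hphi)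
    _ = _ := by
        rw [lintegral_const_mul' _ _ (by simp), lintegral_const_mul' _ _ (by simp), ← mul_assoc,
          ← mul_assoc, ← ENNReal.ofReal_mul (by positivity), ← ENNReal.ofReal_mul (by positivity)]
        congr 2
        generalize b - a = e at hd
        rw [mul_pow, inv_pow]
        field_simp
        ring

/-- The glued function competes in the `K`-functional, and its error is controlled by the
differences of `F` and of its reflection over the cells of the left half. -/
theorem exists_KFunctional_le_eLpNorm_weightedFd (m r : ℕ) {p : ℝ≥0∞} (hp : 1 ≤ p) :
    ∃ C : ℝ≥0, ∀ F : ℝ → ℝ, Measurable F →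
      Integrable (fun x => F x * phi x ^ r) (volume.restrict (Icc (-1 : ℝ) 1)) →
      ∀ n : ℕ, 16 * (m + 1 + 1) ^ 2 ≤ n → ∀ t : ℝ, 0 < t →
        n * t ≤ 16 * ((m : ℝ) + 1 + 1) ^ 2 + 1 →
        KFunctional (m + 1) r p F (t ^ (m + 1)) ≤
          C * (eLpNorm (weightedFd (m + 1) r F) p (leftMeasure (m + 1) n) +
            eLpNorm (weightedFd (m + 1) r fun x => F (-x)) p (leftMeasure (m + 1) n)) := by
  obtain ⟨C₁, hC₁⟩ := exists_polynomial_eLpNorm_cell_le m r hp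
  obtain ⟨C₂, hC₂, hder⟩ := exists_enorm_iteratedDeriv_glue_le m r
  set T : ℝ := 16 * ((m : ℝ) + 1 + 1) ^ 2 + 1 with hT
  refine ⟨(2 * C₁) * 4 + Real.toNNReal (C₂ * T ^ (m + 1)) * ((2 * C₁) * 4),
    fun F hF hFi n hn t ht hnt => ?_⟩
  have hn0 : 0 < n := by nlinarith [Nat.zero_le m]
  have hn1 : 1 < n := by nlinarith [Nat.zero_le m]
  set F' : ℝ → ℝ := fun x => F (-x) with hF'
  have hF'm : Measurable F' := hF.comp measurable_neg
  have hPL : ∀ i : ℕ, ∃ P ∈ Polynomial.degreeLT ℝ (m + 1), i < n →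
      eLpNorm (fun y => phi y ^ r * (F y - P.eval y)) p
        (volume.restrict (Icc (cellLeft n i) (cellLeft n i + cellStep n i))) ≤
      C₁ * eLpNorm (weightedFd (m + 1) r F) p (cellMeasure (m + 1) n i) := fun i => by
    by_cases hi : i < n
    · obtain ⟨P, hP, h⟩ := hC₁ F hF hFi n i hn hi
      exact ⟨P, hP, fun _ => h⟩
    · exact ⟨0, Submodule.zero_mem _, fun h => absurd h hi⟩
  have hPR : ∀ i : ℕ, ∃ P ∈ Polynomial.degreeLT ℝ (m + 1), i < n →
      eLpNorm (fun y => phi y ^ r * (F' y - P.eval y)) p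
        (volume.restrict (Icc (cellLeft n i) (cellLeft n i + cellStep n i))) ≤
      C₁ * eLpNorm (weightedFd (m + 1) r F') p (cellMeasure (m + 1) n i) := fun i => by
    by_cases hi : i < n
    · obtain ⟨P, hP, h⟩ := hC₁ F' hF'm (integrable_comp_neg_mul_phi hF hFi) n i hn hi
      exact ⟨P, hP, fun _ => h⟩
    · exact ⟨0, Submodule.zero_mem _, fun h => absurd h hi⟩
  choose PL hPLd hPL using hPL
  choose PR hPRd hPR using hPR
  -- Polynomials attached to the nodes, obtained by reflection on the right half.
  set P : ℕ → Polynomial ℝ := fun j =>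
    if j ≤ n then PL (j - 1) else (PR (2 * n - j - 1)).comp (-Polynomial.X) with hP
  have hPd : ∀ j, P j ∈ Polynomial.degreeLT ℝ (m + 1) := by
    intro j
    simp only [hP]
    split_ifs
    · exact hPLd _
    · exact comp_mem_degreeLT (hPRd _) (by rw [Polynomial.natDegree_neg, Polynomial.natDegree_X])
  -- The measure which controls the polynomial attached to the node `j`.
  set ν : ℕ → Measure (ℝ × ℝ) := fun j =>
    if j ≤ n then cellMeasure (m + 1) n (j - 1)
    else (cellMeasure (m + 1) n (2 * n - j - 1)).map fun q => -q with hν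
  set Λ : Measure (ℝ × ℝ) := leftMeasure (m + 1) n + (leftMeasure (m + 1) n).map fun q => -q with hΛ
  set Φ := weightedFd (m + 1) r F with hΦ
  set lam : ℕ → Measure ℝ := fun l => volume.restrict (Icc (node n l) (node n (l + 1))) with hlam
  set γ : ℕ → Measure (ℝ × ℝ) := fun l => ν l + ν (l + 1) with hγ
  have hapx : ∀ l < 2 * n, ∀ j, j = l ∨ j = l + 1 →
      eLpNorm (fun y => phi y ^ r * (F y - (P j).eval y)) p (lam l) ≤ C₁ * eLpNorm Φ p (ν j) := by
    intro l hl j hj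
    by_cases hjn : j ≤ n
    · simp only [hP, hν, if_pos hjn]
      exact (eLpNorm_mono_measure _ (Measure.restrict_mono (cell_subset hn0 hjn hj) le_rfl)).trans
        (hPL _ (by omega))
    · simp only [hP, hν, if_neg hjn]
      rw [hΦ, eLpNorm_weightedFd_map_neg _ _ hF]
      have hset : Icc (node n l) (node n (l + 1)) =
          -Icc (node n (2 * n - 1 - l)) (node n (2 * n - 1 - l + 1)) := by
        rw [Set.neg_Icc, show 2 * n - 1 - l + 1 = 2 * n - l by omega,
          show 2 * n - 1 - l = 2 * n - (l + 1) by omega, node_reflect hn0 (by omega),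
          node_reflect hn0 (by omega), neg_neg, neg_neg]
      have h1 := eLpNorm_restrict_neg
        (fun y => phi y ^ r * (F' y - (PR (2 * n - j - 1)).eval y))
        (Icc (node n (2 * n - 1 - l)) (node n (2 * n - 1 - l + 1))) p
      simp only [hF', phi_neg, neg_neg] at h1
      simp only [hlam, Polynomial.eval_comp, Polynomial.eval_neg, Polynomial.eval_X]
      rw [hset, h1]
      exact (eLpNorm_mono_measure _ (Measure.restrict_mono (cell_subset (j := 2 * n - j) hn0
        (by omega) (by omega)) le_rfl)).trans (hPR _ (by omega))
  have hγΛ : ∑ l ∈ Finset.range (2 * n), γ l ≤ (4 : ℝ≥0∞) • Λ := by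
    refine Measure.le_intro fun s hs _ => ?_
    have h1 := sum_adjacent_le hn0 (fun i => cellMeasure (m + 1) n i s)
      (fun i => (cellMeasure (m + 1) n i).map (fun q => -q) s)
    have h2 : Λ s = ∑ i ∈ Finset.range n, cellMeasure (m + 1) n i s +
        ∑ i ∈ Finset.range n, (cellMeasure (m + 1) n i).map (fun q => -q) s := by
      rw [hΛ, Measure.add_apply, Measure.map_apply measurable_neg hs, leftMeasure,
        Measure.finsetSum_apply, Measure.finsetSum_apply]
      congr 1
      exact Finset.sum_congr rfl fun i _ => (Measure.map_apply measurable_neg hs).symm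
    rw [Measure.smul_apply, smul_eq_mul, h2, Measure.finsetSum_apply]
    refine le_trans (le_of_eq (Finset.sum_congr rfl fun l _ => ?_)) h1
    simp only [hγ, hν, Measure.add_apply]
    congr 1 <;> split_ifs <;> rfl
  have hΛle : eLpNorm Φ p Λ ≤ eLpNorm Φ p (leftMeasure (m + 1) n) +
      eLpNorm (weightedFd (m + 1) r F') p (leftMeasure (m + 1) n) := by
    refine (eLpNorm_add_measure_le _ hp _ _).trans (add_le_add le_rfl ?_)
    rw [hΦ, eLpNorm_weightedFd_map_neg _ _ hF]
  have hvol : (volume : Measure ℝ).restrict (Icc (-1) 1) ≤ ∑ l ∈ Finset.range (2 * n), lam l := by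
    have := volume_restrict_Icc_le_sum (node n) (2 * n)
    rwa [node_zero, node_two_mul hn0] at this
  have hnode : ∀ i < 2 * n, node n i < node n (i + 1) := fun i hi => node_lt_node_succ hi
  set G := glue (2 * n) (node n) P with hG
  have hcell : ∀ l < 2 * n, eLpNorm (fun y => phi y ^ r * (F y - (P l).eval y)) p (lam l) +
      eLpNorm (fun y => phi y ^ r * (F y - (P (l + 1)).eval y)) p (lam l) ≤
      ((2 * C₁ : ℝ≥0) : ℝ≥0∞) * eLpNorm Φ p (γ l) := by
    intro l hl
    have h1 : eLpNorm Φ p (ν l) ≤ eLpNorm Φ p (γ l) :=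
      eLpNorm_mono_measure _ (Measure.le_add_right le_rfl)
    have h2 : eLpNorm Φ p (ν (l + 1)) ≤ eLpNorm Φ p (γ l) :=
      eLpNorm_mono_measure _ (Measure.le_add_left le_rfl)
    refine (add_le_add ((hapx l hl l (Or.inl rfl)).trans (mul_le_mul' le_rfl h1))
      ((hapx l hl (l + 1) (Or.inr rfl)).trans (mul_le_mul' le_rfl h2))).trans_eq ?_
    push_cast
    ring
  have hmeas : ∀ j l, AEStronglyMeasurable (fun y => phi y ^ r * (F y - (P j).eval y)) (lam l) :=
    fun j l => ((measurable_phi.pow_const r).mul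
      (hF.sub (P j).continuous.measurable)).aestronglyMeasurable
  have hterm1 : normP p (fun x => (F x - G x) * phi x ^ r) ≤
      ((2 * C₁ : ℝ≥0) : ℝ≥0∞) * 4 * eLpNorm Φ p Λ := by
    refine (eLpNorm_mono_measure _ hvol).trans
      (eLpNorm_sum_measure_le _ (by norm_num) hγΛ hp fun l hl => ?_)
    have hl := Finset.mem_range.1 hl
    refine le_trans ?_ (hcell l hl)
    refine le_trans ?_ ((eLpNorm_add_le (hmeas l l).norm (hmeas (l + 1) l).norm hp).trans_eq ?_)
    · refine eLpNorm_mono_ae_real ((ae_restrict_iff' measurableSet_Icc).2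
        (Filter.Eventually.of_forall fun y hy => ?_))
      have := abs_sub_glue_le hnode P hl hy (F y)
      rw [Pi.add_apply, norm_mul, norm_mul, norm_mul, ← mul_add, mul_comm]
      exact mul_le_mul_of_nonneg_left this (norm_nonneg _)
    · rw [eLpNorm_norm, eLpNorm_norm]
  have hterm2 : normP p (fun x => iteratedDeriv (m + 1) G x * phi x ^ (m + 1 + r)) ≤
      ENNReal.ofReal (C₂ * (n : ℝ) ^ (m + 1)) * ((2 * C₁ : ℝ≥0) : ℝ≥0∞) * 4 * eLpNorm Φ p Λ := by
    refine (eLpNorm_mono_measure _ hvol).trans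
      (eLpNorm_sum_measure_le _ (by norm_num) hγΛ hp fun l hl => ?_)
    have hl := Finset.mem_range.1 hl
    set d := node n (l + 1) - node n l with hd
    have hd0 : 0 < d := sub_pos.2 (node_lt_node_succ hl)
    have hone : ∫⁻ _z, ENNReal.ofReal (1 / d) ∂(lam l) ≤ 1 := by
      rw [lintegral_const, Measure.restrict_apply_univ, Real.volume_Icc, ← hd,
        ← ENNReal.ofReal_mul (by positivity), one_div_mul_cancel hd0.ne', ENNReal.ofReal_one]
    have hQm : Measurable fun z => phi z ^ r * (P (l + 1) - P l).eval z :=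
      (measurable_phi.pow_const r).mul (P (l + 1) - P l).continuous.measurable
    have hend : l = 0 ∨ l + 1 = 2 * n → P (l + 1) = P l := by
      rintro (h | h)
      · simp only [hP, h, Nat.zero_le, if_true]
        rw [if_pos (by omega)]
      · simp only [hP]
        rw [if_neg (by omega), if_neg (by omega), show 2 * n - (l + 1) - 1 = 2 * n - l - 1 by omega]
    have h1 : eLpNorm (fun x => iteratedDeriv (m + 1) G x * phi x ^ (m + 1 + r)) p (lam l) ≤
        ENNReal.ofReal (C₂ * (n : ℝ) ^ (m + 1)) * 1 *
          eLpNorm (fun z => phi z ^ r * (P (l + 1) - P l).eval z) p (lam l) := by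
      refine eLpNorm_le_mul_of_kernel (K := fun _ => ENNReal.ofReal (1 / d)) measurable_const
        ENNReal.ofReal_ne_top ENNReal.one_ne_top (Filter.Eventually.of_forall fun _ => hone)
        (Filter.Eventually.of_forall fun _ => hone) hQm ?_ hp
      simp only [hlam]
      rw [← Measure.restrict_congr_set (Ioo_ae_eq_Icc (a := node n l) (b := node n (l + 1))),
        ae_restrict_iff' measurableSet_Ioo]
      refine Filter.Eventually.of_forall fun y hy => ?_
      rw [Measure.restrict_congr_set (Ioo_ae_eq_Icc (a := node n l) (b := node n (l + 1)))]
      exact hder n l hl P hPd hend y hy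
    rw [mul_one] at h1
    rw [mul_assoc]
    refine h1.trans (mul_le_mul' le_rfl ((le_trans ?_ (hcell l hl))))
    have h2 : (fun z => phi z ^ r * (P (l + 1) - P l).eval z) =
        (fun y => phi y ^ r * (F y - (P l).eval y)) -
          fun y => phi y ^ r * (F y - (P (l + 1)).eval y) := by
      funext z
      rw [Pi.sub_apply, Polynomial.eval_sub]
      ring
    rw [h2]
    exact eLpNorm_sub_le (hmeas l l) (hmeas (l + 1) l) hp
  refine (KFunctional_le_of_contDiff (contDiff_glue (2 * n) (node n) P) (m + 1) r p F _).trans ?_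
  rw [← hG]
  refine (add_le_add hterm1 (mul_le_mul' le_rfl hterm2)).trans ?_
  -- The factor `n^k` from differentiating the transitions is compensated by `t^k`.
  have htn : ENNReal.ofReal (t ^ (m + 1)) * ENNReal.ofReal (C₂ * (n : ℝ) ^ (m + 1)) ≤
      ENNReal.ofReal (C₂ * T ^ (m + 1)) := by
    rw [← ENNReal.ofReal_mul (by positivity)]
    refine ENNReal.ofReal_le_ofReal ?_
    calc t ^ (m + 1) * (C₂ * (n : ℝ) ^ (m + 1)) = C₂ * (n * t) ^ (m + 1) := by rw [mul_pow]; ring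
      _ ≤ _ := by gcongr
  calc _ = ((2 * C₁ : ℝ≥0) : ℝ≥0∞) * 4 * eLpNorm Φ p Λ +
        (ENNReal.ofReal (t ^ (m + 1)) * ENNReal.ofReal (C₂ * (n : ℝ) ^ (m + 1))) *
          (((2 * C₁ : ℝ≥0) : ℝ≥0∞) * 4 * eLpNorm Φ p Λ) := by ring
    _ ≤ ((2 * C₁ : ℝ≥0) : ℝ≥0∞) * 4 * eLpNorm Φ p Λ + ENNReal.ofReal (C₂ * T ^ (m + 1)) *
          (((2 * C₁ : ℝ≥0) : ℝ≥0∞) * 4 * eLpNorm Φ p Λ) :=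
        add_le_add le_rfl (mul_le_mul' htn le_rfl)
    _ = (((2 * C₁) * 4 + Real.toNNReal (C₂ * T ^ (m + 1)) * ((2 * C₁) * 4) : ℝ≥0) : ℝ≥0∞) *
          eLpNorm Φ p Λ := by
        rw [ENNReal.ofReal]
        push_cast
        ring
    _ ≤ _ := mul_le_mul' le_rfl hΛle

/-! ### Relative step and centre of the differences -/

/-- A set which contains the centres of the differences which belong to the `i`-th cell. -/
def cellCenters (k n i : ℕ) : Set ℝ :=
  {x | (((i : ℝ) + 1) / n) ^ 2 ≤ 1 + x ∧ 1 + x ≤ (((i : ℝ) + 4 * (k + 1) ^ 2) / n) ^ 2 ∧ x ≤ 1 / 2}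

theorem measurableSet_cellCenters (k n i : ℕ) : MeasurableSet (cellCenters k n i) := by
  unfold cellCenters
  exact measurableSet_and (measurableSet_le (by fun_prop) (by fun_prop))
    (measurableSet_and (measurableSet_le (by fun_prop) (by fun_prop))
      (measurableSet_le (by fun_prop) (by fun_prop)))

/-- The passage from base point `y` and step `u` of a difference to its centre `x = y + ku/2` and
its relative step `u/φ(x)`, which comes first in the pair. -/
noncomputable def toCenter (k : ℕ) (q : ℝ × ℝ) : ℝ × ℝ :=
  (q.2 / phi (q.1 + k * q.2 / 2), q.1 + k * q.2 / 2)

theorem measurable_toCenter (k : ℕ) : Measurable (toCenter k) := by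
  unfold toCenter
  have h : Measurable fun q : ℝ × ℝ => q.1 + k * q.2 / 2 := by fun_prop
  exact (measurable_snd.div (measurable_phi.comp h)).prodMk h

section Geometry

variable {k n i : ℕ} {y u : ℝ}

theorem node_mem_of_mem_cell (hn : 16 * (k + 1) ^ 2 ≤ n) (hi : i < n) (hy : y ∈ cellBase k n i)
    (hu : u ∈ cellSteps k n i) : -1 ≤ y ∧ 0 < u ∧ y + k * u ≤ 1 / 2 := by
  have h := cell_reach_le hn hi
  have hk : (0 : ℝ) ≤ k := Nat.cast_nonneg k
  refine ⟨(neg_one_le_cellLeft n i).trans hy.1,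
    (cellStep_pos ((Nat.zero_le i).trans_lt hi) i).trans_le hu.1, ?_⟩
  have := mul_le_mul_of_nonneg_left hu.2 hk
  linarith [hy.2]

theorem center_mem_of_mem_cell (hk : 1 ≤ k) (hn : 16 * (k + 1) ^ 2 ≤ n) (hi : i < n)
    (hy : y ∈ cellBase k n i) (hu : u ∈ cellSteps k n i) :
    y + k * u / 2 ∈ cellCenters k n i := by
  obtain ⟨-, h2, h3⟩ := node_mem_of_mem_cell hn hi hy hu
  have hk1 : (1 : ℝ) ≤ k := by exact_mod_cast hk
  have hi0 : (0 : ℝ) ≤ i := Nat.cast_nonneg i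
  have hn0 : (0 : ℝ) < n := by exact_mod_cast (Nat.zero_le i).trans_lt hi
  obtain ⟨hy1, hy2⟩ := hy
  obtain ⟨hu1, hu2⟩ := hu
  set s := 1 / (n : ℝ) ^ 2 with hs
  have hs0 : 0 < s := by positivity
  have eH : cellStep n i = 4 * (i + 1) * s := by unfold cellStep; rw [hs]; ring
  have eL : cellLeft n i = -1 + (i : ℝ) ^ 2 * s := by unfold cellLeft; rw [hs, div_pow]; ring
  rw [eH, eL] at hy2
  rw [eL] at hy1
  rw [eH] at hu1 hu2
  refine ⟨?_, ?_, by nlinarith⟩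
  · have e : (((i : ℝ) + 1) / n) ^ 2 = ((i : ℝ) + 1) ^ 2 * s := by rw [hs, div_pow]; ring
    rw [e]
    have h4 : 2 * ((i : ℝ) + 1) * s ≤ k * u / 2 := by nlinarith
    nlinarith
  · have e : (((i : ℝ) + 4 * (k + 1) ^ 2) / n) ^ 2 = ((i : ℝ) + 4 * (k + 1) ^ 2) ^ 2 * s := by
      rw [hs, div_pow]; ring
    rw [e]
    have h4 : k * u / 2 ≤ k * ((2 * (k : ℝ) + 1) * (4 * (i + 1) * s)) / 2 := by gcongr
    have h5 : 1 + (y + k * u / 2) ≤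
        ((i : ℝ) ^ 2 + ((k : ℝ) + 1) * (4 * (i + 1)) + k * (2 * k + 1) * (2 * (i + 1))) * s := by
      nlinarith
    refine h5.trans (mul_le_mul_of_nonneg_right ?_ hs0.le)
    set B : ℝ := 4 * ((k : ℝ) + 1) ^ 2 with hB
    have h6 : ((k : ℝ) + 1) * 4 + k * (2 * k + 1) * 2 ≤ B := by rw [hB]; nlinarith
    have h7 : 1 ≤ B := by rw [hB]; nlinarith
    nlinarith [mul_le_mul_of_nonneg_right h6 (by linarith : (0 : ℝ) ≤ i + 1)]

theorem abs_lt_one_of_mem_cellCenters (hn : 0 < n) {x : ℝ} (hx : x ∈ cellCenters k n i) :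
    |x| < 1 := by
  obtain ⟨h1, -, h3⟩ := hx
  have hn0 : (0 : ℝ) < n := by exact_mod_cast hn
  have : 0 < (((i : ℝ) + 1) / n) ^ 2 := by positivity
  exact abs_lt.2 ⟨by linarith, by linarith⟩

/-- At the centres of the `i`-th cell the weight is comparable to `(i + 1)/n`. -/
theorem phi_bounds_of_mem_cellCenters (hn : 0 < n) {x : ℝ} (hx : x ∈ cellCenters k n i) :
    ((i : ℝ) + 1) / (2 * n) ≤ phi x ∧ phi x ≤ 8 * (k + 1) ^ 2 * ((i + 1) / n) := by
  have habs := (abs_lt_one_of_mem_cellCenters hn hx).le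
  obtain ⟨h1, h2, h3⟩ := hx
  have hn0 : (0 : ℝ) < n := by exact_mod_cast hn
  have hi0 : (0 : ℝ) ≤ i := Nat.cast_nonneg i
  have hk0 : (0 : ℝ) ≤ k := Nat.cast_nonneg k
  have hx1 : 0 ≤ 1 + x := by linarith [(abs_le.1 habs).1]
  constructor
  · refine abs_le_of_sq_le_sq' ?_ (phi_nonneg x) |>.2
    rw [phi_sq habs]
    have : (((i : ℝ) + 1) / (2 * n)) ^ 2 = (((i : ℝ) + 1) / n) ^ 2 / 4 := by
      rw [div_pow, div_pow, mul_pow]; ring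
    rw [this]
    nlinarith
  · refine abs_le_of_sq_le_sq' ?_ (by positivity) |>.2
    rw [phi_sq habs]
    set B : ℝ := 4 * ((k : ℝ) + 1) ^ 2 with hB
    have hB1 : 1 ≤ B := by rw [hB]; nlinarith
    have h4 : (((i : ℝ) + B) / n) ^ 2 ≤ (B * ((i + 1) / n)) ^ 2 := by
      refine pow_le_pow_left₀ (by positivity) ?_ 2
      rw [← mul_div_assoc]
      refine div_le_div_of_nonneg_right ?_ hn0.le
      nlinarith
    have e : (8 : ℝ) * (k + 1) ^ 2 * ((i + 1) / n) = 2 * (B * ((i + 1) / n)) := by rw [hB]; ring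
    rw [e, mul_pow]
    nlinarith [sq_nonneg (B * ((i + 1) / (n : ℝ)))]

/-- The relative steps which occur in the cells do not exceed `t`. -/
theorem step_div_phi_le (hn : 16 * (k + 1) ^ 2 ≤ n) {t : ℝ}
    (hnt : 16 * ((k : ℝ) + 1) ^ 2 ≤ n * t) {x : ℝ} (hx : x ∈ cellCenters k n i) :
    (2 * (k : ℝ) + 1) * cellStep n i / phi x ≤ t := by
  have hn' : 0 < n := by nlinarith [Nat.zero_le k]
  have hn0 : (0 : ℝ) < n := by exact_mod_cast hn'
  have hi0 : (0 : ℝ) ≤ i := Nat.cast_nonneg i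
  have hk0 : (0 : ℝ) ≤ k := Nat.cast_nonneg k
  obtain ⟨h1, -⟩ := phi_bounds_of_mem_cellCenters hn' hx
  have hp : 0 < phi x := lt_of_lt_of_le (by positivity) h1
  have ht : 16 * ((k : ℝ) + 1) ^ 2 / n ≤ t := by rw [div_le_iff₀ hn0]; linarith
  rw [div_le_iff₀ hp]
  calc (2 * (k : ℝ) + 1) * cellStep n i = (8 * (2 * (k : ℝ) + 1) / n) * ((i + 1) / (2 * n)) := by
        unfold cellStep; field_simp; ring
    _ ≤ (16 * ((k : ℝ) + 1) ^ 2 / n) * ((i + 1) / (2 * n)) := by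
        gcongr ?_ / _ * _
        nlinarith
    _ ≤ t * phi x := mul_le_mul ht h1 (by positivity) ((by positivity : (0 : ℝ) ≤ _).trans ht)

end Geometry

/-- Every point is a possible centre for at most `4(k + 1)²` cells. -/
theorem sum_restrict_cellCenters_le {k n : ℕ} (hn : 0 < n) (J : Finset ℕ) {S : Set ℝ}
    (hSm : MeasurableSet S) (hS : ∀ i ∈ J, cellCenters k n i ⊆ S) (g : ℝ → ℝ≥0∞) :
    ∑ i ∈ J, ∫⁻ x in cellCenters k n i, g x ≤ ((4 * (k + 1) ^ 2 : ℕ) : ℝ≥0∞) * ∫⁻ x in S, g x := by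
  classical
  have hn0 : (0 : ℝ) < n := by exact_mod_cast hn
  set B : ℕ := 4 * (k + 1) ^ 2 with hB
  have hcard : ∀ x, (J.filter fun i => x ∈ cellCenters k n i).card ≤ B := by
    intro x
    rcases (J.filter fun i => x ∈ cellCenters k n i).eq_empty_or_nonempty with h | h
    · rw [h]; simp
    set i₀ := (J.filter fun i => x ∈ cellCenters k n i).min' h with hi₀
    have hsub : (J.filter fun i => x ∈ cellCenters k n i) ⊆ Finset.Ico i₀ (i₀ + B) := by
      intro i hi
      have h0 : i₀ ≤ i := Finset.min'_le _ _ hi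
      have h1 := (Finset.mem_filter.1 hi).2.1
      have h2 := (Finset.mem_filter.1 (Finset.min'_mem _ h)).2.2.1
      rw [← hi₀] at h2
      have h3 := abs_le_of_sq_le_sq' (h1.trans h2) (by positivity) |>.2
      rw [div_le_div_iff_of_pos_right hn0] at h3
      have h4 : i + 1 ≤ i₀ + B := by rw [hB]; exact_mod_cast h3
      exact Finset.mem_Ico.2 ⟨h0, by omega⟩
    refine (Finset.card_le_card hsub).trans_eq ?_
    simp
  have hmeas : ∑ i ∈ J, volume.restrict (cellCenters k n i) ≤ (B : ℝ≥0∞) • volume.restrict S := by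
    refine Measure.le_intro fun s hs _ => ?_
    have h1 : ∀ i ∈ J, volume.restrict (cellCenters k n i) s =
        ∫⁻ x in s, (cellCenters k n i).indicator (fun _ => 1) x := by
      intro i _
      rw [lintegral_indicator_const (measurableSet_cellCenters k n i), one_mul,
        Measure.restrict_apply hs, Measure.restrict_apply (measurableSet_cellCenters k n i),
        inter_comm]
    rw [Measure.finsetSum_apply, Finset.sum_congr rfl h1, ← lintegral_finsetSum' _ fun i _ =>
      (measurable_const.indicator (measurableSet_cellCenters k n i)).aemeasurable]
    have hpt : ∀ x, ∑ i ∈ J, (cellCenters k n i).indicator (fun _ => (1 : ℝ≥0∞)) x ≤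
        S.indicator (fun _ => (B : ℝ≥0∞)) x := by
      intro x
      by_cases hx : x ∈ S
      · rw [indicator_of_mem hx]
        have : ∑ i ∈ J, (cellCenters k n i).indicator (fun _ => (1 : ℝ≥0∞)) x =
            ((J.filter fun i => x ∈ cellCenters k n i).card : ℝ≥0∞) := by
          simp only [indicator_apply]
          rw [Finset.sum_boole]
        rw [this]
        exact_mod_cast hcard x
      · refine (Finset.sum_eq_zero fun i hi => indicator_of_notMem (fun h => hx ?_) _).le.trans
          zero_le
        exact hS i hi h
    refine (lintegral_mono hpt).trans ?_
    rw [lintegral_indicator_const hSm, Measure.smul_apply, smul_eq_mul,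
      Measure.restrict_apply hSm, inter_comm, Measure.restrict_apply hs]
  calc _ = ∫⁻ x, g x ∂(∑ i ∈ J, volume.restrict (cellCenters k n i)) :=
        (lintegral_finsetSum_measure _ _ _).symm
    _ ≤ ∫⁻ x, g x ∂((B : ℝ≥0∞) • volume.restrict S) := lintegral_mono' hmeas le_rfl
    _ = _ := by rw [lintegral_smul_measure, smul_eq_mul]

/-- The uniform probability measure on `(0, t]`. -/
noncomputable def uniformStep (t : ℝ) : Measure ℝ :=
  ENNReal.ofReal (1 / t) • volume.restrict (Ioc 0 t)

instance (t : ℝ) : SFinite (uniformStep t) := by unfold uniformStep; infer_instance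

theorem uniformStep_univ {t : ℝ} (ht : 0 < t) : uniformStep t univ ≤ 1 := by
  rw [uniformStep, Measure.smul_apply, smul_eq_mul, Measure.restrict_apply_univ, Real.volume_Ioc,
    ← ENNReal.ofReal_mul (by positivity), sub_zero, one_div_mul_cancel ht.ne', ENNReal.ofReal_one]

/-- The change of variables on one cell, first from base point to centre for a fixed step, then from
step to relative step for a fixed centre. The Jacobian `φ(x)` is compensated by the length of the
cell, since `φ(x)/H ≲ n ≲ 1/t`. -/
theorem cellMeasure_preimage_le {k n i : ℕ} (hk : 1 ≤ k) (hn : 16 * (k + 1) ^ 2 ≤ n) (hi : i < n)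
    {t : ℝ} (ht : 0 < t) (hnt : 16 * ((k : ℝ) + 1) ^ 2 ≤ n * t)
    (hnt' : n * t ≤ 16 * ((k : ℝ) + 1) ^ 2 + 1) {s : Set (ℝ × ℝ)} (hs : MeasurableSet s) :
    cellMeasure k n i (toCenter k ⁻¹' s) ≤
      ENNReal.ofReal (2 * (k + 1) ^ 2 * (16 * ((k : ℝ) + 1) ^ 2 + 1)) *
        ∫⁻ x in cellCenters k n i, uniformStep t ((fun τ => (τ, x)) ⁻¹' s) := by
  have hn' : 0 < n := (Nat.zero_le i).trans_lt hi
  have hn0 : (0 : ℝ) < n := by exact_mod_cast hn'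
  have hi0 : (0 : ℝ) ≤ i := Nat.cast_nonneg i
  have hk0 : (0 : ℝ) ≤ k := Nat.cast_nonneg k
  have hH0 := cellStep_pos hn' i
  set X := cellCenters k n i with hX
  have hXm : MeasurableSet X := measurableSet_cellCenters k n i
  set I : ℝ × ℝ → ℝ≥0∞ := s.indicator fun _ => 1 with hI
  have hIm : Measurable I := measurable_const.indicator hs
  have hTm : Measurable fun q : ℝ × ℝ => I (toCenter k q) := hIm.comp (measurable_toCenter k)
  have h1 : cellMeasure k n i (toCenter k ⁻¹' s) = ENNReal.ofReal (1 / cellStep n i) *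
      ∫⁻ u in cellSteps k n i, ∫⁻ y in cellBase k n i, I (toCenter k (y, u)) := by
    rw [← lintegral_prod_symm (fun q => I (toCenter k q)) hTm.aemeasurable, cellMeasure,
      Measure.smul_apply, smul_eq_mul]
    congr 1
    rw [← lintegral_indicator_one (measurable_toCenter k hs)]
    rfl
  have hJm : Measurable
      (Function.uncurry fun u x : ℝ => X.indicator (fun x => I (u / phi x, x)) x) := by
    have : (Function.uncurry fun u x : ℝ => X.indicator (fun x => I (u / phi x, x)) x) =
        (univ ×ˢ X).indicator fun q : ℝ × ℝ => I (q.1 / phi q.2, q.2) := by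
      funext ⟨u, x⟩
      by_cases hx : x ∈ X <;> simp [Function.uncurry, hx]
    rw [this]
    refine (hIm.comp ?_).indicator (MeasurableSet.univ.prod hXm)
    exact (measurable_fst.div (measurable_phi.comp measurable_snd)).prodMk measurable_snd
  have h2 : ∀ u ∈ cellSteps k n i, ∫⁻ y in cellBase k n i, I (toCenter k (y, u)) ≤
      ∫⁻ x, X.indicator (fun x => I (u / phi x, x)) x := by
    intro u hu
    rw [← lintegral_add_right_eq_self (μ := volume)
      (fun x => X.indicator (fun x => I (u / phi x, x)) x) (k * u / 2)]
    refine le_trans (setLIntegral_mono' measurableSet_Icc fun y hy => ?_)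
      (setLIntegral_le_lintegral (cellBase k n i) _)
    rw [indicator_of_mem (center_mem_of_mem_cell hk hn hi hy hu)]
    exact le_rfl
  have h3 : ∀ x ∈ X, ∫⁻ u in cellSteps k n i, I (u / phi x, x) ≤
      ENNReal.ofReal (phi x) * ∫⁻ τ in Ioc 0 t, I (τ, x) := by
    intro x hx
    have hp : 0 < phi x := phi_pos (abs_lt_one_of_mem_cellCenters hn' hx)
    have h4 := setLIntegral_comp_mul_left (g := fun τ => I (τ, x))
      (hIm.comp measurable_prodMk_right) (inv_pos.2 hp) (cellStep n i)
      ((2 * (k : ℝ) + 1) * cellStep n i)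
    rw [inv_inv] at h4
    have h5 : ∫⁻ u in cellSteps k n i, I (u / phi x, x) =
        ∫⁻ u in Icc (cellStep n i) ((2 * (k : ℝ) + 1) * cellStep n i), I ((phi x)⁻¹ * u, x) := by
      refine lintegral_congr fun u => ?_
      rw [inv_mul_eq_div]
    rw [h5, h4]
    refine mul_le_mul' le_rfl (lintegral_mono_set fun τ hτ => ?_)
    refine ⟨(by positivity : (0 : ℝ) < (phi x)⁻¹ * cellStep n i).trans_le hτ.1, hτ.2.trans ?_⟩
    rw [inv_mul_eq_div]
    exact step_div_phi_le hn hnt hx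
  have h6 : ∀ x ∈ X, ENNReal.ofReal (1 / cellStep n i) * (ENNReal.ofReal (phi x) *
      ∫⁻ τ in Ioc 0 t, I (τ, x)) ≤
      ENNReal.ofReal (2 * (k + 1) ^ 2 * (16 * ((k : ℝ) + 1) ^ 2 + 1)) *
        uniformStep t ((fun τ => (τ, x)) ⁻¹' s) := by
    intro x hx
    have hxs : MeasurableSet ((fun τ => (τ, x)) ⁻¹' s) := measurable_prodMk_right hs
    have h7 : ∫⁻ τ in Ioc 0 t, I (τ, x) = volume.restrict (Ioc 0 t) ((fun τ => (τ, x)) ⁻¹' s) := by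
      rw [← lintegral_indicator_one hxs]
      rfl
    rw [h7, uniformStep, Measure.smul_apply, smul_eq_mul, ← mul_assoc, ← mul_assoc,
      ← ENNReal.ofReal_mul (by positivity), ← ENNReal.ofReal_mul (by positivity)]
    refine mul_le_mul' (ENNReal.ofReal_le_ofReal ?_) le_rfl
    obtain ⟨-, h8⟩ := phi_bounds_of_mem_cellCenters hn' hx
    calc 1 / cellStep n i * phi x
        ≤ 1 / cellStep n i * (8 * (k + 1) ^ 2 * ((i + 1) / n)) := by gcongr
      _ = 2 * (k + 1) ^ 2 * (n * t) * (1 / t) := by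
          unfold cellStep; field_simp; ring
      _ ≤ _ := by gcongr
  rw [h1]
  calc _ ≤ ENNReal.ofReal (1 / cellStep n i) *
        ∫⁻ u in cellSteps k n i, ∫⁻ x, X.indicator (fun x => I (u / phi x, x)) x :=
        mul_le_mul' le_rfl (setLIntegral_mono' measurableSet_Icc h2)
    _ = ENNReal.ofReal (1 / cellStep n i) *
        ∫⁻ x, ∫⁻ u in cellSteps k n i, X.indicator (fun x => I (u / phi x, x)) x := by
        rw [lintegral_lintegral_swap hJm.aemeasurable]
    _ = ∫⁻ x in X, ENNReal.ofReal (1 / cellStep n i) *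
          ∫⁻ u in cellSteps k n i, I (u / phi x, x) := by
        rw [lintegral_const_mul' _ _ (by simp), ← lintegral_indicator hXm]
        congr 1
        refine lintegral_congr fun x => ?_
        by_cases hx : x ∈ X <;> simp [hx]
    _ ≤ ∫⁻ x in X, ENNReal.ofReal (2 * (k + 1) ^ 2 * (16 * ((k : ℝ) + 1) ^ 2 + 1)) *
        uniformStep t ((fun τ => (τ, x)) ⁻¹' s) :=
        setLIntegral_mono' hXm fun x hx => (mul_le_mul' le_rfl (h3 x hx)).trans (h6 x hx)
    _ = _ := lintegral_const_mul' _ _ (by simp)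

/-- The change of variables to relative step and centre maps the cell measures into a multiple of
the product of the uniform measure on `(0, t]` and Lebesgue measure. -/
theorem map_toCenter_le {k n : ℕ} (hk : 1 ≤ k) (hn : 16 * (k + 1) ^ 2 ≤ n) {t : ℝ} (ht : 0 < t)
    (hnt : 16 * ((k : ℝ) + 1) ^ 2 ≤ n * t) (hnt' : n * t ≤ 16 * ((k : ℝ) + 1) ^ 2 + 1)
    {J : Finset ℕ} (hJ : ∀ i ∈ J, i < n) {S : Set ℝ}
    (hSm : MeasurableSet S) (hS : ∀ i ∈ J, cellCenters k n i ⊆ S) :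
    (∑ i ∈ J, cellMeasure k n i).map (toCenter k) ≤
      (ENNReal.ofReal (2 * (k + 1) ^ 2 * (16 * ((k : ℝ) + 1) ^ 2 + 1)) *
        ((4 * (k + 1) ^ 2 : ℕ) : ℝ≥0∞)) • (uniformStep t).prod (volume.restrict S) := by
  have hn' : 0 < n := by nlinarith [Nat.zero_le k]
  refine Measure.le_intro fun s hs _ => ?_
  rw [Measure.map_apply (measurable_toCenter k) hs, Measure.finsetSum_apply, Measure.smul_apply,
    smul_eq_mul, Measure.prod_apply_symm hs]
  refine (Finset.sum_le_sum fun i hi =>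
    cellMeasure_preimage_le hk hn (hJ i hi) ht hnt hnt' hs).trans ?_
  rw [← Finset.mul_sum, mul_assoc (ENNReal.ofReal _)]
  exact mul_le_mul' le_rfl (sum_restrict_cellCenters_le hn' J hSm hS _)

/-! ### Differences over the cells and the averaged modulus -/

theorem ae_sum_measure_of_forall {α ι : Type*} [MeasurableSpace α] {J : Finset ι}
    {μ : ι → Measure α} {P : α → Prop} (h : ∀ i ∈ J, ∀ᵐ x ∂μ i, P x) : ∀ᵐ x ∂∑ i ∈ J, μ i, P x := by
  rw [ae_iff, Measure.finsetSum_apply]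
  exact Finset.sum_eq_zero fun i hi => ae_iff.1 (h i hi)

/-- Differences over cells are bounded by any function of relative step and centre which dominates
them pointwise. -/
theorem eLpNorm_weightedFd_le_prod {k n r : ℕ} (hk : 1 ≤ k) (hn : 16 * (k + 1) ^ 2 ≤ n) {t : ℝ}
    (ht : 0 < t) (hnt : 16 * ((k : ℝ) + 1) ^ 2 ≤ n * t)
    (hnt' : n * t ≤ 16 * ((k : ℝ) + 1) ^ 2 + 1)
    {J : Finset ℕ} (hJ : ∀ i ∈ J, i < n) {S : Set ℝ} (hSm : MeasurableSet S)
    (hS : ∀ i ∈ J, cellCenters k n i ⊆ S) {F : ℝ → ℝ} {g : ℝ × ℝ → ℝ} (hg : Measurable g)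
    (h : ∀ i ∈ J, ∀ y ∈ cellBase k n i, ∀ u ∈ cellSteps k n i,
      ‖weightedFd k r F (y, u)‖ₑ ≤ 2 ^ r * ‖g (toCenter k (y, u))‖ₑ) {p : ℝ≥0∞} (hp : 1 ≤ p) :
    eLpNorm (weightedFd k r F) p (∑ i ∈ J, cellMeasure k n i) ≤
      2 ^ r * ((ENNReal.ofReal (2 * (k + 1) ^ 2 * (16 * ((k : ℝ) + 1) ^ 2 + 1)) *
        ((4 * (k + 1) ^ 2 : ℕ) : ℝ≥0∞)) *
          eLpNorm g p ((uniformStep t).prod (volume.restrict S))) := by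
  have h1 : eLpNorm (weightedFd k r F) p (∑ i ∈ J, cellMeasure k n i) ≤
      2 ^ r * eLpNorm (fun q => g (toCenter k q)) p (∑ i ∈ J, cellMeasure k n i) := by
    refine eLpNorm_le_const_mul (by simp) (ae_sum_measure_of_forall fun i hi => ?_)
    refine Measure.ae_smul_measure ?_ _
    rw [Measure.prod_restrict, ae_restrict_iff' (by
      unfold cellBase cellSteps
      exact measurableSet_Icc.prod measurableSet_Icc)]
    exact Filter.Eventually.of_forall fun q hq => h i hi q.1 hq.1 q.2 hq.2
  refine h1.trans (mul_le_mul' le_rfl ?_)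
  refine eLpNorm_comp_le_of_map_le (T := toCenter k) (g := g) ?_ hp
    (measurable_toCenter k).aemeasurable (map_toCenter_le hk hn ht hnt hnt' hJ hSm hS)
    hg.aestronglyMeasurable
  have hk0 : (0 : ℝ) ≤ k := Nat.cast_nonneg k
  have e1 : (1 : ℝ≥0∞) ≤ ENNReal.ofReal (2 * (k + 1) ^ 2 * (16 * ((k : ℝ) + 1) ^ 2 + 1)) := by
    rw [← ENNReal.ofReal_one]
    refine ENNReal.ofReal_le_ofReal ?_
    nlinarith [sq_nonneg ((k : ℝ) + 1)]
  have e2 : (1 : ℝ≥0∞) ≤ ((4 * (k + 1) ^ 2 : ℕ) : ℝ≥0∞) := by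
    exact_mod_cast (by nlinarith [Nat.zero_le k] : 1 ≤ 4 * (k + 1) ^ 2)
  exact one_le_mul e1 e2

/-- The symmetric difference about the centre is the forward difference at the base point. -/
theorem symmDelta_toCenter {k n i : ℕ} (hk : 1 ≤ k) (hn : 16 * (k + 1) ^ 2 ≤ n) (hi : i < n)
    {y u : ℝ} (hy : y ∈ cellBase k n i) (hu : u ∈ cellSteps k n i) (F : ℝ → ℝ) :
    symmDelta k ((toCenter k (y, u)).1 * phi (toCenter k (y, u)).2) F (toCenter k (y, u)).2 =
      fd k u F y := by
  obtain ⟨h1, h2, h3⟩ := node_mem_of_mem_cell hn hi hy hu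
  have hx := center_mem_of_mem_cell hk hn hi hy hu
  have hp := phi_pos (abs_lt_one_of_mem_cellCenters ((Nat.zero_le i).trans_lt hi) hx)
  have hku : 0 ≤ k * u := by positivity
  simp only [toCenter]
  rw [div_mul_cancel₀ _ hp.ne', symmDelta_eq_fd, add_sub_cancel_right]
  · exact ⟨by linarith, by linarith⟩
  · exact ⟨by linarith, by linarith⟩

/-- The weight at the base point, the leftmost node, is bounded by `W` at the centre: the node on
the right stays at distance at least `1/2` from `1`. -/
theorem phi_le_two_mul_wt_toCenter {k n i : ℕ} (hk : 1 ≤ k) (hn : 16 * (k + 1) ^ 2 ≤ n) (hi : i < n)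
    {y u : ℝ} (hy : y ∈ cellBase k n i) (hu : u ∈ cellSteps k n i) :
    phi y ≤ 2 * wt (k * (toCenter k (y, u)).1) (toCenter k (y, u)).2 := by
  obtain ⟨h1, h2, h3⟩ := node_mem_of_mem_cell hn hi hy hu
  have hx := center_mem_of_mem_cell hk hn hi hy hu
  have hp := phi_pos (abs_lt_one_of_mem_cellCenters ((Nat.zero_le i).trans_lt hi) hx)
  have hku : 0 ≤ k * u := by positivity
  simp only [toCenter]
  have e : (k : ℝ) * (u / phi (y + k * u / 2)) * phi (y + k * u / 2) = k * u := by
    rw [mul_assoc, div_mul_cancel₀ _ hp.ne']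
  rw [wt, e]
  refine abs_le_of_sq_le_sq' ?_ (by positivity) |>.2
  rw [mul_pow, Real.sq_sqrt (mul_nonneg (by linarith) (by linarith)),
    phi_sq (abs_le.2 ⟨h1, by linarith⟩)]
  nlinarith

theorem eLpNorm_wdiff_prod_le_avgModulus {k r : ℕ} {F : ℝ → ℝ} (hF : Measurable F) {p : ℝ≥0∞}
    (hp : 1 ≤ p) {t : ℝ} (ht : 0 < t) :
    eLpNorm (fun q : ℝ × ℝ => wdiff k r F q.1 q.2) p
      ((uniformStep t).prod (volume.restrict (Icc (-1 : ℝ) 1))) ≤ avgModulus k r p F t := by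
  unfold avgModulus
  split_ifs with hpt
  · subst hpt
    have h := eLpNorm_prod_le_of_slices (lam := uniformStep t)
      (ν := volume.restrict (Icc (-1 : ℝ) 1)) (measurable_wdiff_uncurry (k := k) (r := r) hF)
      (p := ∞) hp (M := modulus k r ∞ F t) le_rfl (uniformStep_univ ht) ?_
    · rwa [one_mul] at h
    · refine Measure.ae_smul_measure ((ae_restrict_iff' measurableSet_Ioc).2
        (Filter.Eventually.of_forall fun τ hτ => ?_)) _
      exact le_iSup₂ (f := fun h (_ : h ∈ Icc (0 : ℝ) t) =>
        normP ∞ (fun x => wt (k * h) x ^ r * symmDelta k (h * phi x) F x)) τ ⟨hτ.1.le, hτ.2⟩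
  · have hp0 : p ≠ 0 := (zero_lt_one.trans_le hp).ne'
    have hpr : 0 < p.toReal := ENNReal.toReal_pos hp0 hpt
    have hm := measurable_wdiff_uncurry (k := k) (r := r) hF
    rw [eLpNorm_eq_lintegral_rpow_enorm_toReal hp0 hpt, lintegral_prod _
      (hm.enorm.pow_const _).aemeasurable, uniformStep, lintegral_smul_measure, smul_eq_mul]
    refine (congrArg (fun a => (ENNReal.ofReal (1 / t) * a) ^ (1 / p.toReal))
      (setLIntegral_congr_fun measurableSet_Ioc fun τ hτ => ?_)).le
    have h1 := eLpNorm_eq_restrict_Dom (k := k) hτ.1.le (r := r) (F := F) (p := p)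
    rw [eLpNorm_eq_lintegral_rpow_enorm_toReal hp0 hpt,
      eLpNorm_eq_lintegral_rpow_enorm_toReal hp0 hpt] at h1
    exact ENNReal.rpow_left_injective (one_div_pos.2 hpr).ne' h1

/-- The differences over the cells of the left half are controlled by the averaged modulus. -/
theorem exists_eLpNorm_weightedFd_le_avgModulus (m r : ℕ) {p : ℝ≥0∞} (hp : 1 ≤ p) :
    ∃ C : ℝ≥0, ∀ F : ℝ → ℝ, Measurable F → ∀ n : ℕ, 16 * (m + 1 + 1) ^ 2 ≤ n → ∀ t : ℝ, 0 < t →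
      16 * ((m : ℝ) + 1 + 1) ^ 2 ≤ n * t → n * t ≤ 16 * ((m : ℝ) + 1 + 1) ^ 2 + 1 →
      eLpNorm (weightedFd (m + 1) r F) p (leftMeasure (m + 1) n) ≤
        C * avgModulus (m + 1) r p F t := by
  refine ⟨2 ^ r * (Real.toNNReal (2 * (((m + 1 : ℕ) : ℝ) + 1) ^ 2 *
    (16 * (((m + 1 : ℕ) : ℝ) + 1) ^ 2 + 1)) * ((4 * (m + 1 + 1) ^ 2 : ℕ) : ℝ≥0)),
    fun F hF n hn t ht hnt hnt' => ?_⟩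
  have hn' : 0 < n := by nlinarith [Nat.zero_le m]
  have h := eLpNorm_weightedFd_le_prod (k := m + 1) (r := r) (F := F) (by omega) hn ht
    (by push_cast; exact hnt) (by push_cast; exact hnt') (J := Finset.range n)
    (fun i hi => Finset.mem_range.1 hi) measurableSet_Icc (S := Icc (-1) 1)
    (fun i _ x hx => Ioo_subset_Icc_self (abs_lt.1 (abs_lt_one_of_mem_cellCenters hn' hx)))
    (measurable_wdiff_uncurry (k := m + 1) (r := r) hF) ?_ hp
  · refine h.trans ((mul_le_mul' le_rfl (mul_le_mul' le_rfl
      (eLpNorm_wdiff_prod_le_avgModulus hF hp ht))).trans_eq ?_)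
    rw [ENNReal.ofReal]
    push_cast
    ring
  · intro i hi y hy u hu
    have hi' := Finset.mem_range.1 hi
    simp only [weightedFd, wdiff, enorm_mul]
    rw [symmDelta_toCenter (by omega) hn hi' hy hu, ← mul_assoc]
    refine mul_le_mul' ?_ le_rfl
    have h2 : (2 : ℝ≥0∞) ^ r = ‖(2 : ℝ) ^ r‖ₑ := by
      rw [enorm_pow, Real.enorm_of_nonneg (by norm_num)]; simp
    rw [h2, ← enorm_mul, ← mul_pow, Real.enorm_of_nonneg (pow_nonneg (phi_nonneg _) _),
      Real.enorm_of_nonneg (pow_nonneg (mul_nonneg (by norm_num) (wt_nonneg _ _)) _)]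
    exact ENNReal.ofReal_le_ofReal (pow_le_pow_left₀ (phi_nonneg _)
      (phi_le_two_mul_wt_toCenter (by omega) hn hi' hy hu) r)

/-! ### Differences over the cells and the weighted Ditzian–Totik modulus -/

theorem eLpNorm_finsetSum_measure_le {α ι : Type*} [MeasurableSpace α] (J : Finset ι)
    (μ : ι → Measure α) (g : α → ℝ) {p : ℝ≥0∞} (hp : 1 ≤ p) :
    eLpNorm g p (∑ i ∈ J, μ i) ≤ ∑ i ∈ J, eLpNorm g p (μ i) := by
  classical
  induction J using Finset.induction_on with
  | empty => simp
  | insert i J hi ih =>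
    rw [Finset.sum_insert hi, Finset.sum_insert hi]
    exact (eLpNorm_add_measure_le g hp _ _).trans (add_le_add le_rfl ih)

/-- The mean over the step is bounded by the supremum over the step. -/
theorem eLpNorm_symmDelta_prod_le {k r : ℕ} {F : ℝ → ℝ} (hF : Measurable F) {p : ℝ≥0∞}
    (hp : 1 ≤ p) {t : ℝ} (ht : 0 < t) (S : Set ℝ) :
    eLpNorm (fun q : ℝ × ℝ => phi q.2 ^ r * symmDelta k (q.1 * phi q.2) F q.2) p
      ((uniformStep t).prod (volume.restrict S)) ≤
      ⨆ h ∈ Ioc (0 : ℝ) t, eLpNorm (fun x => phi x ^ r * symmDelta k (h * phi x) F x) p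
        (volume.restrict S) := by
  have hm : Measurable fun q : ℝ × ℝ => phi q.2 ^ r * symmDelta k (q.1 * phi q.2) F q.2 := by
    refine ((measurable_phi.comp measurable_snd).pow_const r).mul ?_
    exact (measurable_symmDiffOn_uncurry hF).comp
      (f := fun z : ℝ × ℝ => (z.1 * phi z.2, z.2))
      ((measurable_fst.mul (measurable_phi.comp measurable_snd)).prodMk measurable_snd)
  have h := eLpNorm_prod_le_of_slices (lam := uniformStep t) (ν := volume.restrict S) hm hp
    (M := ⨆ h ∈ Ioc (0 : ℝ) t, eLpNorm (fun x => phi x ^ r * symmDelta k (h * phi x) F x) p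
        (volume.restrict S)) le_rfl (uniformStep_univ ht) ?_
  · rwa [one_mul] at h
  · refine Measure.ae_smul_measure ((ae_restrict_iff' measurableSet_Ioc).2
      (Filter.Eventually.of_forall fun τ hτ => ?_)) _
    exact le_iSup₂ (f := fun h (_ : h ∈ Ioc (0 : ℝ) t) =>
      eLpNorm (fun x => phi x ^ r * symmDelta k (h * phi x) F x) p (volume.restrict S)) τ hτ

/-- A cell near the end point is controlled by the one-sided differences there. -/
theorem eLpNorm_weightedFd_cell_le_forwardDelta {k n i r : ℕ} (hn : 16 * (k + 1) ^ 2 ≤ n)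
    (hi : i < n) {F : ℝ → ℝ} (hF : Measurable F) {p : ℝ≥0∞} (hp : 1 ≤ p) {a b : ℝ}
    (ha : cellSteps k n i ⊆ Ioc 0 a) (hb : cellBase k n i ⊆ Icc (-1) (-1 + b)) :
    eLpNorm (weightedFd k r F) p (cellMeasure k n i) ≤ (2 * k + 1 : ℕ) *
      ⨆ h ∈ Ioc (0 : ℝ) a, eLpNorm (fun x => phi x ^ r * forwardDelta k h F x) p
        (volume.restrict (Icc (-1) (-1 + b))) := by
  have hH := cellStep_pos ((Nat.zero_le i).trans_lt hi) i
  set lam : Measure ℝ := ENNReal.ofReal (1 / cellStep n i) • volume.restrict (cellSteps k n i)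
    with hlam
  have hlamS : SFinite lam := by rw [hlam]; infer_instance
  have hm := measurable_weightedFd k r hF
  have hms : Measurable fun q : ℝ × ℝ => weightedFd k r F (q.2, q.1) := hm.comp measurable_swap
  have e1 : cellMeasure k n i =
      (lam.prod (volume.restrict (cellBase k n i))).map Prod.swap := by
    rw [Measure.prod_swap, hlam, Measure.prod_smul_right]
    rfl
  rw [e1, eLpNorm_map_measure hm.aestronglyMeasurable measurable_swap.aemeasurable]
  have hk0 : (0 : ℝ) ≤ k := Nat.cast_nonneg k
  refine eLpNorm_prod_le_of_slices hms hp (by exact_mod_cast (by omega : 1 ≤ 2 * k + 1)) ?_ ?_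
  · rw [hlam, Measure.smul_apply, smul_eq_mul, Measure.restrict_apply_univ, cellSteps,
      Real.volume_Icc, ← ENNReal.ofReal_mul (by positivity), ← ENNReal.ofReal_natCast]
    refine ENNReal.ofReal_le_ofReal ?_
    have : 1 / cellStep n i * ((2 * (k : ℝ) + 1) * cellStep n i - cellStep n i) = 2 * k := by
      field_simp; ring
    rw [this]
    push_cast
    linarith
  · refine Measure.ae_smul_measure ((ae_restrict_iff' (by
      unfold cellSteps; exact measurableSet_Icc)).2 (Filter.Eventually.of_forall fun u hu => ?_)) _
    refine le_trans ?_ (le_iSup₂ (f := fun h (_ : h ∈ Ioc (0 : ℝ) a) =>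
      eLpNorm (fun x => phi x ^ r * forwardDelta k h F x) p
        (volume.restrict (Icc (-1) (-1 + b)))) u (ha hu))
    refine le_trans (le_of_eq ?_) (eLpNorm_mono_measure _ (Measure.restrict_mono hb le_rfl))
    refine eLpNorm_congr_ae ((ae_restrict_iff' (by unfold cellBase; exact measurableSet_Icc)).2
      (Filter.Eventually.of_forall fun y hy => ?_))
    obtain ⟨h1, h2, h3⟩ := node_mem_of_mem_cell hn hi hy hu
    simp only [weightedFd]
    rw [forwardDelta_eq_fd h2.le h1 (by linarith)]

section EndCells

variable {k n i : ℕ} {t : ℝ}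

/-- The cells which start in the end interval of length `t* = 2k²t²` use only steps at most `t*` and
base points at distance at most `12 t*` from the end point, and their number is bounded. -/
theorem endCell_subset (hk : 1 ≤ k) (hn : 16 * (k + 1) ^ 2 ≤ n) (ht : 0 < t)
    (hnt : 16 * ((k : ℝ) + 1) ^ 2 ≤ n * t) (hnt' : n * t ≤ 16 * ((k : ℝ) + 1) ^ 2 + 1)
    (hi : ((i : ℝ) / n) ^ 2 < 2 * (k : ℝ) ^ 2 * t ^ 2) :
    cellSteps k n i ⊆ Ioc 0 (2 * (k : ℝ) ^ 2 * t ^ 2) ∧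
      cellBase k n i ⊆ Icc (-1) (-1 + 12 * (2 * (k : ℝ) ^ 2 * t ^ 2)) ∧
      i < 2 * k * (16 * (k + 1) ^ 2 + 1) := by
  have hn' : 0 < n := by nlinarith [Nat.zero_le k]
  have hn0 : (0 : ℝ) < n := by exact_mod_cast hn'
  have hi0 : (0 : ℝ) ≤ i := Nat.cast_nonneg i
  have hk1 : (1 : ℝ) ≤ k := by exact_mod_cast hk
  have hH := cellStep_pos hn' i
  have h1 : (i : ℝ) / n < 3 / 2 * k * t := by
    refine lt_of_pow_lt_pow_left₀ 2 (by positivity) (hi.trans_le ?_)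
    have : 0 ≤ (k : ℝ) ^ 2 * t ^ 2 := by positivity
    nlinarith
  have h2 : 1 / (n : ℝ) ≤ t / (16 * ((k : ℝ) + 1) ^ 2) := by
    rw [div_le_div_iff₀ hn0 (by positivity)]; linarith
  have h3 : t / (16 * ((k : ℝ) + 1) ^ 2) ≤ t / 64 := by
    refine div_le_div_of_nonneg_left ht.le (by norm_num) ?_
    nlinarith
  have h4 : ((i : ℝ) + 1) / n ≤ 2 * k * t := by
    rw [add_div]
    have : t / 64 ≤ 1 / 2 * k * t := by nlinarith
    linarith
  have h5 : (2 * (k : ℝ) + 1) * cellStep n i ≤ 2 * (k : ℝ) ^ 2 * t ^ 2 := by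
    have e : (2 * (k : ℝ) + 1) * cellStep n i = 4 * (2 * k + 1) * ((i + 1) / n) * (1 / n) := by
      unfold cellStep; field_simp
    rw [e]
    calc _ ≤ 4 * (2 * k + 1) * (2 * k * t) * (t / (16 * ((k : ℝ) + 1) ^ 2)) := by gcongr
      _ = (k * (2 * k + 1) / (2 * ((k : ℝ) + 1) ^ 2)) * t ^ 2 := by field_simp; ring
      _ ≤ (2 * (k : ℝ) ^ 2) * t ^ 2 := by
        refine mul_le_mul_of_nonneg_right ?_ (by positivity)
        rw [div_le_iff₀ (by positivity)]
        nlinarith [mul_pos (by linarith : (0 : ℝ) < k) (by linarith : (0 : ℝ) < k),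
          pow_pos (by linarith : (0 : ℝ) < k) 3]
  refine ⟨fun u hu => ⟨hH.trans_le hu.1, hu.2.trans h5⟩, 
    Icc_subset_Icc (neg_one_le_cellLeft n i) ?_, ?_⟩
  · have : ((k : ℝ) + 1) * cellStep n i ≤ (2 * (k : ℝ) + 1) * cellStep n i := by gcongr; linarith
    unfold cellLeft
    have h6 : 0 ≤ (k : ℝ) ^ 2 * t ^ 2 := by positivity
    linarith
  · have h6 : (i : ℝ) < 2 * k * (16 * (k + 1) ^ 2 + 1) := by
      rw [div_lt_iff₀ hn0] at h1
      calc (i : ℝ) < 3 / 2 * k * t * n := h1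
        _ = 3 / 2 * k * (n * t) := by ring
        _ ≤ 3 / 2 * k * (16 * ((k : ℝ) + 1) ^ 2 + 1) := by gcongr
        _ ≤ _ := by gcongr; norm_num
    exact_mod_cast h6

theorem cellCenters_subset (ht2 : 2 * (k : ℝ) ^ 2 * t ^ 2 ≤ 1 / 2)
    (hi : 2 * (k : ℝ) ^ 2 * t ^ 2 ≤ ((i : ℝ) / n) ^ 2) :
    cellCenters k n i ⊆ Icc (-1 + 2 * (k : ℝ) ^ 2 * t ^ 2) (1 - 2 * (k : ℝ) ^ 2 * t ^ 2) := by
  rintro x ⟨h1, -, h3⟩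
  have h4 : ((i : ℝ) / n) ^ 2 ≤ (((i : ℝ) + 1) / n) ^ 2 := by gcongr; linarith
  exact ⟨by linarith, by linarith⟩

end EndCells

/-- The differences over the cells of the left half are controlled by the interior term and the left
end point term of the weighted Ditzian–Totik modulus. The cells are divided according to whether
they start in the end interval of length `t* = 2k²t²` or not. -/
theorem exists_eLpNorm_weightedFd_le_weightedDTModulus (m r : ℕ) {p : ℝ≥0∞} (hp : 1 ≤ p) :
    ∃ C : ℝ≥0, ∀ F : ℝ → ℝ, Measurable F → ∀ n : ℕ, 16 * (m + 1 + 1) ^ 2 ≤ n → ∀ t : ℝ, 0 < t →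
      16 * ((m : ℝ) + 1 + 1) ^ 2 ≤ n * t → n * t ≤ 16 * ((m : ℝ) + 1 + 1) ^ 2 + 1 →
      2 * ((m + 1 : ℕ) : ℝ) ^ 2 * t ^ 2 ≤ 1 / 2 →
      eLpNorm (weightedFd (m + 1) r F) p (leftMeasure (m + 1) n) ≤
        C * ((⨆ h ∈ Ioc (0 : ℝ) t,
          eLpNorm (fun x => phi x ^ r * symmDelta (m + 1) (h * phi x) F x) p
            (volume.restrict (Icc (-1 + 2 * ((m + 1 : ℕ) : ℝ) ^ 2 * t ^ 2)
              (1 - 2 * ((m + 1 : ℕ) : ℝ) ^ 2 * t ^ 2)))) +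
        (⨆ h ∈ Ioc (0 : ℝ) (2 * ((m + 1 : ℕ) : ℝ) ^ 2 * t ^ 2),
          eLpNorm (fun x => phi x ^ r * forwardDelta (m + 1) h F x) p
          (volume.restrict (Icc (-1) (-1 + 12 * (2 * ((m + 1 : ℕ) : ℝ) ^ 2 * t ^ 2)))))) := by
  classical
  set k := m + 1 with hk
  set A : ℝ≥0 := 2 ^ r * (Real.toNNReal (2 * ((k : ℝ) + 1) ^ 2 *
    (16 * ((k : ℝ) + 1) ^ 2 + 1)) * ((4 * (k + 1) ^ 2 : ℕ) : ℝ≥0)) with hA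
  set N : ℕ := 2 * k * (16 * (k + 1) ^ 2 + 1) with hN
  set B : ℝ≥0 := (N : ℝ≥0) * ((2 * k + 1 : ℕ) : ℝ≥0) with hB
  refine ⟨A + B, fun F hF n hn t ht hnt hnt' ht2 => ?_⟩
  have hkm : (k : ℝ) = m + 1 := by rw [hk]; push_cast; rfl
  rw [← hkm] at hnt hnt'
  set ts : ℝ := 2 * (k : ℝ) ^ 2 * t ^ 2 with hts
  set D₁ := ⨆ h ∈ Ioc (0 : ℝ) t, eLpNorm (fun x => phi x ^ r * symmDelta k (h * phi x) F x) p
    (volume.restrict (Icc (-1 + ts) (1 - ts))) with hD₁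
  set D₂ := ⨆ h ∈ Ioc (0 : ℝ) ts, eLpNorm (fun x => phi x ^ r * forwardDelta k h F x) p
    (volume.restrict (Icc (-1) (-1 + 12 * ts))) with hD₂
  set J₁ := (Finset.range n).filter fun i : ℕ => ts ≤ ((i : ℝ) / n) ^ 2 with hJ₁
  set J₂ := (Finset.range n).filter fun i : ℕ => ¬ ts ≤ ((i : ℝ) / n) ^ 2 with hJ₂
  have hsplit : leftMeasure k n = ∑ i ∈ J₁, cellMeasure k n i + ∑ i ∈ J₂, cellMeasure k n i :=
    (Finset.sum_filter_add_sum_filter_not _ _ _).symm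
  have hJ1n : ∀ i ∈ J₁, i < n := fun i hi => Finset.mem_range.1 (Finset.mem_filter.1 hi).1
  have hJ2n : ∀ i ∈ J₂, i < n := fun i hi => Finset.mem_range.1 (Finset.mem_filter.1 hi).1
  have h1 : eLpNorm (weightedFd k r F) p (∑ i ∈ J₁, cellMeasure k n i) ≤ A * D₁ := by
    have hm : Measurable fun q : ℝ × ℝ => phi q.2 ^ r * symmDelta k (q.1 * phi q.2) F q.2 := by
      refine ((measurable_phi.comp measurable_snd).pow_const r).mul ?_
      exact (measurable_symmDiffOn_uncurry hF).comp
        (f := fun z : ℝ × ℝ => (z.1 * phi z.2, z.2))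
        ((measurable_fst.mul (measurable_phi.comp measurable_snd)).prodMk measurable_snd)
    have h := eLpNorm_weightedFd_le_prod (k := k) (r := r) (F := F) (by omega) hn ht
      hnt hnt' (J := J₁) hJ1n measurableSet_Icc (S := Icc (-1 + ts) (1 - ts))
      (fun i hi => cellCenters_subset ht2 (Finset.mem_filter.1 hi).2) hm ?_ hp
    · refine h.trans ((mul_le_mul' le_rfl (mul_le_mul' le_rfl
        (eLpNorm_symmDelta_prod_le hF hp ht _))).trans_eq ?_)
      rw [hA, ENNReal.ofReal]
      push_cast
      ring
    · intro i hi y hy u hu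
      have hi' := hJ1n i hi
      obtain ⟨g1, g2, g3⟩ := node_mem_of_mem_cell hn hi' hy hu
      simp only [weightedFd, enorm_mul]
      rw [symmDelta_toCenter (by omega) hn hi' hy hu, ← mul_assoc]
      refine mul_le_mul' ?_ le_rfl
      have h2 : (2 : ℝ≥0∞) ^ r = ‖(2 : ℝ) ^ r‖ₑ := by
        rw [enorm_pow, Real.enorm_of_nonneg (by norm_num)]; simp
      rw [h2, ← enorm_mul, ← mul_pow, Real.enorm_of_nonneg (pow_nonneg (phi_nonneg _) _),
        Real.enorm_of_nonneg (pow_nonneg (mul_nonneg (by norm_num) (phi_nonneg _)) _)]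
      refine ENNReal.ofReal_le_ofReal (pow_le_pow_left₀ (phi_nonneg _) ?_ r)
      have hku : 0 ≤ (k : ℝ) * u := by positivity
      exact phi_le_two_mul_phi g1 (by simp only [toCenter]; linarith)
        (by simp only [toCenter]; linarith)
  have h2 : eLpNorm (weightedFd k r F) p (∑ i ∈ J₂, cellMeasure k n i) ≤ B * D₂ := by
    have hend : ∀ i ∈ J₂, cellSteps k n i ⊆ Ioc 0 ts ∧
        cellBase k n i ⊆ Icc (-1) (-1 + 12 * ts) ∧ i < N := fun i hi =>
      endCell_subset (by omega) hn ht hnt hnt' (not_le.1 (Finset.mem_filter.1 hi).2)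
    have hcard : J₂.card ≤ N := by
      have : J₂ ⊆ Finset.range N := fun i hi => Finset.mem_range.2 (hend i hi).2.2
      simpa using Finset.card_le_card this
    refine (eLpNorm_finsetSum_measure_le J₂ _ _ hp).trans ?_
    refine (Finset.sum_le_card_nsmul J₂ _ _ fun i hi => eLpNorm_weightedFd_cell_le_forwardDelta hn
      (hJ2n i hi) hF hp (hend i hi).1 (hend i hi).2.1).trans ?_
    rw [nsmul_eq_mul, hB, ENNReal.coe_mul, mul_assoc]
    refine mul_le_mul' ?_ le_rfl
    rw [ENNReal.coe_natCast]
    exact_mod_cast hcard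
  rw [hsplit]
  refine (eLpNorm_add_measure_le _ hp _ _).trans ((add_le_add h1 h2).trans ?_)
  rw [ENNReal.coe_add, add_mul]
  exact add_le_add (mul_le_mul' le_rfl le_self_add) (mul_le_mul' le_rfl le_add_self)

/-! ### Invariance and comparison of the moduli -/

theorem modulus_eq (k r : ℕ) (p : ℝ≥0∞) (F : ℝ → ℝ) (t : ℝ) :
    modulus k r p F t = ⨆ h ∈ Icc (0 : ℝ) t, normP p (wdiff k r F h) := rfl

/-- For `p < ∞` the averaged modulus is the `L_p` mean over the step of the norms whose supremum is
the modulus: the differences vanish outside `Dom`, up to a null set. -/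
theorem avgModulus_eq (k r : ℕ) {p : ℝ≥0∞} (hp : 1 ≤ p) (hpt : p ≠ ∞) (F : ℝ → ℝ) (t : ℝ) :
    avgModulus k r p F t = (ENNReal.ofReal (1 / t) * ∫⁻ τ in Ioc (0 : ℝ) t,
      normP p (wdiff k r F τ) ^ p.toReal) ^ (1 / p.toReal) := by
  have hp0 : p ≠ 0 := (zero_lt_one.trans_le hp).ne'
  have hpr : 0 < p.toReal := ENNReal.toReal_pos hp0 hpt
  rw [avgModulus, if_neg hpt]
  congr 2
  refine setLIntegral_congr_fun measurableSet_Ioc fun τ hτ => ?_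
  rw [normP, eLpNorm_eq_restrict_Dom hτ.1.le, eLpNorm_eq_lintegral_rpow_enorm_toReal hp0 hpt,
    ← ENNReal.rpow_mul, one_div_mul_cancel hpr.ne', ENNReal.rpow_one]
  rfl

theorem modulus_congr {k r : ℕ} {p : ℝ≥0∞} {F F' : ℝ → ℝ} {t : ℝ}
    (h : ∀ τ, 0 ≤ τ → normP p (wdiff k r F τ) = normP p (wdiff k r F' τ)) :
    modulus k r p F t = modulus k r p F' t := by
  rw [modulus_eq, modulus_eq]
  exact iSup_congr fun τ => iSup_congr fun hτ => h τ hτ.1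

theorem avgModulus_congr {k r : ℕ} {p : ℝ≥0∞} (hp : 1 ≤ p) {F F' : ℝ → ℝ} {t : ℝ}
    (h : ∀ τ, 0 ≤ τ → normP p (wdiff k r F τ) = normP p (wdiff k r F' τ)) :
    avgModulus k r p F t = avgModulus k r p F' t := by
  rcases eq_or_ne p ∞ with rfl | hpt
  · rw [avgModulus, avgModulus, if_pos rfl, if_pos rfl, modulus_congr h]
  · rw [avgModulus_eq k r hp hpt, avgModulus_eq k r hp hpt]
    congr 2
    exact setLIntegral_congr_fun measurableSet_Ioc fun τ hτ => by rw [h τ hτ.1.le]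

theorem avgModulus_le_modulus (k r : ℕ) {p : ℝ≥0∞} (hp : 1 ≤ p) (F : ℝ → ℝ) {t : ℝ} (ht : 0 < t) :
    avgModulus k r p F t ≤ modulus k r p F t := by
  rcases eq_or_ne p ∞ with rfl | hpt
  · rw [avgModulus, if_pos rfl]
  have hp0 : p ≠ 0 := (zero_lt_one.trans_le hp).ne'
  have hpr : 0 < p.toReal := ENNReal.toReal_pos hp0 hpt
  rw [avgModulus_eq k r hp hpt]
  set M := modulus k r p F t with hM
  have h1 : ∫⁻ τ in Ioc (0 : ℝ) t, normP p (wdiff k r F τ) ^ p.toReal ≤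
      M ^ p.toReal * ENNReal.ofReal t := by
    calc ∫⁻ τ in Ioc (0 : ℝ) t, normP p (wdiff k r F τ) ^ p.toReal
        ≤ ∫⁻ _ in Ioc (0 : ℝ) t, M ^ p.toReal := by
          refine setLIntegral_mono' measurableSet_Ioc fun τ hτ => ENNReal.rpow_le_rpow ?_ hpr.le
          rw [hM, modulus_eq]
          exact le_iSup₂ (f := fun h (_ : h ∈ Icc (0 : ℝ) t) => normP p (wdiff k r F h)) τ
            ⟨hτ.1.le, hτ.2⟩
      _ = M ^ p.toReal * ENNReal.ofReal t := by
          rw [setLIntegral_const, Real.volume_Ioc, sub_zero]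
  calc _ ≤ (ENNReal.ofReal (1 / t) * (M ^ p.toReal * ENNReal.ofReal t)) ^ (1 / p.toReal) :=
        ENNReal.rpow_le_rpow (mul_le_mul' le_rfl h1) (by positivity)
    _ = (M ^ p.toReal) ^ (1 / p.toReal) := by
        rw [mul_left_comm, ← ENNReal.ofReal_mul (by positivity), one_div_mul_cancel ht.ne',
          ENNReal.ofReal_one, mul_one]
    _ = M := by rw [← ENNReal.rpow_mul, mul_one_div_cancel hpr.ne', ENNReal.rpow_one]

theorem normP_wdiff_comp_neg (k r : ℕ) (p : ℝ≥0∞) (F : ℝ → ℝ) (h : ℝ) :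
    normP p (wdiff k r (fun x => F (-x)) h) = normP p (wdiff k r F h) := by
  rw [← normP_comp_neg p (wdiff k r F h)]
  exact eLpNorm_congr_enorm_ae (Filter.Eventually.of_forall fun x =>
    enorm_wdiff_comp_neg k r F h x)

theorem normP_wdiff_congr {F F' : ℝ → ℝ}
    (hF : F =ᵐ[volume.restrict (Icc (-1 : ℝ) 1)] F') (k r : ℕ) (p : ℝ≥0∞) {h : ℝ} (hh : 0 ≤ h) :
    normP p (wdiff k r F h) = normP p (wdiff k r F' h) := by
  refine eLpNorm_congr_ae (ae_restrict_of_ae ?_)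
  filter_upwards [symmDelta_ae_eq (k := k) hh hF] with x hx
  unfold wdiff
  rw [hx]

theorem KFunctional_congr {F F' : ℝ → ℝ}
    (hF : F =ᵐ[volume.restrict (Icc (-1 : ℝ) 1)] F') (k r : ℕ) (p : ℝ≥0∞) (s : ℝ) :
    KFunctional k r p F s = KFunctional k r p F' s := by
  unfold KFunctional
  refine iInf_congr fun g => iInf_congr fun _ => ?_
  congr 1
  refine eLpNorm_congr_ae ?_
  filter_upwards [hF] with x hx
  rw [hx]

theorem symmDelta_const_ae_eq {F F' : ℝ → ℝ}
    (hF : F =ᵐ[volume.restrict (Icc (-1 : ℝ) 1)] F') (k : ℕ) {h : ℝ} (hh : 0 ≤ h) :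
    (fun x => symmDelta k h F x) =ᵐ[volume] fun x => symmDelta k h F' x := by
  have hF' := (ae_restrict_iff' measurableSet_Icc).1 hF
  have h1 : ∀ᵐ x : ℝ, ∀ i ∈ Finset.range (k + 1),
      x + ((i : ℝ) - (k : ℝ) / 2) * h ∈ Icc (-1 : ℝ) 1 →
      F (x + ((i : ℝ) - (k : ℝ) / 2) * h) = F' (x + ((i : ℝ) - (k : ℝ) / 2) * h) := by
    rw [Finset.eventually_all]
    intro i _
    exact (measurePreserving_add_right volume
      (((i : ℝ) - (k : ℝ) / 2) * h)).quasiMeasurePreserving.ae hF'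
  filter_upwards [h1] with x hx
  unfold symmDelta symmDiffOn
  split_ifs with hc
  · refine Finset.sum_congr rfl fun i hi => ?_
    rw [hx i hi]
    obtain ⟨h2, h3⟩ := abs_le.1 (abs_node_le hh hi)
    exact ⟨by linarith [hc.2.1], by linarith [hc.1.2]⟩
  · rfl

theorem weightedDTModulus_congr {F F' : ℝ → ℝ}
    (hF : F =ᵐ[volume.restrict (Icc (-1 : ℝ) 1)] F') (k r : ℕ) (p : ℝ≥0∞) (t : ℝ) :
    weightedDTModulus k (fun x => phi x ^ r) p F t =
      weightedDTModulus k (fun x => phi x ^ r) p F' t := by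
  unfold weightedDTModulus
  simp only
  congr 1
  · congr 1
    · refine iSup_congr fun h => iSup_congr fun hh => eLpNorm_congr_ae (ae_restrict_of_ae ?_)
      filter_upwards [symmDelta_ae_eq (k := k) hh.1.le hF] with x hx
      rw [hx]
    · refine iSup_congr fun h => iSup_congr fun hh => eLpNorm_congr_ae (ae_restrict_of_ae ?_)
      filter_upwards [(measurePreserving_add_right volume
        (k * h / 2)).quasiMeasurePreserving.ae (symmDelta_const_ae_eq hF k hh.1.le)] with x hx
      unfold forwardDelta
      rw [hx]
  · refine iSup_congr fun h => iSup_congr fun hh => eLpNorm_congr_ae (ae_restrict_of_ae ?_)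
    filter_upwards [(measurePreserving_add_right volume
      (-(k * h / 2))).quasiMeasurePreserving.ae (symmDelta_const_ae_eq hF k hh.1.le)] with x hx
    unfold backwardDelta
    rw [sub_eq_add_neg, hx]

/-- The interior and the left end point term of the weighted Ditzian–Totik modulus are bounded by
the whole modulus. -/
theorem DT_terms_le (k r : ℕ) (p : ℝ≥0∞) (F : ℝ → ℝ) (t : ℝ) :
    (⨆ h ∈ Ioc (0 : ℝ) t, eLpNorm (fun x => phi x ^ r * symmDelta k (h * phi x) F x) p
        (volume.restrict (Icc (-1 + 2 * (k : ℝ) ^ 2 * t ^ 2) (1 - 2 * (k : ℝ) ^ 2 * t ^ 2)))) +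
      (⨆ h ∈ Ioc (0 : ℝ) (2 * (k : ℝ) ^ 2 * t ^ 2),
        eLpNorm (fun x => phi x ^ r * forwardDelta k h F x) p
          (volume.restrict (Icc (-1) (-1 + 12 * (2 * (k : ℝ) ^ 2 * t ^ 2))))) ≤
      weightedDTModulus k (fun x => phi x ^ r) p F t := le_self_add

theorem weightedDTModulus_comp_neg (k r : ℕ) (p : ℝ≥0∞) (F : ℝ → ℝ) (t : ℝ) :
    weightedDTModulus k (fun x => phi x ^ r) p (fun x => F (-x)) t =
      weightedDTModulus k (fun x => phi x ^ r) p F t := by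
  unfold weightedDTModulus
  simp only
  simp_rw [eLpNorm_backwardDelta, neg_neg]
  rw [add_assoc, add_assoc]
  congr 1
  · refine iSup_congr fun h => iSup_congr fun hh => ?_
    rw [← eLpNorm_restrict_neg (fun x => phi x ^ r * symmDelta k (h * phi x) F x), Set.neg_Icc]
    rw [show -(1 - 2 * (k : ℝ) ^ 2 * t ^ 2) = -1 + 2 * (k : ℝ) ^ 2 * t ^ 2 by ring,
      show -(-1 + 2 * (k : ℝ) ^ 2 * t ^ 2) = 1 - 2 * (k : ℝ) ^ 2 * t ^ 2 by ring]
    refine eLpNorm_congr_enorm_ae (Filter.Eventually.of_forall fun x => ?_)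
    rw [enorm_mul, enorm_mul, phi_neg, symmDelta_comp_neg, enorm_neg_one_pow_mul]
  · exact add_comm _ _

/-! ### The lower estimates for the moduli -/

/-- For a given `t` there is a partition with `n ~ 1/t`, so fine that the relative steps of all the
differences used in its cells are at most `t`. -/
theorem exists_cell_number (m : ℕ) {t : ℝ} (ht : 0 < t) (ht1 : t ≤ 1) :
    ∃ n : ℕ, 16 * (m + 1 + 1) ^ 2 ≤ n ∧ 16 * ((m : ℝ) + 1 + 1) ^ 2 ≤ n * t ∧
      n * t ≤ 16 * ((m : ℝ) + 1 + 1) ^ 2 + 1 := by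
  set c : ℝ := 16 * ((m : ℝ) + 1 + 1) ^ 2 with hc
  have hc0 : 0 ≤ c := by positivity
  have h1 : c ≤ ⌈c / t⌉₊ * t := by
    rw [← div_le_iff₀ ht]; exact Nat.le_ceil _
  refine ⟨⌈c / t⌉₊, ?_, h1, ?_⟩
  · have h2 : c ≤ ⌈c / t⌉₊ := h1.trans (mul_le_of_le_one_right (Nat.cast_nonneg _) ht1)
    refine (Nat.cast_le (α := ℝ)).1 ?_
    push_cast
    exact h2
  · have h2 := (Nat.ceil_lt_add_one (div_nonneg hc0 ht.le)).le
    calc (⌈c / t⌉₊ : ℝ) * t ≤ (c / t + 1) * t := by gcongr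
      _ = c + t := by field_simp
      _ ≤ c + 1 := by linarith

/-- The `K`-functional is bounded by the averaged modulus, and for small `t` by the weighted
Ditzian–Totik modulus. -/
theorem exists_KFunctional_le_moduli (m r : ℕ) {p : ℝ≥0∞} (hp : 1 ≤ p) :
    ∃ C : ℝ≥0, 0 < C ∧ ∀ F : ℝ → ℝ, AEStronglyMeasurable F (volume.restrict (Icc (-1 : ℝ) 1)) →
      Integrable (fun x => F x * phi x ^ r) (volume.restrict (Icc (-1 : ℝ) 1)) →
      ∀ t : ℝ, 0 < t → t ≤ 1 →
        KFunctional (m + 1) r p F (t ^ (m + 1)) ≤ C * avgModulus (m + 1) r p F t ∧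
        (2 * ((m + 1 : ℕ) : ℝ) ^ 2 * t ^ 2 ≤ 1 / 2 → KFunctional (m + 1) r p F (t ^ (m + 1)) ≤
          C * weightedDTModulus (m + 1) (fun x => phi x ^ r) p F t) := by
  obtain ⟨C₁, h₁⟩ := exists_KFunctional_le_eLpNorm_weightedFd m r hp
  obtain ⟨C₂, h₂⟩ := exists_eLpNorm_weightedFd_le_avgModulus m r hp
  obtain ⟨C₃, h₃⟩ := exists_eLpNorm_weightedFd_le_weightedDTModulus m r hp
  refine ⟨C₁ * (2 * (C₂ + C₃)) + 1, by positivity, fun F₀ hF₀ hFi₀ t ht ht1 => ?_⟩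
  -- All quantities are unchanged if `F₀` is replaced by a Borel representative.
  obtain ⟨F, hFs, hae⟩ := hF₀
  have hF : Measurable F := hFs.measurable
  have hFi : Integrable (fun x => F x * phi x ^ r) (volume.restrict (Icc (-1 : ℝ) 1)) := by
    refine hFi₀.congr ?_
    filter_upwards [hae] with x hx
    rw [hx]
  have hF' : Measurable fun x => F (-x) := hF.comp measurable_neg
  obtain ⟨n, hn, hnt, hnt'⟩ := exists_cell_number m ht ht1
  have hK := h₁ F hF hFi n hn t ht hnt'
  rw [KFunctional_congr hae, avgModulus_congr hp (fun τ hτ => normP_wdiff_congr hae _ _ _ hτ),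
    weightedDTModulus_congr hae]
  -- A bound `M` which is invariant under reflection serves for both halves of `[-1, 1]`.
  have hfin : ∀ {C : ℝ≥0} {M : ℝ≥0∞}, C ≤ C₂ + C₃ →
      eLpNorm (weightedFd (m + 1) r F) p (leftMeasure (m + 1) n) ≤ C * M →
      eLpNorm (weightedFd (m + 1) r fun x => F (-x)) p (leftMeasure (m + 1) n) ≤ C * M →
      KFunctional (m + 1) r p F (t ^ (m + 1)) ≤ (C₁ * (2 * (C₂ + C₃)) + 1 : ℝ≥0) * M := by
    intro C M hC ha hb
    refine hK.trans ((mul_le_mul' le_rfl (add_le_add ha hb)).trans ?_)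
    rw [← two_mul, ← mul_assoc, ← mul_assoc]
    refine mul_le_mul' ?_ le_rfl
    have e : (C₁ : ℝ≥0∞) * 2 * C = ((C₁ * 2 * C : ℝ≥0) : ℝ≥0∞) := by push_cast; rfl
    rw [e, ENNReal.coe_le_coe]
    calc C₁ * 2 * C ≤ C₁ * 2 * (C₂ + C₃) := by gcongr
      _ ≤ C₁ * (2 * (C₂ + C₃)) + 1 := by rw [mul_assoc]; exact le_self_add
  constructor
  · refine hfin (C := C₂) le_self_add (h₂ F hF n hn t ht hnt hnt') ?_
    have := h₂ _ hF' n hn t ht hnt hnt'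
    rwa [avgModulus_congr hp (fun τ _ => normP_wdiff_comp_neg _ _ _ F τ)] at this
  · intro ht2
    refine hfin (C := C₃) le_add_self ((h₃ F hF n hn t ht hnt hnt' ht2).trans
      (mul_le_mul' le_rfl (DT_terms_le _ _ _ _ _))) ?_
    refine (h₃ _ hF' n hn t ht hnt hnt' ht2).trans (mul_le_mul' le_rfl
      ((DT_terms_le _ _ _ _ _).trans_eq ?_))
    exact weightedDTModulus_comp_neg _ _ _ _ _

theorem KFunctional_mul_le (k r : ℕ) (p : ℝ≥0∞) (F : ℝ → ℝ) {a : ℝ} (ha : 1 ≤ a) (s : ℝ) :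
    KFunctional k r p F (a * s) ≤ ENNReal.ofReal a * KFunctional k r p F s := by
  refine le_mul_iInf_mem (by simp; linarith) ENNReal.ofReal_ne_top fun g hg => ?_
  refine (iInf₂_le g hg).trans ?_
  rw [mul_add, ENNReal.ofReal_mul (by linarith), ← mul_assoc]
  refine add_le_add (le_mul_of_one_le_left zero_le ?_) le_rfl
  rw [← ENNReal.ofReal_one]
  exact ENNReal.ofReal_le_ofReal ha

/-- Halving `t` costs at most a factor `2`, since the mean is over half the interval. -/
theorem avgModulus_half_le (k r : ℕ) {p : ℝ≥0∞} (hp : 1 ≤ p) (F : ℝ → ℝ) {t : ℝ} (ht : 0 < t) :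
    avgModulus k r p F (t / 2) ≤ 2 * avgModulus k r p F t := by
  rcases eq_or_ne p ∞ with rfl | hpt
  · rw [avgModulus, avgModulus, if_pos rfl, if_pos rfl]
    refine le_trans ?_ (le_mul_of_one_le_left zero_le one_le_two)
    exact biSup_mono fun h hh => ⟨hh.1, by linarith [hh.2]⟩
  have hp0 : p ≠ 0 := (zero_lt_one.trans_le hp).ne'
  have hpr : 0 < p.toReal := ENNReal.toReal_pos hp0 hpt
  rw [avgModulus_eq k r hp hpt, avgModulus_eq k r hp hpt]
  have h2 : ENNReal.ofReal (1 / (t / 2)) = 2 * ENNReal.ofReal (1 / t) := by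
    rw [show 1 / (t / 2) = 2 * (1 / t) by field_simp, ENNReal.ofReal_mul (by norm_num)]
    simp
  have h3 : (2 : ℝ≥0∞) ^ (1 / p.toReal) ≤ 2 := by
    have := ennreal_rpow_inv_le_self (c := 2) one_le_two hp
    rwa [ENNReal.toReal_div, ENNReal.toReal_one] at this
  rw [h2, mul_assoc]
  refine le_trans (ENNReal.rpow_le_rpow (z := 1 / p.toReal) (mul_le_mul' (le_refl 2)
    (mul_le_mul' le_rfl (lintegral_mono_set (t := Ioc 0 t)
      (Ioc_subset_Ioc le_rfl (by linarith))))) (by positivity)) ?_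
  rw [ENNReal.mul_rpow_of_nonneg _ _ (by positivity)]
  exact mul_le_mul' h3 le_rfl

theorem measurable_and_integrable_of_mem_BSpace {p : ℝ≥0∞} (hp : 1 ≤ p) {r : ℕ} {f : ℝ → ℝ}
    (hf : f ∈ BSpace p r) :
    AEStronglyMeasurable (iteratedDeriv r f) (volume.restrict (Icc (-1 : ℝ) 1)) ∧
      Integrable (fun x => iteratedDeriv r f x * phi x ^ r) (volume.restrict (Icc (-1 : ℝ) 1)) := by
  cases r with
  | zero =>
    have h : MemLp f p (volume.restrict (Icc (-1 : ℝ) 1)) := hf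
    simp only [iteratedDeriv_zero, pow_zero, mul_one]
    exact ⟨h.1, h.integrable hp⟩
  | succ r =>
    refine ⟨?_, hf.2.2.integrable hp⟩
    rw [iteratedDeriv_succ]
    exact (measurable_deriv _).aestronglyMeasurable

end DTModuli

theorem mainTheorem1 (k r : ℕ) (hk : 1 ≤ k) (p : ℝ≥0∞) (hp : 1 ≤ p) :
    (∃ c C : ℝ≥0, 0 < c ∧ 0 < C ∧
      ∀ f ∈ DTModuli.BSpace p r, ∀ t : ℝ, 0 < t → t ≤ 2 / (k : ℝ) →
        c * DTModuli.KFunctional k r p (iteratedDeriv r f) (t ^ k) ≤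
            DTModuli.avgModulus k r p (iteratedDeriv r f) t ∧
          DTModuli.avgModulus k r p (iteratedDeriv r f) t ≤
            DTModuli.modulus k r p (iteratedDeriv r f) t ∧
          DTModuli.modulus k r p (iteratedDeriv r f) t ≤
            C * DTModuli.KFunctional k r p (iteratedDeriv r f) (t ^ k)) ∧
    (∃ (c C : ℝ≥0) (t₀ : ℝ), 0 < c ∧ 0 < C ∧ 0 < t₀ ∧
      ∀ f ∈ DTModuli.BSpace p r, ∀ t : ℝ, 0 < t → t ≤ t₀ →
        c * DTModuli.weightedDTModulus k (fun x => DTModuli.phi x ^ r) p (iteratedDeriv r f) t ≤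
            DTModuli.avgModulus k r p (iteratedDeriv r f) t ∧
          DTModuli.avgModulus k r p (iteratedDeriv r f) t ≤
            DTModuli.modulus k r p (iteratedDeriv r f) t ∧
          DTModuli.modulus k r p (iteratedDeriv r f) t ≤
            C * DTModuli.weightedDTModulus k (fun x => DTModuli.phi x ^ r) p
              (iteratedDeriv r f) t) := by
  obtain ⟨m, rfl⟩ : ∃ m, k = m + 1 := ⟨k - 1, by omega⟩
  obtain ⟨A, hA, hmod⟩ := DTModuli.exists_modulus_le_KFunctional m r hp
  obtain ⟨B, hB, hDT⟩ := DTModuli.exists_weightedDTModulus_le_KFunctional m r hp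
  obtain ⟨C, hC, hlow⟩ := DTModuli.exists_KFunctional_le_moduli m r hp
  have hinv : ∀ {a : ℝ≥0} {X Y : ℝ≥0∞}, 0 < a → X ≤ a * Y → ((a⁻¹ : ℝ≥0) : ℝ≥0∞) * X ≤ Y := by
    intro a X Y ha h
    calc _ ≤ ((a⁻¹ : ℝ≥0) : ℝ≥0∞) * (a * Y) := mul_le_mul' le_rfl h
      _ = Y := by
        rw [← mul_assoc, ← ENNReal.coe_mul, inv_mul_cancel₀ ha.ne', ENNReal.coe_one, one_mul]
  constructor
  · set c : ℝ≥0 := 2 ^ (m + 1) * (C * 2) with hc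
    have hc0 : 0 < c := by positivity
    refine ⟨c⁻¹, A, inv_pos.2 hc0, hA, fun f hf t ht ht2 => ?_⟩
    obtain ⟨hFm, hFi⟩ := DTModuli.measurable_and_integrable_of_mem_BSpace hp hf
    refine ⟨hinv hc0 ?_, DTModuli.avgModulus_le_modulus _ r hp _ ht, hmod _ hFm t ht⟩
    have ht1 : t / 2 ≤ 1 := by
      have h1 : 2 / ((m + 1 : ℕ) : ℝ) ≤ 2 := by
        refine div_le_self (by norm_num) ?_
        exact_mod_cast Nat.succ_le_succ (Nat.zero_le m)
      linarith
    -- For `k = 1` the admissible `t` go up to `2`, while the partitions need `t ≤ 1`.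
    have h1 := (hlow _ hFm hFi (t / 2) (by positivity) ht1).1
    have h2 := DTModuli.KFunctional_mul_le (m + 1) r p (iteratedDeriv r f)
      (one_le_pow₀ (n := m + 1) (one_le_two (α := ℝ))) ((t / 2) ^ (m + 1))
    rw [← mul_pow, mul_div_cancel₀ t (two_ne_zero)] at h2
    refine h2.trans ((mul_le_mul' le_rfl (h1.trans (mul_le_mul' le_rfl
      (DTModuli.avgModulus_half_le _ r hp _ ht)))).trans_eq ?_)
    rw [hc, ENNReal.ofReal_pow (by norm_num)]
    push_cast
    rw [ENNReal.ofReal_ofNat]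
    ring
  · set t₀ : ℝ := 1 / (8 * ((m : ℝ) + 1 + 1) ^ 2) with ht₀
    refine ⟨(B * C)⁻¹, A * C, t₀, by positivity, by positivity, by positivity,
      fun f hf t ht htt => ?_⟩
    obtain ⟨hFm, hFi⟩ := DTModuli.measurable_and_integrable_of_mem_BSpace hp hf
    have hm : (0 : ℝ) ≤ m := Nat.cast_nonneg m
    have hM1 : (4 : ℝ) ≤ ((m : ℝ) + 1 + 1) ^ 2 := by nlinarith
    have htM : 8 * ((m : ℝ) + 1 + 1) ^ 2 * t ≤ 1 := by
      rw [ht₀, le_div_iff₀ (by positivity)] at htt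
      linarith
    have ht1 : t ≤ 1 := by nlinarith
    have hsmall : (12 + ((m : ℝ) + 1)) * (2 * ((m + 1 : ℕ) : ℝ) ^ 2 * t ^ 2) ≤ 1 := by
      push_cast
      set s := (m : ℝ) + 1 with hs
      have hs1 : 1 ≤ s := by linarith
      have h1 : (8 * (s + 1) ^ 2 * t) ^ 2 ≤ 1 := pow_le_one₀ (by positivity) htM
      have h2 : (12 + s) * (2 * s ^ 2) ≤ (8 * (s + 1) ^ 2) ^ 2 := by
        have : 0 ≤ s ^ 3 := by positivity
        nlinarith [sq_nonneg s, sq_nonneg (s ^ 2)]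
      calc _ = ((12 + s) * (2 * s ^ 2)) * t ^ 2 := by ring
        _ ≤ (8 * (s + 1) ^ 2) ^ 2 * t ^ 2 := by gcongr
        _ ≤ 1 := by rw [← mul_pow]; exact h1
    have hsmall2 : 2 * ((m + 1 : ℕ) : ℝ) ^ 2 * t ^ 2 ≤ 1 / 2 := by
      have : 0 ≤ 2 * ((m + 1 : ℕ) : ℝ) ^ 2 * t ^ 2 := by positivity
      nlinarith
    obtain ⟨h1, h2⟩ := hlow _ hFm hFi t ht ht1
    refine ⟨hinv (mul_pos hB hC) ?_, DTModuli.avgModulus_le_modulus _ r hp _ ht, ?_⟩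
    · refine (hDT _ hFm t ht hsmall).trans ((mul_le_mul' le_rfl h1).trans_eq ?_)
      push_cast
      ring
    · refine (hmod _ hFm t ht).trans ((mul_le_mul' le_rfl (h2 hsmall2)).trans_eq ?_)
      push_cast
      ring
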